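/- Consider $N$ followers $x_{i,k+1}=Ax_{i,k}+B_iu_{i,k}+E_iw_{i,k}$ and a leader $x_{0,k+1}=Ax_{0,k}$ on a directed graph with weights $a_{ij}\ge 0$, $a_{ii}=0$, neighbour sets $N_i=\{j: a_{ij}>0\}$, in-degrees $d_i=\sum_{j\in N_i}a_{ij}$ and pinning gains $g_i\in\{0,1\}$. The local neighbourhood tracking error $\delta_i=\sum_{j\in N_i}a_{ij}(x_j-x_i)+g_i(x_0-x_i)$ of agent $i$ obeys $$\delta_{i,k+1}=f_i(\delta_{i,k},u_{i,k},v_{i,k}):=A\delta_{i,k}-(d_i+g_i)B_iu_{i,k}+\sum_{j\in N_i}a_{ij}B_ju_{j,k}-(d_i+g_i)E_iw_{i,k}+\sum_{j\in N_i}a_{ij}E_jw_{j,k},$$ where $v_i=(u_{-i},w_i,w_{-i})=((u_j)_{j\in N_i},w_i,(w_j)_{j\in N_i})$ collects the inputs that agent $i$ regards as adversarial. Let $\beta>0$, $Q_{ii}>0$, $R_{ii}>0$, let $$r_i(\delta,u,v)=\delta^\top Q_{ii}\delta+u^\top R_{ii}u-\beta^2\Big(\sum_{j\in N_i}u_j^\top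 R_{ij}u_j+w_i^\top T_{ii}w_i+\sum_{j\in N_i}w_j^\top T_{ij}w_j\Big),$$ and let $\mathcal J_i=\sum_{k\ge0}r_i(\delta_{i,k},u_{i,k},v_{i,k})$. A minmax strategy of agent $i$ is a state feedback $u_{i,k}=\mu_k(\delta_{i,k})$ minimizing, for every $\delta_{i,0}$, the maximum of $\mathcal J_i$ over all square-summable adversarial sequences $v_i$. The DTHJ equation of agent $i$ is $$\mathcal V_i(\delta)=\min_u\max_v\{r_i(\delta,u,v)+\mathcal V_i(f_i(\delta,u,v))\},$$ that is, the Bellman equation $\mathcal V_i(\delta)=r_i(\delta,u^*,v^*)+\mathcal V_i(\delta^+)$, $\delta^+=f_i(\delta,u^*,v^*)$, along the stationary policies $u_i^*=\frac{d_i+g_i}{2}R_{ii}^{-1}B_i^\top\nabla\mathcal V_i(\delta^+)$, $w_i^*=-\frac{d_i+g_i}{2\beta^2}T_{ii}^{-1}E_i^\top\nabla\mathcal V_i(\delta^+)$, $u_j^*=\frac{a_{ij}}{2\beta^2}R_{ij}^{-1}B_j^\top\nabla\mathcal V_i(\delta^+)$, $w_j^*=\frac{a_{ij}}{2\beta^2}T_{ij}^{-1}E_j^\top\nabla\mathcal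 V_i(\delta^+)$ for $j\in N_i$. All agents simultaneously run the following policy iteration. Initially $u_i^0=K_i^0\delta_i$ is admissible, i.e. $\delta_i\mapsto f_i(\delta_i,K_i^0\delta_i,0)$ is asymptotically stable, and the adversarial policies are zero. At outer step $h$ and inner step $z$: (evaluation) find $\mathcal Q_i^{h,z}(\delta,u,v)=r_i(\delta,u,v)+\mathcal V_i^{h,z}(f_i(\delta,u,v))$ with $\mathcal V_i^{h,z}$ a quadratic form such that $\mathcal V_i^{h,z}(\delta)=\mathcal Q_i^{h,z}(\delta,u_i^h(\delta),v_i^{h,z}(\delta))$, so that $\mathcal Q_i^{h,z}(\delta,u^h_i,v^{h,z}_i)=r_i(\delta,u_i^h,v_i^{h,z})+\mathcal Q_i^{h,z}(\delta^+,u_i^h,v_i^{h,z})$; (inner update) let each of the three components $u_{-i},w_i,w_{-i}$ of $v_i^{h,z+1}(\delta)$ maximize $\mathcal Q_i^{h,z}(\delta,u_i^h(\delta),\cdot)$ with the other two components kept at $v_i^{h,z}(\delta)$. After the inner loop has been run to its limit $v_i^{h,\infty},\mathcal Q_i^{h,\infty}$, (outer update) set $u_i^{h+1}(\delta)=\arg\min_u\mathcal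 Q_i^{h,\infty}(\delta,u,v_i^{h,\infty}(\delta))$; the next inner loop starts from $0$ or from $v_i^{h,\infty}$ (either choice may be made each time). **Theorem.** For given dynamics, graph, $\beta$, $Q_{ii}>0$, $R_{ii}>0$ (arbitrarily large or not) and admissible $K_i^0$ ($i=1,\dots,N$) there is $\tau>0$ such that, for all symmetric adversarial weights with $R_{ij}\ge\tau I$, $T_{ii}\ge\tau I$, $T_{ij}\ge\tau I$ for all $i$ and all $j\in N_i$, the following holds for every $i$. There are a positive definite quadratic solution $\mathcal V_i^*$ of the DTHJ equation of agent $i$ and a fully distributed linear feedback $u_i^*=K_i^*\delta_i$, attaining the minimum in it, which is a minmax strategy with worst-case cost $\mathcal V_i^*(\delta_{i,0})$. The policy iteration can be carried out; in every run of it each inner loop converges, $u_i^h\to u_i^*$, and $\mathcal Q_i^{h,\infty}\to\mathcal Q_i^*:=r_i+\mathcal V_i^*\circ f_i$ pointwise as $h\to\infty$. Moreover, for every tolerance $\epsilon>0$ the inner stopping criterion $\max_v\mathcal Q_i^{h,z}-\mathcal Q_i^{h,z}\le\epsilon\|\delta\|^2$ is met for all large $z$, and the outer criterion $\mathcal Q_i^{h,z}-\min_u\mathcal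 Q_i^{h,z}\le\epsilon\|\delta\|^2$ for all large $h$ and then all large $z$ (the gaps being taken at $u_i^h(\delta)$, $v_i^{h,z}(\delta)$, for all $\delta$). -/

import Mathlib

open Filter Topology Matrix
open scoped ENNReal

noncomputable section

namespace GraphicalGame

/-- A leader with dynamics `x₀⁺ = A x₀` and `N` followers `xᵢ⁺ = A xᵢ + Bᵢ uᵢ + Eᵢ wᵢ` on a weighted
directed graph without self-loops; `adj i j = a_{ij}`, and `g i` is the pinning gain. -/
structure MultiAgentSystem (N n p q : ℕ) where
  A : Matrix (Fin n) (Fin n) ℝ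
  B : Fin N → Matrix (Fin n) (Fin p) ℝ
  E : Fin N → Matrix (Fin n) (Fin q) ℝ
  adj : Fin N → Fin N → ℝ
  g : Fin N → ℝ
  adj_nonneg : ∀ i j, 0 ≤ adj i j
  adj_self : ∀ i, adj i i = 0
  g_mem : ∀ i, g i = 0 ∨ g i = 1

/-- The weights of the cost functions, `R i j = R_{ij}`, `T i j = T_{ij}`, and the attenuation
level `β`. Only the entries with `j = i` or `j` a neighbour of `i` are ever used. -/
structure CostWeights (N n p q : ℕ) where
  β : ℝ
  Q : Fin N → Matrix (Fin n) (Fin n) ℝ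
  R : Fin N → Fin N → Matrix (Fin p) (Fin p) ℝ
  T : Fin N → Fin N → Matrix (Fin q) (Fin q) ℝ

/-- The quadratic form `x ↦ xᵀ P x`. -/
def quad {m : ℕ} (P : Matrix (Fin m) (Fin m) ℝ) (x : Fin m → ℝ) : ℝ := x ⬝ᵥ (P *ᵥ x)

/-- The gradient `2 P x` of `x ↦ xᵀ P x` for symmetric `P`. -/
def gradQuad {m : ℕ} (P : Matrix (Fin m) (Fin m) ℝ) (x : Fin m → ℝ) : Fin m → ℝ :=
  (2 : ℝ) • (P *ᵥ x)

variable {N n p q : ℕ}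

namespace MultiAgentSystem

/-- The neighbours `N_i = {j | a_{ij} > 0}` of agent `i`. -/
abbrev Nbr (S : MultiAgentSystem N n p q) (i : Fin N) : Type := {j : Fin N // 0 < S.adj i j}

/-- What agent `i` treats as adversarial: the controls of its neighbours, its own disturbance, and
the disturbances of its neighbours, `(u_{-i}, w_i, w_{-i})`. -/
abbrev Adv (S : MultiAgentSystem N n p q) (i : Fin N) : Type :=
  (S.Nbr i → Fin p → ℝ) × (Fin q → ℝ) × (S.Nbr i → Fin q → ℝ)

/-- `d_i + g_i`, with `d_i` the in-degree. -/
def gain (S : MultiAgentSystem N n p q) (i : Fin N) : ℝ := (∑ j : S.Nbr i, S.adj i j) + S.g i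

/-- The dynamics of the local neighbourhood tracking error of agent `i`. -/
def next (S : MultiAgentSystem N n p q) (i : Fin N) (x : Fin n → ℝ) (u : Fin p → ℝ)
    (v : S.Adv i) : Fin n → ℝ :=
  S.A *ᵥ x - S.gain i • (S.B i *ᵥ u) + ∑ j : S.Nbr i, S.adj i j • (S.B j *ᵥ v.1 j)
    - S.gain i • (S.E i *ᵥ v.2.1) + ∑ j : S.Nbr i, S.adj i j • (S.E j *ᵥ v.2.2 j)

/-- The feedback `u_i = K δ_i` is admissible: in the absence of adversarial inputs it makes the
local error dynamics of agent `i` asymptotically stable (its quadratic cost is then finite). -/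
def Admissible (S : MultiAgentSystem N n p q) (i : Fin N) (K : Matrix (Fin p) (Fin n) ℝ) : Prop :=
  ∀ x : Fin n → ℝ, Tendsto (fun k : ℕ => (fun y => S.next i y (K *ᵥ y) 0)^[k] x) atTop (𝓝 0)

/-- The state of agent `i` from `x₀` under the (possibly nonlinear and time-varying) state feedback
`u_{i,k} = μ k δ_{i,k}` and the adversarial input sequence `v`. -/
def traj (S : MultiAgentSystem N n p q) (i : Fin N) (μ : ℕ → (Fin n → ℝ) → Fin p → ℝ)
    (v : ℕ → S.Adv i) (x₀ : Fin n → ℝ) : ℕ → Fin n → ℝ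
  | 0 => x₀
  | k + 1 => S.next i (S.traj i μ v x₀ k) (μ k (S.traj i μ v x₀ k)) (v k)

/-- The adversarial input sequence has finite energy (is in `L₂[0,∞)`). -/
def FiniteEnergy (S : MultiAgentSystem N n p q) (i : Fin N) (v : ℕ → S.Adv i) : Prop :=
  Summable fun k => ∑ j : S.Nbr i, (v k).1 j ⬝ᵥ (v k).1 j + (v k).2.1 ⬝ᵥ (v k).2.1
    + ∑ j : S.Nbr i, (v k).2.2 j ⬝ᵥ (v k).2.2 j

end MultiAgentSystem

variable (S : MultiAgentSystem N n p q) (C : CostWeights N n p q)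

/-- The part `δᵀ Q_{ii} δ + uᵢᵀ R_{ii} uᵢ` of the stage cost. -/
def ownCost (i : Fin N) (x : Fin n → ℝ) (u : Fin p → ℝ) : ℝ := quad (C.Q i) x + quad (C.R i i) u

/-- `∑ⱼ uⱼᵀ R_{ij} uⱼ + wᵢᵀ T_{ii} wᵢ + ∑ⱼ wⱼᵀ T_{ij} wⱼ`. -/
def advCost (i : Fin N) (v : S.Adv i) : ℝ :=
  ∑ j : S.Nbr i, quad (C.R i j) (v.1 j) + quad (C.T i i) v.2.1
    + ∑ j : S.Nbr i, quad (C.T i j) (v.2.2 j)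

/-- The stage cost of the non-cooperative game. -/
def stageCost (i : Fin N) (x : Fin n → ℝ) (u : Fin p → ℝ) (v : S.Adv i) : ℝ :=
  ownCost C i x u - C.β ^ 2 * advCost S C i v

/-- The cost `∑ₖ stageCost`, for an adversarial sequence of finite energy: the first series has
non-negative terms and may be `+∞`, the second one converges. -/
def totalCost (i : Fin N) (x₀ : Fin n → ℝ) (μ : ℕ → (Fin n → ℝ) → Fin p → ℝ)
    (v : ℕ → S.Adv i) : EReal :=
  ((∑' k, ENNReal.ofReal (ownCost C i (S.traj i μ v x₀ k) (μ k (S.traj i μ v x₀ k))) : ℝ≥0∞) : EReal)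
    - ((∑' k, C.β ^ 2 * advCost S C i (v k) : ℝ) : EReal)

/-- The worst-case cost of the state feedback `μ` over all adversarial inputs of finite energy. -/
def worstCost (i : Fin N) (x₀ : Fin n → ℝ) (μ : ℕ → (Fin n → ℝ) → Fin p → ℝ) : EReal :=
  ⨆ v : {v : ℕ → S.Adv i // S.FiniteEnergy i v}, totalCost S C i x₀ μ v.1

/-- `μ` is a minmax strategy of agent `i`: for every initial error, the maximum of the cost over the
adversarial inputs is attained, and no other state feedback has a smaller worst case. -/
def IsMinmaxStrategy (i : Fin N) (μ : ℕ → (Fin n → ℝ) → Fin p → ℝ) : Prop :=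
  ∀ x₀, (∃ v, S.FiniteEnergy i v ∧ totalCost S C i x₀ μ v = worstCost S C i x₀ μ) ∧
    ∀ μ', worstCost S C i x₀ μ ≤ worstCost S C i x₀ μ'

/-- The Q-function `r(δ, u, v) + V(δ⁺)` of a value function `V`. -/
def qOfValue (i : Fin N) (V : (Fin n → ℝ) → ℝ) (x : Fin n → ℝ) (u : Fin p → ℝ)
    (v : S.Adv i) : ℝ :=
  stageCost S C i x u v + V (S.next i x u v)

/-- `V(δ) = δᵀ P δ` solves the discrete-time Hamilton-Jacobi equation of agent `i`, with optimal
control `uS` and worst adversarial inputs `vS`: these have the stationary form, the Bellman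
equation holds along them, and `V(δ) = min_u max_v {r(δ, u, v) + V(δ⁺)}`. -/
structure SolvesDTHJ (i : Fin N) (P : Matrix (Fin n) (Fin n) ℝ)
    (uS : (Fin n → ℝ) → Fin p → ℝ) (vS : (Fin n → ℝ) → S.Adv i) : Prop where
  control : ∀ x, uS x = (S.gain i / 2) •
    ((C.R i i)⁻¹ *ᵥ ((S.B i)ᵀ *ᵥ gradQuad P (S.next i x (uS x) (vS x))))
  disturbance : ∀ x, (vS x).2.1 = (-(S.gain i / (2 * C.β ^ 2))) •
    ((C.T i i)⁻¹ *ᵥ ((S.E i)ᵀ *ᵥ gradQuad P (S.next i x (uS x) (vS x))))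
  nbr_control : ∀ x (j : S.Nbr i), (vS x).1 j = (S.adj i j / (2 * C.β ^ 2)) •
    ((C.R i j)⁻¹ *ᵥ ((S.B j)ᵀ *ᵥ gradQuad P (S.next i x (uS x) (vS x))))
  nbr_disturbance : ∀ x (j : S.Nbr i), (vS x).2.2 j = (S.adj i j / (2 * C.β ^ 2)) •
    ((C.T i j)⁻¹ *ᵥ ((S.E j)ᵀ *ᵥ gradQuad P (S.next i x (uS x) (vS x))))
  bellman : ∀ x, quad P x = stageCost S C i x (uS x) (vS x) + quad P (S.next i x (uS x) (vS x))
  max_attained : ∀ x u, ∃ m, IsGreatest (Set.range (qOfValue S C i (quad P) x u)) m ∧ quad P x ≤ m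
  minmax : ∀ x, IsGreatest (Set.range (qOfValue S C i (quad P) x (uS x))) (quad P x)

/-- `F` is the (quadratic) Q-function of the policies `u`, `v` of agent `i`, that is, the solution
of the equation in the policy-evaluation step. -/
def SolvesQEquation (i : Fin N) (u : (Fin n → ℝ) → Fin p → ℝ) (v : (Fin n → ℝ) → S.Adv i)
    (F : (Fin n → ℝ) → (Fin p → ℝ) → S.Adv i → ℝ) : Prop :=
  (∃ P : Matrix (Fin n) (Fin n) ℝ, P.IsSymm ∧
    (∀ x a b, F x a b = qOfValue S C i (quad P) x a b) ∧ ∀ x, F x (u x) (v x) = quad P x) ∧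
  ∀ x, F x (u x) (v x) = stageCost S C i x (u x) (v x) +
    F (S.next i x (u x) (v x)) (u (S.next i x (u x) (v x))) (v (S.next i x (u x) (v x)))

/-- `b` is the update of the adversarial inputs `b₀`: each of `u_{-i}`, `w_i`, `w_{-i}` maximizes
`f` with the other two kept at their old values. -/
def IsAdvUpdate {i : Fin N} (f : S.Adv i → ℝ) (b₀ b : S.Adv i) : Prop :=
  (∀ c, f (c, b₀.2.1, b₀.2.2) ≤ f (b.1, b₀.2.1, b₀.2.2)) ∧
  (∀ c, f (b₀.1, c, b₀.2.2) ≤ f (b₀.1, b.2.1, b₀.2.2)) ∧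
  (∀ c, f (b₀.1, b₀.2.1, c) ≤ f (b₀.1, b₀.2.1, b.2.2))

/-- A simultaneous run of the Q-function policy iteration by all agents, from the control policies
`u_i⁰ = K₀ᵢ δ_i` and vanishing adversarial policies. `u h i` is the control policy of agent `i` at
outer step `h`; `v h z i` are the adversarial policies and `F h z i` the Q-function at inner step
`z` of outer step `h`. The control is improved with the limits of the inner loop; a run in
which these limits do not exist is not constrained there. `warm h i` tells whether the inner loop
`h + 1` of agent `i` continues from the limit of the inner loop `h` or restarts from zero. -/
structure Run (K₀ : Fin N → Matrix (Fin p) (Fin n) ℝ) (warm : ℕ → Fin N → Bool) where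
  u : ℕ → Fin N → (Fin n → ℝ) → Fin p → ℝ
  v : ℕ → ℕ → (i : Fin N) → (Fin n → ℝ) → S.Adv i
  F : ℕ → ℕ → (i : Fin N) → (Fin n → ℝ) → (Fin p → ℝ) → S.Adv i → ℝ
  init_u : ∀ i x, u 0 i x = K₀ i *ᵥ x
  init_v : ∀ i x, v 0 0 i x = 0
  evaluate : ∀ h z i, SolvesQEquation S C i (u h i) (v h z i) (F h z i)
  improve_v : ∀ h z i x, IsAdvUpdate S (F h z i x (u h i x)) (v h z i x) (v h (z + 1) i x)
  improve_u : ∀ h i (vL : (Fin n → ℝ) → S.Adv i)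
    (FL : (Fin n → ℝ) → (Fin p → ℝ) → S.Adv i → ℝ),
    (∀ x, Tendsto (fun z => v h z i x) atTop (𝓝 (vL x))) →
    (∀ x a b, Tendsto (fun z => F h z i x a b) atTop (𝓝 (FL x a b))) →
    ∀ x a, FL x (u (h + 1) i x) (vL x) ≤ FL x a (vL x)
  restart : ∀ h i, warm h i = false → ∀ x, v (h + 1) 0 i x = 0
  continue_v : ∀ h i, warm h i = true → ∀ vL : (Fin n → ℝ) → S.Adv i,
    (∀ x, Tendsto (fun z => v h z i x) atTop (𝓝 (vL x))) → ∀ x, v (h + 1) 0 i x = vL x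

/-- The weights of agent `i`'s adversarial inputs, `R_{ij}`, `T_{ii}`, `T_{ij}` with `j` a neighbour
of `i`, are symmetric with all eigenvalues at least `τ`. -/
def AdvWeightsAtLeast (τ : ℝ) (i : Fin N) : Prop :=
  (C.T i i - τ • (1 : Matrix (Fin q) (Fin q) ℝ)).PosSemidef ∧
  ∀ j : S.Nbr i, (C.R i j - τ • (1 : Matrix (Fin p) (Fin p) ℝ)).PosSemidef ∧
    (C.T i j - τ • (1 : Matrix (Fin q) (Fin q) ℝ)).PosSemidef

end GraphicalGame

end

/-! The error dynamics of an agent involve only its own error and inputs, so each agent plays a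
separate zero-sum linear-quadratic game against one stacked adversarial vector `v` with
block-diagonal weight `W`. Heavy weights make this game a small perturbation of the linear-quadratic
regulator (LQR) without adversary. To make this precise, the adversarial policy is written `v = W⁻¹
M x` and `E = W⁻¹` is treated as a small parameter. Policy evaluation solves a discrete Lyapunov
equation and both improvements solve linear systems, so the inner update `advStep` and the outer
update `ctrlStep` are continuously differentiable in `(E, K, M)` wherever these equations are
uniquely solvable.

At `E = 0` the adversary has no influence: `advStep` does not depend on `M`, and `ctrlStep` is
policy iteration for the LQR. That iteration keeps stability, lowers the value at each step, and
converges to a stabilizing fixed point (`exists_tendsto_lqr_iterate`). The value is minimal there,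
so its derivative in `K` vanishes, and with it the derivative of the iteration
(`hasFDerivAt_lqrStep`): the fixed point is superattracting.

The perturbation argument is `nested_converges`. For small `E` the inner map contracts by 1/2 in
`M`, and its fixed point is Lipschitz in `K`, so near the LQR limit the outer map contracts by 1/2
as well. From the given `K₀`, a fixed finite number of outer steps shadows the LQR orbit until it
enters this region. Along the way the open conditions `WellPosed` hold, and they make all updates
unique. A lower bound `τ` on the weights bounds all entries of `W⁻¹` by `τ⁻¹`
(`IsWeight.abs_inv_le`), which provides the smallness.

A common fixed point of the two updates is a saddle point of the Bellman equation. Telescoping along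
trajectories then gives the minmax property (`isMinmaxStrategy_of_saddle`). Against a feedback with
infinite own cost, the adversary follows its saddle policy for a long finite time and then stops.
Uniqueness of all updates identifies every run with the matrix iteration
(`AgentIteration.run_start`), and the stopping criteria hold because the gradients of the Q-function
tend to zero. -/

set_option linter.unusedSectionVars false

noncomputable section

namespace GraphicalGame

/-! ### Quadratic forms and positivity. -/

section QuadraticForms

variable {ι κ : Type*} [Fintype ι] [Fintype κ]

/-- The quadratic form `x ↦ xᵀ P x` over an arbitrary finite index type. -/
def qf (P : Matrix ι ι ℝ) (x : ι → ℝ) : ℝ := x ⬝ᵥ (P *ᵥ x)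

/-- Positivity of the quadratic form of `P` away from zero; `P` need not be symmetric. -/
def Pos (P : Matrix ι ι ℝ) : Prop := ∀ x, x ≠ 0 → 0 < qf P x

lemma quad_eq_qf {m : ℕ} (P : Matrix (Fin m) (Fin m) ℝ) : quad P = qf P := rfl

lemma qf_add (P R : Matrix ι ι ℝ) (x : ι → ℝ) : qf (P + R) x = qf P x + qf R x := by
  simp [qf, add_mulVec, dotProduct_add]

lemma qf_sub (P R : Matrix ι ι ℝ) (x : ι → ℝ) : qf (P - R) x = qf P x - qf R x := by
  simp [qf, sub_mulVec, dotProduct_sub]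

lemma qf_smul (c : ℝ) (P : Matrix ι ι ℝ) (x : ι → ℝ) : qf (c • P) x = c * qf P x := by
  simp [qf, smul_mulVec, dotProduct_smul]

lemma qf_neg (P : Matrix ι ι ℝ) (x : ι → ℝ) : qf (-P) x = -qf P x := by
  simp [qf, neg_mulVec, dotProduct_neg]

lemma qf_one [DecidableEq ι] (x : ι → ℝ) : qf (1 : Matrix ι ι ℝ) x = x ⬝ᵥ x := by
  simp [qf]

lemma qf_zero (P : Matrix ι ι ℝ) : qf P 0 = 0 := by simp [qf]

lemma qf_smul_vec (c : ℝ) (P : Matrix ι ι ℝ) (x : ι → ℝ) : qf P (c • x) = c ^ 2 * qf P x := by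
  simp [qf, mulVec_smul, dotProduct_smul, smul_dotProduct]; ring

lemma dotProduct_mulVec_transpose (F : Matrix ι κ ℝ) (y : ι → ℝ) (x : κ → ℝ) :
    x ⬝ᵥ (Fᵀ *ᵥ y) = (F *ᵥ x) ⬝ᵥ y := by
  rw [dotProduct_mulVec, vecMul_transpose]

lemma dotProduct_mulVec_comm {P : Matrix ι ι ℝ} (hP : P.IsSymm) (x y : ι → ℝ) :
    x ⬝ᵥ (P *ᵥ y) = y ⬝ᵥ (P *ᵥ x) := by
  conv_lhs => rw [← hP.eq]
  rw [dotProduct_mulVec_transpose, dotProduct_comm]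

lemma dotProduct_self_nonneg (x : ι → ℝ) : 0 ≤ x ⬝ᵥ x :=
  Finset.sum_nonneg fun i _ => mul_self_nonneg (x i)

lemma qf_mulVec (P : Matrix ι ι ℝ) (F : Matrix ι κ ℝ) (x : κ → ℝ) :
    qf P (F *ᵥ x) = qf (Fᵀ * P * F) x := by
  simp only [qf, ← mulVec_mulVec]
  rw [dotProduct_mulVec_transpose]

lemma qf_add_vec {P : Matrix ι ι ℝ} (hP : P.IsSymm) (x y : ι → ℝ) :
    qf P (x + y) = qf P x + 2 * (y ⬝ᵥ (P *ᵥ x)) + qf P y := by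
  have := dotProduct_mulVec_comm hP x y
  simp only [qf, mulVec_add, dotProduct_add, add_dotProduct]
  linarith

/-- Polarization. It transfers limits and derivatives from the scalars `qf P x` to the entries of
`P`. -/
lemma apply_eq_qf [DecidableEq ι] {P : Matrix ι ι ℝ} (hP : P.IsSymm) (i j : ι) :
    P i j = (qf P (Pi.single i 1 + Pi.single j 1) - qf P (Pi.single i 1)
      - qf P (Pi.single j 1)) / 2 := by
  rw [qf_add_vec hP]
  simp only [mulVec_single_one, single_one_dotProduct, hP.apply i j, col_apply]
  ring

lemma eq_of_qf_eq {P R : Matrix ι ι ℝ} (hP : P.IsSymm) (hR : R.IsSymm)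
    (h : ∀ x, qf P x = qf R x) : P = R := by
  classical
  ext i j
  rw [apply_eq_qf hP, apply_eq_qf hR]
  simp [h]

lemma continuous_qf : Continuous fun p : Matrix ι ι ℝ × (ι → ℝ) => qf p.1 p.2 := by
  unfold qf
  fun_prop

/-- Positivity need only be tested on the unit sphere, by homogeneity, and the sphere is compact. -/
lemma Pos.eventually {P : Matrix ι ι ℝ} (hP : Pos P) : ∀ᶠ R in 𝓝 P, Pos R := by
  have hK : IsCompact (Metric.sphere (0 : ι → ℝ) 1) := isCompact_sphere _ _
  have key : ∀ᶠ R in 𝓝 P, ∀ x ∈ Metric.sphere (0 : ι → ℝ) 1, 0 < qf R x := by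
    refine hK.eventually_forall_of_forall_eventually fun x hx => ?_
    have hx0 : x ≠ 0 := by rintro rfl; simp at hx
    exact (continuous_qf.tendsto (P, x)).eventually (lt_mem_nhds (hP x hx0))
  filter_upwards [key] with R hR x hx
  have hn : 0 < ‖x‖ := norm_pos_iff.2 hx
  have := hR (‖x‖⁻¹ • x) (by simp [norm_smul, hn.ne'])
  rw [qf_smul_vec] at this
  exact pos_of_mul_pos_right this (by positivity)

lemma Pos.nonneg {P : Matrix ι ι ℝ} (hP : Pos P) (x : ι → ℝ) : 0 ≤ qf P x := by
  rcases eq_or_ne x 0 with rfl | h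
  · simp [qf_zero]
  · exact (hP x h).le

/-- Positivity is an open condition, so it survives subtracting a small multiple of `R`. -/
lemma Pos.exists_dominates {P : Matrix ι ι ℝ} (hP : Pos P) (R : Matrix ι ι ℝ) :
    ∃ c, 0 < c ∧ ∀ x, c * qf R x ≤ qf P x := by
  have h : Tendsto (fun c : ℝ => P - c • R) (𝓝[>] 0) (𝓝 P) := by
    have : Continuous fun c : ℝ => P - c • R := by fun_prop
    simpa using (this.tendsto 0).mono_left nhdsWithin_le_nhds
  obtain ⟨c, hc, hc0⟩ := ((h.eventually hP.eventually).and self_mem_nhdsWithin).exists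
  refine ⟨c, hc0, fun x => ?_⟩
  have := hc.nonneg x
  rw [qf_sub, qf_smul] at this
  linarith

lemma Pos.exists_coercive {P : Matrix ι ι ℝ} (hP : Pos P) :
    ∃ c, 0 < c ∧ ∀ x, c * (x ⬝ᵥ x) ≤ qf P x := by
  classical
  simpa [qf_one] using hP.exists_dominates (1 : Matrix ι ι ℝ)

lemma Pos.isUnit_det [DecidableEq ι] {P : Matrix ι ι ℝ} (hP : Pos P) : IsUnit P.det := by
  rw [isUnit_iff_ne_zero]
  intro h
  obtain ⟨x, hx, hx'⟩ := exists_mulVec_eq_zero_iff.2 h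
  have := hP x hx
  simp [qf, hx'] at this

lemma pos_of_posDef {P : Matrix ι ι ℝ} (hP : P.PosDef) : Pos P := fun x hx => by
  simpa [qf] using hP.dotProduct_mulVec_pos hx

lemma Pos.posDef {P : Matrix ι ι ℝ} (hs : P.IsSymm) (hP : Pos P) : P.PosDef :=
  PosDef.of_dotProduct_mulVec_pos (by rw [IsHermitian, conjTranspose_eq_transpose_of_trivial]; exact hs)
    fun x hx => by simpa [qf] using hP x hx

lemma qf_nonneg_of_posSemidef {P : Matrix ι ι ℝ} (hP : P.PosSemidef) (x : ι → ℝ) : 0 ≤ qf P x := by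
  simpa [qf] using hP.dotProduct_mulVec_nonneg x

omit [Fintype ι] in
lemma isSymm_of_isHermitian {P : Matrix ι ι ℝ} (hP : P.IsHermitian) : P.IsSymm := by
  rwa [IsHermitian, conjTranspose_eq_transpose_of_trivial] at hP

lemma dotProduct_self_mulVec_le (G : Matrix κ ι ℝ) (x : ι → ℝ) :
    (G *ᵥ x) ⬝ᵥ (G *ᵥ x) ≤ (∑ k, ∑ i, G k i ^ 2) * (x ⬝ᵥ x) := by
  rw [Finset.sum_mul]
  refine Finset.sum_le_sum fun k _ => ?_
  have := Finset.sum_mul_sq_le_sq_mul_sq Finset.univ (G k) x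
  simpa [mulVec, dotProduct, sq] using this

end QuadraticForms

/-! ### Quadratic optimization and gap estimates. -/

section Optimisation

variable {ι κ : Type*} [Fintype ι] [Fintype κ]

/-- Second-order expansion of `u ↦ uᵀ R u + (y + B u)ᵀ P (y + B u)`. -/
lemma qf_expand {P : Matrix ι ι ℝ} {R : Matrix κ κ ℝ} (hP : P.IsSymm) (hR : R.IsSymm)
    (B : Matrix ι κ ℝ) (y : ι → ℝ) (u d : κ → ℝ) :
    qf R (u + d) + qf P (y + B *ᵥ (u + d)) = qf R u + qf P (y + B *ᵥ u)
      + 2 * (d ⬝ᵥ (R *ᵥ u + Bᵀ *ᵥ (P *ᵥ (y + B *ᵥ u)))) + qf (R + Bᵀ * P * B) d := by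
  rw [mulVec_add, ← add_assoc, qf_add_vec hR, qf_add_vec hP, qf_add, ← qf_mulVec,
    dotProduct_add, dotProduct_mulVec_transpose]
  ring

/-- A linear form dominated by a quadratic form vanishes. -/
lemma eq_zero_of_quadratic_nonneg {a b : ℝ} (h : ∀ s : ℝ, 0 ≤ s * a + s ^ 2 * b) : a = 0 := by
  by_contra ha
  -- A step against the sign of `a`, so short that the quadratic term cannot outweigh the linear
  -- one; the added 1 keeps the denominator positive when `b = 0`.
  have h1 := h (-a / (2 * (|b| + 1)))
  have hb : 0 < |b| + 1 := by positivity
  have : -a / (2 * (|b| + 1)) * a + (-a / (2 * (|b| + 1))) ^ 2 * b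
      = a ^ 2 / (4 * (|b| + 1) ^ 2) * (b - 2 * (|b| + 1)) := by
    field_simp; ring
  rw [this] at h1
  have hneg : b - 2 * (|b| + 1) < 0 := by
    have := le_abs_self b
    have := abs_nonneg b
    linarith
  have hpos : 0 < a ^ 2 / (4 * (|b| + 1) ^ 2) := by positivity
  nlinarith [mul_neg_of_pos_of_neg hpos hneg]

/-- Completing the square: `c • d - g` has nonnegative squared length. -/
lemma two_mul_dotProduct_sub_qf_le {H : Matrix κ κ ℝ} {c : ℝ} (hc : 0 < c)
    (hH : ∀ x, c * (x ⬝ᵥ x) ≤ qf H x) (g d : κ → ℝ) :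
    2 * (d ⬝ᵥ g) - qf H d ≤ c⁻¹ * (g ⬝ᵥ g) := by
  have h0 : 0 ≤ (c • d - g) ⬝ᵥ (c • d - g) := dotProduct_self_nonneg _
  have h1 : (c • d - g) ⬝ᵥ (c • d - g) = c * (c * (d ⬝ᵥ d) - 2 * (d ⬝ᵥ g)) + g ⬝ᵥ g := by
    simp only [sub_dotProduct, dotProduct_sub, smul_dotProduct, dotProduct_smul, smul_eq_mul,
      dotProduct_comm g d]
    ring
  have h2 : 2 * (d ⬝ᵥ g) - c * (d ⬝ᵥ d) ≤ c⁻¹ * (g ⬝ᵥ g) := by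
    rw [inv_mul_eq_div, le_div_iff₀ hc]
    nlinarith
  linarith [hH d]

/-- The gap `2 d·Gx - dᵀ H d` is uniformly small for `G` near `0` and `H` near a positive form. -/
lemma Pos.eventually_gap_le {ρ : Type*} [Fintype ρ] {H : Matrix κ κ ℝ} (hH : Pos H) {ε : ℝ}
    (hε : 0 < ε) :
    ∀ᶠ y in 𝓝 ((H, 0) : Matrix κ κ ℝ × Matrix κ ρ ℝ), ∀ (x : ρ → ℝ) (d : κ → ℝ),
      2 * (d ⬝ᵥ (y.2 *ᵥ x)) - qf y.1 d ≤ ε * (x ⬝ᵥ x) := by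
  classical
  obtain ⟨c, hc, hcH⟩ := hH.exists_coercive
  -- Half of the coercivity constant is given away, so that all matrices near `H` share the other
  -- half.
  have h1 : Pos (H - (c / 2) • (1 : Matrix κ κ ℝ)) := fun x hx => by
    rw [qf_sub, qf_smul, qf_one]
    have : 0 < x ⬝ᵥ x := by
      rw [← dotProduct_self_star_pos_iff] at hx
      simpa using hx
    nlinarith [hcH x]
  have t1 : Tendsto (fun y : Matrix κ κ ℝ × Matrix κ ρ ℝ => y.1 - (c / 2) • (1 : Matrix κ κ ℝ))
      (𝓝 (H, 0)) (𝓝 (H - (c / 2) • (1 : Matrix κ κ ℝ))) := by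
    have : Continuous fun y : Matrix κ κ ℝ × Matrix κ ρ ℝ => y.1 - (c / 2) • (1 : Matrix κ κ ℝ) := by
      fun_prop
    exact this.tendsto (H, 0)
  have t2 : Tendsto (fun y : Matrix κ κ ℝ × Matrix κ ρ ℝ => (c / 2)⁻¹ * ∑ k, ∑ i, y.2 k i ^ 2)
      (𝓝 (H, 0)) (𝓝 0) := by
    have : Continuous fun y : Matrix κ κ ℝ × Matrix κ ρ ℝ =>
        (c / 2)⁻¹ * ∑ k, ∑ i, y.2 k i ^ 2 := by
      fun_prop
    simpa using this.tendsto (H, 0)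
  filter_upwards [t1.eventually h1.eventually, t2.eventually (gt_mem_nhds hε)] with y hy1 hy2 x d
  have h2 : ∀ x, (c / 2) * (x ⬝ᵥ x) ≤ qf y.1 x := fun x => by
    have := hy1.nonneg x
    rw [qf_sub, qf_smul, qf_one] at this
    linarith
  refine (two_mul_dotProduct_sub_qf_le (by positivity) h2 _ d).trans ?_
  have h3 := dotProduct_self_mulVec_le y.2 x
  have h4 : 0 ≤ x ⬝ᵥ x := dotProduct_self_nonneg _
  calc (c / 2)⁻¹ * (y.2 *ᵥ x ⬝ᵥ y.2 *ᵥ x)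
      ≤ (c / 2)⁻¹ * ((∑ k, ∑ i, y.2 k i ^ 2) * (x ⬝ᵥ x)) := by gcongr
    _ = ((c / 2)⁻¹ * ∑ k, ∑ i, y.2 k i ^ 2) * (x ⬝ᵥ x) := by ring
    _ ≤ ε * (x ⬝ᵥ x) := by gcongr

end Optimisation

/-! ### The discrete Lyapunov equation and stability. -/

section Lyapunov

variable {ι : Type*} [Fintype ι] [DecidableEq ι]

/-- The matrix of `X ↦ X - Fᵀ X F` in the standard basis. -/
def lyapMatrix (F : Matrix ι ι ℝ) : Matrix (ι × ι) (ι × ι) ℝ :=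
  1 - Matrix.of fun i k => F k.1 i.1 * F k.2 i.2

/-- The solution `P` of the discrete Lyapunov equation `P = S + Fᵀ P F`. -/
def lyap (F S : Matrix ι ι ℝ) : Matrix ι ι ℝ :=
  Matrix.of fun i j => ((lyapMatrix F)⁻¹ *ᵥ fun k => S k.1 k.2) (i, j)

lemma lyapMatrix_mulVec (F X : Matrix ι ι ℝ) :
    (lyapMatrix F *ᵥ fun k => X k.1 k.2) = fun k => (X - Fᵀ * X * F) k.1 k.2 := by
  ext ⟨i, j⟩
  rw [lyapMatrix, sub_mulVec, one_mulVec]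
  simp only [Pi.sub_apply, Matrix.sub_apply]
  congr 1
  simp only [mulVec, dotProduct, of_apply, mul_apply, transpose_apply, Fintype.sum_prod_type,
    Finset.sum_mul]
  rw [Finset.sum_comm]
  refine Finset.sum_congr rfl fun k _ => Finset.sum_congr rfl fun l _ => ?_
  ring

lemma lyap_unique {F S P : Matrix ι ι ℝ} (hF : IsUnit (lyapMatrix F).det)
    (h : P = S + Fᵀ * P * F) : P = lyap F S := by
  have h1 : P - Fᵀ * P * F = S := by rw [sub_eq_iff_eq_add]; exact h
  have h2 := lyapMatrix_mulVec F P
  rw [h1] at h2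
  ext i j
  rw [lyap, of_apply, ← h2, mulVec_mulVec, nonsing_inv_mul _ hF, one_mulVec]

lemma lyap_spec {F : Matrix ι ι ℝ} (S : Matrix ι ι ℝ) (hF : IsUnit (lyapMatrix F).det) :
    lyap F S = S + Fᵀ * lyap F S * F := by
  have h2 := lyapMatrix_mulVec F (lyap F S)
  have h3 : (fun k : ι × ι => lyap F S k.1 k.2) = (lyapMatrix F)⁻¹ *ᵥ fun k => S k.1 k.2 := by
    ext ⟨i, j⟩
    simp [lyap]
  rw [h3, mulVec_mulVec, mul_nonsing_inv _ hF, one_mulVec] at h2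
  rw [← sub_eq_iff_eq_add]
  ext i j
  exact (congrFun h2 (i, j)).symm

lemma lyap_isSymm {F S : Matrix ι ι ℝ} (hS : S.IsSymm) (hF : IsUnit (lyapMatrix F).det) :
    (lyap F S).IsSymm := by
  refine lyap_unique hF ?_
  conv_lhs => rw [lyap_spec S hF]
  simp [transpose_mul, hS.eq, Matrix.mul_assoc]

/-- All trajectories of `x⁺ = F x` converge to zero. -/
def Stable (F : Matrix ι ι ℝ) : Prop := ∀ x : ι → ℝ, Tendsto (fun k : ℕ => F ^ k *ᵥ x) atTop (𝓝 0)

lemma Stable.tendsto_pow {F : Matrix ι ι ℝ} (hF : Stable F) :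
    Tendsto (fun k : ℕ => F ^ k) atTop (𝓝 0) := by
  refine tendsto_pi_nhds.2 fun i => tendsto_pi_nhds.2 fun j => ?_
  have := (tendsto_pi_nhds.1 (hF (Pi.single j 1))) i
  simpa using this

/-- A kernel element is a matrix with `X = Fᵀ X F`. Iterating, `X = (F ^ k)ᵀ X F ^ k`, and this
tends to zero. -/
lemma Stable.isUnit {F : Matrix ι ι ℝ} (hF : Stable F) : IsUnit (lyapMatrix F).det := by
  rw [isUnit_iff_ne_zero]
  intro h
  obtain ⟨x, hx, hx'⟩ := exists_mulVec_eq_zero_iff.2 h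
  apply hx
  set X : Matrix ι ι ℝ := Matrix.of fun i j => x (i, j)
  have h1 := lyapMatrix_mulVec F X
  have h2 : (fun k : ι × ι => X k.1 k.2) = x := by ext ⟨i, j⟩; rfl
  rw [h2, hx'] at h1
  have h3 : X = Fᵀ * X * F := by
    rw [← sub_eq_zero]
    ext i j
    exact (congrFun h1 (i, j)).symm
  have h4 : ∀ k : ℕ, X = (F ^ k)ᵀ * X * F ^ k := by
    intro k
    induction k with
    | zero => simp
    | succ k ih =>
      conv_lhs => rw [ih, h3]
      rw [pow_succ' F k]
      simp only [transpose_mul, Matrix.mul_assoc]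
  have h5 : Tendsto (fun k : ℕ => (F ^ k)ᵀ * X * F ^ k) atTop (𝓝 (0ᵀ * X * 0)) := by
    have hc : Continuous fun G : Matrix ι ι ℝ => Gᵀ * X * G := by fun_prop
    exact (hc.tendsto 0).comp hF.tendsto_pow
  have h6 : X = 0 := by
    simp only [← h4] at h5
    simpa using tendsto_nhds_unique tendsto_const_nhds h5
  rw [← h2, h6]
  rfl

/-- A form that decreases along a stable system is nonnegative. -/
lemma Stable.qf_nonneg {F X : Matrix ι ι ℝ} (hF : Stable F)
    (h : ∀ x, qf X (F *ᵥ x) ≤ qf X x) (x : ι → ℝ) : 0 ≤ qf X x := by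
  have h1 : ∀ k : ℕ, qf X (F ^ k *ᵥ x) ≤ qf X x := by
    intro k
    induction k with
    | zero => simp
    | succ k ih =>
      rw [pow_succ', ← mulVec_mulVec]
      exact (h _).trans ih
  have hc : Continuous (qf X) := continuous_qf.comp (Continuous.prodMk_right X)
  have h2 := (hc.tendsto 0).comp (hF x)
  rw [qf_zero] at h2
  exact le_of_tendsto' h2 h1

omit [DecidableEq ι] in
lemma tendsto_zero_of_dotProduct {x : ℕ → ι → ℝ}
    (h : Tendsto (fun k => x k ⬝ᵥ x k) atTop (𝓝 0)) : Tendsto x atTop (𝓝 0) := by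
  rw [tendsto_pi_nhds]
  intro i
  refine (tendsto_zero_iff_abs_tendsto_zero _).2 ?_
  have h1 : Tendsto (fun k => √(x k ⬝ᵥ x k)) atTop (𝓝 0) := by
    simpa [Function.comp_def] using (Real.continuous_sqrt.tendsto 0).comp h
  refine squeeze_zero (fun k => abs_nonneg _) (fun k => ?_) h1
  refine Real.abs_le_sqrt ?_
  rw [sq]
  exact Finset.single_le_sum (f := fun i => x k i * x k i) (fun j _ => mul_self_nonneg _)
    (Finset.mem_univ i)

/-- Lyapunov's theorem: the decrements of `qf P` along a trajectory telescope to at most `qf P x`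
and dominate the squared norms of the states, which are therefore summable. -/
lemma stable_of_pos {F P : Matrix ι ι ℝ} (hP : Pos P) (h : Pos (P - Fᵀ * P * F)) : Stable F := by
  intro x
  obtain ⟨c, hc, hcP⟩ := hP.exists_coercive
  obtain ⟨e, he, heP⟩ := h.exists_coercive
  have h0 : ∀ T : ℕ, ∑ k ∈ Finset.range T, e * ((F ^ k *ᵥ x) ⬝ᵥ (F ^ k *ᵥ x)) ≤ qf P x := by
    intro T
    have : ∑ k ∈ Finset.range T, e * ((F ^ k *ᵥ x) ⬝ᵥ (F ^ k *ᵥ x))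
        ≤ qf P x - qf P (F ^ T *ᵥ x) := by
      induction T with
      | zero => simp
      | succ T ih =>
        rw [Finset.sum_range_succ, pow_succ' F T, ← mulVec_mulVec]
        have := heP (F ^ T *ᵥ x)
        rw [qf_sub, ← qf_mulVec] at this
        linarith
    linarith [hP.nonneg (F ^ T *ᵥ x)]
  have hs : Summable fun k : ℕ => e * ((F ^ k *ᵥ x) ⬝ᵥ (F ^ k *ᵥ x)) :=
    summable_of_sum_range_le (fun k => mul_nonneg he.le (dotProduct_self_nonneg _)) h0
  apply tendsto_zero_of_dotProduct
  have := hs.tendsto_atTop_zero.const_mul e⁻¹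
  simpa [he.ne'] using this

end Lyapunov

/-! ### Continuous differentiability of matrix operations. -/

section Smoothness

attribute [local instance] Matrix.normedAddCommGroup Matrix.normedSpace

variable {X : Type*} [NormedAddCommGroup X] [NormedSpace ℝ X] {x : X}
  {ι κ ν : Type*} [Fintype ι] [Fintype κ] [Fintype ν]

lemma contDiffAt_matrix {f : X → Matrix ι κ ℝ} :
    ContDiffAt ℝ 1 f x ↔ ∀ i j, ContDiffAt ℝ 1 (fun y => f y i j) x := by
  refine ⟨fun h i j => ?_, fun h => ?_⟩
  · exact contDiffAt_pi.1 (contDiffAt_pi.1 h i) j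
  · exact contDiffAt_pi.2 fun i => contDiffAt_pi.2 fun j => h i j

lemma contDiffAt_matrix_mul {f : X → Matrix ι κ ℝ} {g : X → Matrix κ ν ℝ}
    (hf : ContDiffAt ℝ 1 f x) (hg : ContDiffAt ℝ 1 g x) :
    ContDiffAt ℝ 1 (fun y => f y * g y) x := by
  rw [contDiffAt_matrix] at *
  intro i j
  simp only [mul_apply]
  exact ContDiffAt.sum fun k _ => (hf i k).mul (hg k j)

lemma contDiffAt_matrix_transpose {f : X → Matrix ι κ ℝ} (hf : ContDiffAt ℝ 1 f x) :
    ContDiffAt ℝ 1 (fun y => (f y)ᵀ) x := by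
  rw [contDiffAt_matrix] at *
  exact fun i j => hf j i

lemma contDiffAt_matrix_det [DecidableEq ι] {f : X → Matrix ι ι ℝ} (hf : ContDiffAt ℝ 1 f x) :
    ContDiffAt ℝ 1 (fun y => (f y).det) x := by
  rw [contDiffAt_matrix] at hf
  simp only [det_apply']
  exact ContDiffAt.sum fun s _ => contDiffAt_const.mul (contDiffAt_prod fun i _ => hf (s i) i)

/-- The inverse is the adjugate divided by the determinant, and the entries of the adjugate are
themselves determinants. -/
lemma contDiffAt_matrix_inv [DecidableEq ι] {f : X → Matrix ι ι ℝ} (hf : ContDiffAt ℝ 1 f x)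
    (hx : IsUnit (f x).det) : ContDiffAt ℝ 1 (fun y => (f y)⁻¹) x := by
  have hdet := (contDiffAt_matrix_det hf).inv hx.ne_zero
  rw [contDiffAt_matrix]
  intro i j
  simp only [inv_def, Ring.inverse_eq_inv', Matrix.smul_apply, smul_eq_mul, adjugate_apply]
  refine hdet.mul (contDiffAt_matrix_det ?_)
  rw [contDiffAt_matrix] at hf ⊢
  intro k l
  simp only [updateRow_apply]
  split_ifs
  · exact contDiffAt_const
  · exact hf k l

lemma contDiffAt_lyapMatrix [DecidableEq ι] {F : X → Matrix ι ι ℝ} (hF : ContDiffAt ℝ 1 F x) :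
    ContDiffAt ℝ 1 (fun y => lyapMatrix (F y)) x := by
  refine contDiffAt_const.sub ?_
  rw [contDiffAt_matrix] at hF ⊢
  exact fun i j => (hF _ _).mul (hF _ _)

lemma contDiffAt_lyap [DecidableEq ι] {F S : X → Matrix ι ι ℝ} (hF : ContDiffAt ℝ 1 F x)
    (hS : ContDiffAt ℝ 1 S x) (hx : IsUnit (lyapMatrix (F x)).det) :
    ContDiffAt ℝ 1 (fun y => lyap (F y) (S y)) x := by
  have h1 := contDiffAt_matrix_inv (contDiffAt_lyapMatrix hF) hx
  rw [contDiffAt_matrix] at hS h1 ⊢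
  intro i j
  simp only [lyap, of_apply, mulVec, dotProduct]
  exact ContDiffAt.sum fun k _ => (h1 _ _).mul (hS _ _)

end Smoothness

/-! ### The zero-sum game of one agent and its update maps. -/

/-- The zero-sum game that one agent believes to play: the dynamics `x⁺ = A x + B u + D v` and the
weights of the cost `xᵀ Q x + uᵀ R u - β² vᵀ W v`. The weight `W` is kept as a parameter, and `lab`
tells which component of the adversarial input an entry of `v` belongs to. -/
structure ZeroSumGame (ι κ σ : Type) [Fintype ι] [Fintype κ] where
  A : Matrix ι ι ℝ
  B : Matrix ι κ ℝ
  D : Matrix ι σ ℝ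
  Q : Matrix ι ι ℝ
  R : Matrix κ κ ℝ
  β : ℝ
  lab : σ → Fin 3
  Q_symm : Q.IsSymm
  Q_pos : Pos Q
  R_symm : R.IsSymm
  R_pos : Pos R
  β_pos : 0 < β

namespace ZeroSumGame

variable {ι κ σ : Type} [Fintype ι] [Fintype κ] [Fintype σ] [DecidableEq ι] [DecidableEq κ]
  [DecidableEq σ] (G : ZeroSumGame ι κ σ)

/-! Throughout, `E` is the inverse of the weight `W` of the adversarial inputs, and the policies are
`u = K x` and `v = E M x`. -/

/-- The closed-loop matrix. -/
def closedLoop (E : Matrix σ σ ℝ) (K : Matrix κ ι ℝ) (M : Matrix σ ι ℝ) : Matrix ι ι ℝ :=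
  G.A + G.B * K + G.D * E * M

/-- The stage cost along the policies. -/
def policyCost (E : Matrix σ σ ℝ) (K : Matrix κ ι ℝ) (M : Matrix σ ι ℝ) : Matrix ι ι ℝ :=
  G.Q + Kᵀ * G.R * K - G.β ^ 2 • (Mᵀ * E * M)

/-- The value of the policies. -/
def value (E : Matrix σ σ ℝ) (K : Matrix κ ι ℝ) (M : Matrix σ ι ℝ) : Matrix ι ι ℝ :=
  lyap (G.closedLoop E K M) (G.policyCost E K M)

/-- The block-diagonal part with respect to the components of the adversarial input. -/
def blockPart (Γ : Matrix σ σ ℝ) : Matrix σ σ ℝ :=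
  Matrix.of fun s t => if G.lab s = G.lab t then Γ s t else 0

/-- The second derivative of `v ↦ V(δ⁺) / 2`. -/
def curv (P : Matrix ι ι ℝ) : Matrix σ σ ℝ := G.Dᵀ * P * G.D

/-- The matrix of the linear system that the componentwise maximizers solve. -/
def advSystem (E : Matrix σ σ ℝ) (P : Matrix ι ι ℝ) : Matrix σ σ ℝ :=
  G.β ^ 2 • (1 : Matrix σ σ ℝ) - G.blockPart (G.curv P) * E

/-- The update of the adversarial policies. -/
def advStep (E : Matrix σ σ ℝ) (K : Matrix κ ι ℝ) (M : Matrix σ ι ℝ) : Matrix σ ι ℝ :=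
  (G.advSystem E (G.value E K M))⁻¹ * (G.Dᵀ * G.value E K M * (G.A + G.B * K)
    + (G.curv (G.value E K M) - G.blockPart (G.curv (G.value E K M))) * E * M)

/-- The second derivative, up to a factor 2, of the Q-function in the control. -/
def ctrlHess (P : Matrix ι ι ℝ) : Matrix κ κ ℝ := G.R + G.Bᵀ * P * G.B

/-- The minimizing control for the value `P` when the uncontrolled dynamics is `F`. -/
def ctrlGain (P F : Matrix ι ι ℝ) : Matrix κ ι ℝ := -((G.ctrlHess P)⁻¹ * (G.Bᵀ * P * F))

/-- The update of the control policy. -/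
def ctrlStep (E : Matrix σ σ ℝ) (K : Matrix κ ι ℝ) (M : Matrix σ ι ℝ) : Matrix κ ι ℝ :=
  G.ctrlGain (G.value E K M) (G.A + G.D * E * M)

/-- The value of the feedback `u = K x` in the absence of adversarial inputs. -/
def lqrValue (K : Matrix κ ι ℝ) : Matrix ι ι ℝ :=
  lyap (G.A + G.B * K) (G.Q + Kᵀ * G.R * K)

/-- The conditions under which the policy iteration is well posed at the policies `(K, E M)`, for
weights `W ≥ t⁻¹` with inverse `E`. -/
structure WellPosed (t : ℝ) (E : Matrix σ σ ℝ) (K : Matrix κ ι ℝ) (M : Matrix σ ι ℝ) : Prop where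
  lyap_unit : IsUnit (lyapMatrix (G.closedLoop E K M)).det
  adv_unit : IsUnit (G.advSystem E (G.value E K M)).det
  concave : Pos (G.β ^ 2 • (1 : Matrix σ σ ℝ) - t • G.curv (G.value E K M))
  convex : Pos (G.ctrlHess (G.value E K M))
  value_pos : Pos (G.value E K M)
  cost_pos : Pos (G.Q - G.β ^ 2 • (Mᵀ * E * M))

lemma closedLoop_zero (K : Matrix κ ι ℝ) (M : Matrix σ ι ℝ) :
    G.closedLoop 0 K M = G.A + G.B * K := by simp [closedLoop]

lemma value_zero (K : Matrix κ ι ℝ) (M : Matrix σ ι ℝ) : G.value 0 K M = G.lqrValue K := by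
  simp [value, closedLoop, policyCost, lqrValue]

lemma advSystem_zero (P : Matrix ι ι ℝ) : G.advSystem 0 P = G.β ^ 2 • (1 : Matrix σ σ ℝ) := by
  simp [advSystem]

/-- The right-hand side is free of `M`: without adversarial influence the inner iteration is
constant after one step. This is what makes it a contraction for small `E`. -/
lemma advStep_zero (K : Matrix κ ι ℝ) (M : Matrix σ ι ℝ) :
    G.advStep 0 K M = (G.β ^ 2 • (1 : Matrix σ σ ℝ))⁻¹ *
      (G.Dᵀ * G.lqrValue K * (G.A + G.B * K)) := by
  simp [advStep, value_zero, advSystem_zero]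

lemma ctrlStep_zero (K : Matrix κ ι ℝ) (M : Matrix σ ι ℝ) :
    G.ctrlStep 0 K M = G.ctrlGain (G.lqrValue K) G.A := by
  simp [ctrlStep, value_zero]

lemma ctrlHess_pos {P : Matrix ι ι ℝ} (hP : ∀ x, 0 ≤ qf P x) : Pos (G.ctrlHess P) := fun u hu => by
  rw [ctrlHess, qf_add, ← qf_mulVec]
  exact add_pos_of_pos_of_nonneg (G.R_pos u hu) (hP _)

/-! ### Regularity of the update maps. -/

section Regularity

attribute [local instance] Matrix.normedAddCommGroup Matrix.normedSpace

variable {X : Type*} [NormedAddCommGroup X] [NormedSpace ℝ X] {x : X}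
  {E : X → Matrix σ σ ℝ} {K : X → Matrix κ ι ℝ} {M : X → Matrix σ ι ℝ} {P F : X → Matrix ι ι ℝ}

lemma contDiffAt_closedLoop (hE : ContDiffAt ℝ 1 E x) (hK : ContDiffAt ℝ 1 K x)
    (hM : ContDiffAt ℝ 1 M x) : ContDiffAt ℝ 1 (fun y => G.closedLoop (E y) (K y) (M y)) x :=
  (contDiffAt_const.add (contDiffAt_matrix_mul contDiffAt_const hK)).add
    (contDiffAt_matrix_mul (contDiffAt_matrix_mul contDiffAt_const hE) hM)

lemma contDiffAt_policyCost (hE : ContDiffAt ℝ 1 E x) (hK : ContDiffAt ℝ 1 K x)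
    (hM : ContDiffAt ℝ 1 M x) : ContDiffAt ℝ 1 (fun y => G.policyCost (E y) (K y) (M y)) x :=
  (contDiffAt_const.add (contDiffAt_matrix_mul (contDiffAt_matrix_mul
    (contDiffAt_matrix_transpose hK) contDiffAt_const) hK)).sub
    (ContDiffAt.const_smul (G.β ^ 2) (contDiffAt_matrix_mul (contDiffAt_matrix_mul
      (contDiffAt_matrix_transpose hM) hE) hM))

lemma contDiffAt_value (hE : ContDiffAt ℝ 1 E x) (hK : ContDiffAt ℝ 1 K x)
    (hM : ContDiffAt ℝ 1 M x) (hx : IsUnit (lyapMatrix (G.closedLoop (E x) (K x) (M x))).det) :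
    ContDiffAt ℝ 1 (fun y => G.value (E y) (K y) (M y)) x :=
  contDiffAt_lyap (G.contDiffAt_closedLoop hE hK hM) (G.contDiffAt_policyCost hE hK hM) hx

lemma contDiffAt_curv (hP : ContDiffAt ℝ 1 P x) : ContDiffAt ℝ 1 (fun y => G.curv (P y)) x :=
  contDiffAt_matrix_mul (contDiffAt_matrix_mul contDiffAt_const hP) contDiffAt_const

lemma contDiffAt_blockPart (hE : ContDiffAt ℝ 1 E x) :
    ContDiffAt ℝ 1 (fun y => G.blockPart (E y)) x := by
  rw [contDiffAt_matrix] at hE ⊢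
  intro s t
  simp only [blockPart, of_apply]
  split_ifs
  · exact hE s t
  · exact contDiffAt_const

lemma contDiffAt_advSystem (hE : ContDiffAt ℝ 1 E x) (hP : ContDiffAt ℝ 1 P x) :
    ContDiffAt ℝ 1 (fun y => G.advSystem (E y) (P y)) x :=
  contDiffAt_const.sub (contDiffAt_matrix_mul (G.contDiffAt_blockPart (G.contDiffAt_curv hP)) hE)

lemma contDiffAt_ctrlHess (hP : ContDiffAt ℝ 1 P x) :
    ContDiffAt ℝ 1 (fun y => G.ctrlHess (P y)) x :=
  contDiffAt_const.add
    (contDiffAt_matrix_mul (contDiffAt_matrix_mul contDiffAt_const hP) contDiffAt_const)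

lemma contDiffAt_ctrlGain (hP : ContDiffAt ℝ 1 P x) (hF : ContDiffAt ℝ 1 F x)
    (hx : IsUnit (G.ctrlHess (P x)).det) : ContDiffAt ℝ 1 (fun y => G.ctrlGain (P y) (F y)) x :=
  (contDiffAt_matrix_mul (contDiffAt_matrix_inv (G.contDiffAt_ctrlHess hP) hx)
    (contDiffAt_matrix_mul (contDiffAt_matrix_mul contDiffAt_const hP) hF)).neg

lemma contDiffAt_advStep (hE : ContDiffAt ℝ 1 E x) (hK : ContDiffAt ℝ 1 K x)
    (hM : ContDiffAt ℝ 1 M x) (hx : IsUnit (lyapMatrix (G.closedLoop (E x) (K x) (M x))).det)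
    (hx' : IsUnit (G.advSystem (E x) (G.value (E x) (K x) (M x))).det) :
    ContDiffAt ℝ 1 (fun y => G.advStep (E y) (K y) (M y)) x := by
  have hP := G.contDiffAt_value hE hK hM hx
  have hΓ := G.contDiffAt_curv hP
  refine contDiffAt_matrix_mul (contDiffAt_matrix_inv (G.contDiffAt_advSystem hE hP) hx') ?_
  refine (contDiffAt_matrix_mul (contDiffAt_matrix_mul contDiffAt_const hP)
    (contDiffAt_const.add (contDiffAt_matrix_mul contDiffAt_const hK))).add ?_
  exact contDiffAt_matrix_mul (contDiffAt_matrix_mul (hΓ.sub (G.contDiffAt_blockPart hΓ)) hE) hM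

lemma contDiffAt_ctrlStep (hE : ContDiffAt ℝ 1 E x) (hK : ContDiffAt ℝ 1 K x)
    (hM : ContDiffAt ℝ 1 M x) (hx : IsUnit (lyapMatrix (G.closedLoop (E x) (K x) (M x))).det)
    (hx' : IsUnit (G.ctrlHess (G.value (E x) (K x) (M x))).det) :
    ContDiffAt ℝ 1 (fun y => G.ctrlStep (E y) (K y) (M y)) x :=
  G.contDiffAt_ctrlGain (G.contDiffAt_value hE hK hM hx) (contDiffAt_const.add
    (contDiffAt_matrix_mul (contDiffAt_matrix_mul contDiffAt_const hE) hM)) hx'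

end Regularity

end ZeroSumGame

/-! ### Perturbation theory of nested fixed-point iterations. -/

section NestedIteration

lemma eventually_norm_sub_lt {α X : Type*} [SeminormedAddCommGroup X] {f : α → X} {l : Filter α}
    {a : X} (h : Tendsto f l (𝓝 a)) {r : ℝ} (hr : 0 < r) : ∀ᶠ x in l, ‖f x - a‖ < r := by
  filter_upwards [h.eventually (Metric.ball_mem_nhds a hr)] with x hx
  rwa [← dist_eq_norm]

/-- Banach's theorem on a closed ball. The ball is invariant because the centre moves by at most
half the radius and distances to it are halved. -/
lemma exists_fixedPoint_of_half_contraction {X : Type*} [NormedAddCommGroup X] [CompleteSpace X]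
    {f : X → X} {c : X} {r : ℝ} (hr : 0 ≤ r) (hc : ‖f c - c‖ ≤ r / 2)
    (hf : ∀ x y, ‖x - c‖ ≤ r → ‖y - c‖ ≤ r → ‖f x - f y‖ ≤ 1 / 2 * ‖x - y‖) :
    ∃ y, ‖y - c‖ ≤ r ∧ f y = y ∧ ∀ s : ℕ → X, ‖s 0 - c‖ ≤ r → (∀ k, s (k + 1) = f (s k)) →
      (∀ k, ‖s k - c‖ ≤ r) ∧ Tendsto s atTop (𝓝 y) := by
  have hmaps : ∀ x, ‖x - c‖ ≤ r → ‖f x - c‖ ≤ r := fun x hx => by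
    have h1 := hf x c hx (by simpa using hr)
    have h2 := norm_add_le (f x - f c) (f c - c)
    rw [sub_add_sub_cancel] at h2
    linarith
  have hm : Set.MapsTo f (Metric.closedBall c r) (Metric.closedBall c r) := fun x hx => by
    rw [mem_closedBall_iff_norm] at hx ⊢
    exact hmaps x hx
  have hcontr : ContractingWith (1 / 2 : NNReal) (hm.restrict f _ _) := by
    refine ⟨by norm_num, LipschitzWith.of_dist_le_mul fun x y => ?_⟩
    have := hf x y (mem_closedBall_iff_norm.1 x.2) (mem_closedBall_iff_norm.1 y.2)
    rw [Subtype.dist_eq, Subtype.dist_eq, dist_eq_norm, dist_eq_norm]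
    simpa using this
  obtain ⟨y, hy, hfy, -, -⟩ := hcontr.exists_fixedPoint' Metric.isClosed_closedBall.isComplete hm
    (Metric.mem_closedBall_self hr) (edist_ne_top _ _)
  rw [mem_closedBall_iff_norm] at hy
  refine ⟨y, hy, hfy, fun s hs0 hs => ?_⟩
  have hsr : ∀ k, ‖s k - c‖ ≤ r := by
    intro k
    induction k with
    | zero => exact hs0
    | succ k ih => rw [hs]; exact hmaps _ ih
  refine ⟨hsr, ?_⟩
  have hb : ∀ k, ‖s k - y‖ ≤ ‖s 0 - y‖ * (1 / 2) ^ k := by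
    intro k
    induction k with
    | zero => simp
    | succ k ih =>
      have := hf (s k) y (hsr k) hy
      rw [hfy, ← hs] at this
      rw [pow_succ]
      linarith
  rw [tendsto_iff_norm_sub_tendsto_zero]
  refine squeeze_zero (fun _ => norm_nonneg _) hb ?_
  simpa using (tendsto_pow_atTop_nhds_zero_of_lt_one (by norm_num : (0 : ℝ) ≤ 1 / 2)
    (by norm_num)).const_mul ‖s 0 - y‖

variable {Θ 𝓚 𝓜 Z : Type*} [NormedAddCommGroup Θ] [NormedSpace ℝ Θ]
  [NormedAddCommGroup 𝓚] [NormedSpace ℝ 𝓚] [NormedAddCommGroup 𝓜] [NormedSpace ℝ 𝓜]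
  [NormedAddCommGroup Z] [NormedSpace ℝ Z]

/-- Strict differentiability compares two nearby points with the same parameter `θ`. If the
derivative does not see the last variable, that variable enters only through the error term. -/
lemma eventually_norm_sub_le {F : Θ × 𝓚 × 𝓜 → Z} {F' : Θ × 𝓚 × 𝓜 →L[ℝ] Z} {y₀ : Θ × 𝓚 × 𝓜}
    (hF : HasStrictFDerivAt F F' y₀) {a : ℝ} (ha : ∀ k m, ‖F' (0, k, m)‖ ≤ a * ‖k‖)
    {ε : ℝ} (hε : 0 < ε) :
    ∃ r > 0, ∀ θ k k' m m', ‖θ - y₀.1‖ < r → ‖k - y₀.2.1‖ < r → ‖k' - y₀.2.1‖ < r →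
      ‖m - y₀.2.2‖ < r → ‖m' - y₀.2.2‖ < r →
      ‖F (θ, k, m) - F (θ, k', m')‖ ≤ (a + ε) * ‖k - k'‖ + ε * ‖m - m'‖ := by
  have h := hF.isLittleO.def hε
  rw [Metric.eventually_nhds_iff] at h
  obtain ⟨r, hr, h⟩ := h
  refine ⟨r, hr, fun θ k k' m m' h1 h2 h3 h4 h5 => ?_⟩
  have h6 := @h ((θ, k, m), (θ, k', m')) (by
    simp only [Prod.dist_eq, max_lt_iff]
    simp only [dist_eq_norm]
    exact ⟨⟨h1, h2, h4⟩, h1, h3, h5⟩)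
  simp only [Prod.mk_sub_mk, sub_self] at h6
  have h7 : ‖((0 : Θ), k - k', m - m')‖ ≤ ‖k - k'‖ + ‖m - m'‖ := by
    simp only [Prod.norm_def, norm_zero]
    have := norm_nonneg (k - k')
    have := norm_nonneg (m - m')
    refine sup_le (by positivity) (sup_le (by linarith) (by linarith))
  have h8 := norm_sub_norm_le (F (θ, k, m) - F (θ, k', m')) (F' (0, k - k', m - m'))
  have h9 := ha (k - k') (m - m')
  nlinarith

/-- The nested iteration with parameter `θ`: the inner iterates obey `M⁺ = ψ (θ, K, M)`, the outer
ones `K⁺ = φ (θ, K, L)` with `L` the limit of the inner iteration, and the next inner iteration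
starts from `0` or from `L`. -/
structure IsNestedIteration (ψ : Θ × 𝓚 × 𝓜 → 𝓜) (φ : Θ × 𝓚 × 𝓜 → 𝓚) (θ : Θ) (K₀ : 𝓚)
    (Ks : ℕ → 𝓚) (Ms : ℕ → ℕ → 𝓜) : Prop where
  outer_zero : Ks 0 = K₀
  inner_zero : Ms 0 0 = 0
  inner_succ : ∀ h z, Ms h (z + 1) = ψ (θ, Ks h, Ms h z)
  outer_succ : ∀ h L, Tendsto (Ms h) atTop (𝓝 L) →
    Ks (h + 1) = φ (θ, Ks h, L) ∧ (Ms (h + 1) 0 = 0 ∨ Ms (h + 1) 0 = L)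

variable {ψ : Θ × 𝓚 × 𝓜 → 𝓜} {φ : Θ × 𝓚 × 𝓜 → 𝓚} {m₀ : 𝓚 → 𝓜} {k₀ : 𝓚 → 𝓚}
  {good : Θ × 𝓚 × 𝓜 → Prop}

/-- At parameter zero `ψ` is constant in its last variable, so that partial derivative vanishes and
the strict derivative estimate leaves an arbitrarily small Lipschitz constant in `m`. -/
lemma inner_lipschitz {K : 𝓚} (hψ : ContDiffAt ℝ 1 ψ (0, K, m₀ K))
    (hψ₀ : ∀ K M, ψ (0, K, M) = m₀ K) :
    ∃ C ≥ 0, ∃ r > 0, ∀ θ k k' m m', ‖θ‖ < r → ‖k - K‖ < r → ‖k' - K‖ < r →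
      ‖m - m₀ K‖ < r → ‖m' - m₀ K‖ < r →
      ‖ψ (θ, k, m) - ψ (θ, k', m')‖ ≤ C * ‖k - k'‖ + 1 / 2 * ‖m - m'‖ := by
  have hs := hψ.hasStrictFDerivAt one_ne_zero
  set ψ' := fderiv ℝ ψ (0, K, m₀ K)
  have hM : ∀ m, ψ' (0, 0, m) = 0 := fun m => by
    have h1 : HasFDerivAt (fun M : 𝓜 => ((0 : Θ), K, M))
        ((ContinuousLinearMap.inr ℝ Θ (𝓚 × 𝓜)).comp (ContinuousLinearMap.inr ℝ 𝓚 𝓜)) (m₀ K) := by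
      have h2 := (hasFDerivAt_const (𝕜 := ℝ) (0 : Θ) (m₀ K)).prodMk
        ((hasFDerivAt_const (𝕜 := ℝ) K (m₀ K)).prodMk (hasFDerivAt_id (m₀ K)))
      refine h2.congr_fderiv ?_
      ext <;> simp
    have h3 := hs.hasFDerivAt.comp (m₀ K) h1
    have h4 : (ψ ∘ fun M : 𝓜 => ((0 : Θ), K, M)) = fun _ => m₀ K := by
      ext M; simp [hψ₀]
    rw [h4] at h3
    have h5 := h3.unique (hasFDerivAt_const (m₀ K) (m₀ K))
    simpa using congrArg (fun T : 𝓜 →L[ℝ] 𝓜 => T m) h5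
  have ha : ∀ k m, ‖ψ' (0, k, m)‖ ≤ ‖ψ'‖ * ‖k‖ := fun k m => by
    have h1 : ((0 : Θ), k, m) = (0, k, 0) + (0, 0, m) := by simp
    rw [h1, map_add, hM, add_zero]
    refine (ψ'.le_opNorm _).trans_eq ?_
    simp [Prod.norm_def]
  obtain ⟨r, hr, h⟩ := eventually_norm_sub_le hs ha (by norm_num : (0 : ℝ) < 1 / 2)
  refine ⟨‖ψ'‖ + 1 / 2, by positivity, r, hr, fun θ k k' m m' h1 => ?_⟩
  exact h θ k k' m m' (by simpa using h1)

/-- From a start near an arbitrary `M`, one step lands close to `m₀ K`, where the map contracts. The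
start neighbourhood `U` is chosen before `δ`, so it can serve as a fixed target for the limit of the
preceding inner loop. -/
lemma inner_converges [CompleteSpace 𝓜] {K : 𝓚} (hψ : ∀ M, ContDiffAt ℝ 1 ψ (0, K, M))
    (hψ₀ : ∀ K M, ψ (0, K, M) = m₀ K) (hgood : ∀ M, ∀ᶠ y in 𝓝 (0, K, M), good y) (M : 𝓜) :
    ∃ U ∈ 𝓝 M, ∀ δ > 0, ∀ᶠ y in 𝓝 ((0 : Θ), K), ∀ s : ℕ → 𝓜, s 0 ∈ U →
      (∀ z, s (z + 1) = ψ (y.1, y.2, s z)) → (∀ z, good (y.1, y.2, s z)) ∧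
      ∃ L, Tendsto s atTop (𝓝 L) ∧ ‖L - m₀ K‖ < δ ∧ ψ (y.1, y.2, L) = L ∧ good (y.1, y.2, L) := by
  obtain ⟨C, hC, r, hr, hlip⟩ := inner_lipschitz (hψ (m₀ K)) hψ₀
  obtain ⟨e, he, hge⟩ := Metric.eventually_nhds_iff.1 (hgood (m₀ K))
  set ρ := min r e / 2 with hρ
  have hρ0 : 0 < ρ := by positivity
  have hρr : ρ < r := by have := min_le_left r e; simp only [hρ]; linarith
  have hρe : ρ < e := by have := min_le_right r e; simp only [hρ]; linarith
  have hcont : Tendsto ψ (𝓝 (0, K, M)) (𝓝 (m₀ K)) := by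
    have := (hψ M).continuousAt.tendsto
    rwa [hψ₀] at this
  have h1 : ∀ᶠ y in 𝓝 ((0 : Θ), K, M), ‖ψ y - m₀ K‖ < ρ ∧ good y := by
    exact (eventually_norm_sub_lt hcont hρ0).and (hgood M)
  have h1' : ∀ᶠ y in 𝓝 (((0 : Θ), K), M), ‖ψ (y.1.1, y.1.2, y.2) - m₀ K‖ < ρ ∧
      good (y.1.1, y.1.2, y.2) := by
    have : Tendsto (fun y : (Θ × 𝓚) × 𝓜 => (y.1.1, y.1.2, y.2)) (𝓝 ((0, K), M))
        (𝓝 (0, K, M)) := by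
      have hc : Continuous fun y : (Θ × 𝓚) × 𝓜 => (y.1.1, y.1.2, y.2) := by fun_prop
      exact hc.tendsto _
    exact this.eventually h1
  -- Splitting into a product neighbourhood makes the set of starting points independent of `(θ,
  -- k)`.
  rw [nhds_prod_eq, eventually_prod_iff] at h1'
  obtain ⟨pa, hpa, pb, hpb, hab⟩ := h1'
  refine ⟨{m | pb m}, hpb, fun δ hδ => ?_⟩
  have hcont2 : Tendsto (fun y : Θ × 𝓚 => ψ (y.1, y.2, m₀ K)) (𝓝 (0, K)) (𝓝 (m₀ K)) := by
    have h2 := (hψ (m₀ K)).continuousAt.tendsto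
    rw [hψ₀] at h2
    have hc : Continuous fun y : Θ × 𝓚 => (y.1, y.2, m₀ K) := by fun_prop
    exact h2.comp (hc.tendsto (0, K))
  have h3 : ∀ᶠ y in 𝓝 ((0 : Θ), K), ‖ψ (y.1, y.2, m₀ K) - m₀ K‖ < min ρ (δ / 2) / 2 := by
    exact eventually_norm_sub_lt hcont2 (by positivity)
  filter_upwards [hpa, h3, Metric.ball_mem_nhds ((0 : Θ), K) hρ0] with y hy1 hy3 hy4 s hs0 hs
  have hy5 : ‖y.1‖ < ρ ∧ ‖y.2 - K‖ < ρ := by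
    rw [Metric.mem_ball, Prod.dist_eq, max_lt_iff] at hy4
    simpa only [dist_eq_norm, sub_zero] using hy4
  have hmin1 : min ρ (δ / 2) ≤ ρ := min_le_left _ _
  have hmin2 : min ρ (δ / 2) ≤ δ / 2 := min_le_right _ _
  have hlip' : ∀ m m', ‖m - m₀ K‖ ≤ ρ → ‖m' - m₀ K‖ ≤ ρ →
      ‖ψ (y.1, y.2, m) - ψ (y.1, y.2, m')‖ ≤ 1 / 2 * ‖m - m'‖ := fun m m' hm hm' => by
    have := hlip y.1 y.2 y.2 m m' (hy5.1.trans hρr) (hy5.2.trans hρr) (hy5.2.trans hρr)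
      (hm.trans_lt hρr) (hm'.trans_lt hρr)
    simpa using this
  obtain ⟨L, hL, hfix, hseq⟩ := exists_fixedPoint_of_half_contraction
    (f := fun m => ψ (y.1, y.2, m)) hρ0.le (by linarith) hlip'
  have hgd : ∀ m, ‖m - m₀ K‖ ≤ ρ → good (y.1, y.2, m) := fun m hm => hge (by
    simp only [Prod.dist_eq, max_lt_iff]
    simp only [dist_eq_norm, sub_zero]
    exact ⟨hy5.1.trans hρe, hy5.2.trans hρe, hm.trans_lt hρe⟩)
  obtain ⟨hs1, hs2⟩ := hab hy1 hs0
  -- The sequence is shifted by one, since only `s 1` is known to lie in the ball of contraction.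
  obtain ⟨ht1, ht2⟩ := hseq (fun k => s (k + 1)) (by simpa [hs] using hs1.le) (fun k => hs _)
  refine ⟨fun z => ?_, L, (tendsto_add_atTop_iff_nat 1).1 ht2, ?_, hfix, hgd L hL⟩
  · cases z with
    | zero => exact hs2
    | succ z => exact hgd _ (ht1 z)
  · have h5 := hlip' L (m₀ K) hL (by simpa using hρ0.le)
    rw [hfix] at h5
    have h6 := norm_add_le (L - ψ (y.1, y.2, m₀ K)) (ψ (y.1, y.2, m₀ K) - m₀ K)
    rw [sub_add_sub_cancel] at h6
    linarith

/-- Inner fixed points satisfy `‖m - m'‖ ≤ C ‖k - k'‖ + ‖m - m'‖ / 2`, hence depend on `k` with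
constant `2 C`. The derivative of `φ` in `(k, m)` vanishes at the base point because that of `k₀`
does. With `k = k'` the first estimate also gives uniqueness of the inner fixed point. -/
lemma outer_lipschitz {K : 𝓚} (hψ : ContDiffAt ℝ 1 ψ (0, K, m₀ K))
    (hφ : ContDiffAt ℝ 1 φ (0, K, m₀ K)) (hψ₀ : ∀ K M, ψ (0, K, M) = m₀ K)
    (hφ₀ : ∀ K M, φ (0, K, M) = k₀ K) (hk₀ : HasFDerivAt k₀ (0 : 𝓚 →L[ℝ] 𝓚) K) :
    ∃ C ≥ 0, ∃ r > 0, ∀ θ k k' m m', ‖θ‖ < r → ‖k - K‖ < r → ‖k' - K‖ < r →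
      ‖m - m₀ K‖ < r → ‖m' - m₀ K‖ < r → ψ (θ, k, m) = m → ψ (θ, k', m') = m' →
      ‖m - m'‖ ≤ C * ‖k - k'‖ ∧ ‖φ (θ, k, m) - φ (θ, k', m')‖ ≤ 1 / 2 * ‖k - k'‖ := by
  obtain ⟨C, hC, r, hr, hlip⟩ := inner_lipschitz hψ hψ₀
  have hs := hφ.hasStrictFDerivAt one_ne_zero
  set φ' := fderiv ℝ φ (0, K, m₀ K)
  have ha : ∀ k m, ‖φ' (0, k, m)‖ ≤ 0 * ‖k‖ := fun k m => by
    have h1 : HasFDerivAt (fun y : 𝓚 × 𝓜 => ((0 : Θ), y))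
        (ContinuousLinearMap.inr ℝ Θ (𝓚 × 𝓜)) (K, m₀ K) := by
      have h2 := (hasFDerivAt_const (𝕜 := ℝ) (0 : Θ) (K, m₀ K)).prodMk (hasFDerivAt_id (K, m₀ K))
      refine h2.congr_fderiv ?_
      ext <;> simp
    have h3 := hs.hasFDerivAt.comp (K, m₀ K) h1
    have h4 : (φ ∘ fun y : 𝓚 × 𝓜 => ((0 : Θ), y)) = fun y => k₀ y.1 := by
      ext y; simp [hφ₀]
    rw [h4] at h3
    have h5 := h3.unique (hk₀.comp (K, m₀ K) hasFDerivAt_fst)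
    have h6 := congrArg (fun T : 𝓚 × 𝓜 →L[ℝ] 𝓚 => T (k, m)) h5
    simp only [ContinuousLinearMap.comp_apply, ContinuousLinearMap.inr_apply,
      _root_.zero_apply] at h6
    simp [h6]
  -- With this error `ε` the two contributions add up to `ε + ε * (2 * C) = 1 / 2`.
  obtain ⟨r', hr', h⟩ := eventually_norm_sub_le hs ha
    (by positivity : (0 : ℝ) < 1 / (2 * (1 + 2 * C)))
  refine ⟨2 * C, by positivity, min r r', lt_min hr hr', fun θ k k' m m' h1 h2 h3 h4 h5 e e' => ?_⟩
  rw [lt_min_iff] at h1 h2 h3 h4 h5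
  have h6 := hlip θ k k' m m' h1.1 h2.1 h3.1 h4.1 h5.1
  rw [e, e'] at h6
  have h7 : ‖m - m'‖ ≤ 2 * C * ‖k - k'‖ := by linarith
  refine ⟨h7, ?_⟩
  have h8 := h θ k k' m m' (by simpa using h1.2) h2.2 h3.2 h4.2 h5.2
  refine h8.trans ?_
  have h9 : 1 / (2 * (1 + 2 * C)) * ‖m - m'‖ ≤ 1 / (2 * (1 + 2 * C)) * (2 * C * ‖k - k'‖) := by
    gcongr
  have h10 : (0 + 1 / (2 * (1 + 2 * C))) * ‖k - k'‖
      + 1 / (2 * (1 + 2 * C)) * (2 * C * ‖k - k'‖) = 1 / 2 * ‖k - k'‖ := by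
    field_simp
    ring
  linarith

/-- The outer map composed with the inner limit is a half-contraction near `K`. The starting data
are only assumed close, because the lemma is applied to a tail of the iteration. -/
lemma nested_near_fixedPoint [CompleteSpace 𝓚] [CompleteSpace 𝓜] {K : 𝓚}
    (hψ : ∀ M, ContDiffAt ℝ 1 ψ (0, K, M)) (hφ : ContDiffAt ℝ 1 φ (0, K, m₀ K))
    (hψ₀ : ∀ K M, ψ (0, K, M) = m₀ K) (hφ₀ : ∀ K M, φ (0, K, M) = k₀ K)
    (hgood : ∀ M, ∀ᶠ y in 𝓝 (0, K, M), good y)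
    (hk₀ : HasFDerivAt k₀ (0 : 𝓚 →L[ℝ] 𝓚) K) (hK : k₀ K = K) :
    ∃ ρ > 0, ∀ᶠ θ in 𝓝 (0 : Θ), ∃ k m, ‖k - K‖ ≤ ρ ∧ good (θ, k, m) ∧ ψ (θ, k, m) = m ∧
      φ (θ, k, m) = k ∧ ∀ (Ks : ℕ → 𝓚) (Ms : ℕ → ℕ → 𝓜), ‖Ks 0 - K‖ ≤ ρ →
      (‖Ms 0 0‖ < ρ ∨ ‖Ms 0 0 - m₀ K‖ < ρ) → (∀ h z, Ms h (z + 1) = ψ (θ, Ks h, Ms h z)) →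
      (∀ h L, Tendsto (Ms h) atTop (𝓝 L) →
        Ks (h + 1) = φ (θ, Ks h, L) ∧ (Ms (h + 1) 0 = 0 ∨ Ms (h + 1) 0 = L)) →
      ∃ Ls : ℕ → 𝓜, (∀ h z, good (θ, Ks h, Ms h z)) ∧ (∀ h, Tendsto (Ms h) atTop (𝓝 (Ls h)) ∧
        good (θ, Ks h, Ls h) ∧ ψ (θ, Ks h, Ls h) = Ls h) ∧
        Tendsto Ks atTop (𝓝 k) ∧ Tendsto Ls atTop (𝓝 m) := by
  obtain ⟨C, hC, r, hr, hout⟩ := outer_lipschitz (hψ (m₀ K)) hφ hψ₀ hφ₀ hk₀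
  obtain ⟨U₀, hU₀, hin₀⟩ := inner_converges hψ hψ₀ hgood 0
  obtain ⟨U₁, hU₁, hin₁⟩ := inner_converges hψ hψ₀ hgood (m₀ K)
  obtain ⟨e₀, he₀, hb₀⟩ := Metric.mem_nhds_iff.1 hU₀
  obtain ⟨e₁, he₁, hb₁⟩ := Metric.mem_nhds_iff.1 hU₁
  -- The limit must come within `e₁` of `m₀ K` to be an admissible warm start, and within `r` for
  -- the Lipschitz estimates.
  obtain ⟨e₂, he₂, hin⟩ := Metric.eventually_nhds_iff.1
    ((hin₀ _ (lt_min he₁ hr)).and (hin₁ _ (lt_min he₁ hr)))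
  set ρ := min (min r e₂) (min e₀ e₁) / 2 with hρ
  have hρ0 : 0 < ρ := by positivity
  have hlt : ρ < r ∧ ρ < e₂ ∧ ρ < e₀ ∧ ρ < e₁ := by
    have h : ρ < min (min r e₂) (min e₀ e₁) := by
      have : 0 < min (min r e₂) (min e₀ e₁) := by positivity
      simp only [hρ]; linarith
    simp only [lt_min_iff] at h
    exact ⟨h.1.1, h.1.2, h.2.1, h.2.2⟩
  obtain ⟨hρr, hρe₂, hρe₀, hρe₁⟩ := hlt
  have hinner : ∀ θ k, ‖θ‖ < ρ → ‖k - K‖ ≤ ρ → ∀ s : ℕ → 𝓜, (s 0 ∈ U₀ ∨ s 0 ∈ U₁) →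
      (∀ z, s (z + 1) = ψ (θ, k, s z)) → (∀ z, good (θ, k, s z)) ∧ ∃ L, Tendsto s atTop (𝓝 L) ∧
        (‖L - m₀ K‖ < e₁ ∧ ‖L - m₀ K‖ < r) ∧ ψ (θ, k, L) = L ∧ good (θ, k, L) := by
    intro θ k hθ hk s hs0 hs
    have h1 := @hin (θ, k) (by
      simp only [Prod.dist_eq, max_lt_iff]
      simp only [dist_eq_norm, sub_zero]
      exact ⟨hθ.trans hρe₂, hk.trans_lt hρe₂⟩)
    simp only [lt_min_iff] at h1
    rcases hs0 with hs0 | hs0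
    · exact h1.1 s hs0 hs
    · exact h1.2 s hs0 hs
  have hfixed : ∀ θ k, ‖θ‖ < ρ → ‖k - K‖ ≤ ρ → ∃ L, ‖L - m₀ K‖ < r ∧ ψ (θ, k, L) = L ∧
      good (θ, k, L) := fun θ k hθ hk => by
    obtain ⟨-, L, -, h2, h3, h4⟩ := hinner θ k hθ hk (fun z => (fun m => ψ (θ, k, m))^[z] (m₀ K))
      (Or.inr (mem_of_mem_nhds hU₁)) (fun z => Function.iterate_succ_apply' _ _ _)
    exact ⟨L, h2.2, h3, h4⟩
  -- `ℓ θ k` is the limit of the inner iteration, so the outer iteration becomes that of `k ↦ φ (θ,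
  -- k, ℓ θ k)`.
  choose! ℓ hℓr hℓfix hℓgood using hfixed
  have hout' : ∀ θ k k', ‖θ‖ < ρ → ‖k - K‖ ≤ ρ → ‖k' - K‖ ≤ ρ → ∀ m m', ‖m - m₀ K‖ < r →
      ‖m' - m₀ K‖ < r → ψ (θ, k, m) = m → ψ (θ, k', m') = m' → ‖m - m'‖ ≤ C * ‖k - k'‖ ∧
        ‖φ (θ, k, m) - φ (θ, k', m')‖ ≤ 1 / 2 * ‖k - k'‖ := fun θ k k' h1 h2 h3 m m' =>
    hout θ k k' m m' (h1.trans hρr) (h2.trans_lt hρr) (h3.trans_lt hρr)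
  -- the limit of the inner iteration at `K` is close to `m₀ K`
  have hφcont : Tendsto φ (𝓝 (0, K, m₀ K)) (𝓝 K) := by
    have := hφ.continuousAt.tendsto
    rwa [hφ₀, hK] at this
  obtain ⟨d, hd, hφd⟩ := Metric.eventually_nhds_iff.1
    (eventually_norm_sub_lt hφcont (by positivity : 0 < ρ / 2))
  have hclose : ∀ᶠ θ in 𝓝 (0 : Θ), ‖ℓ θ K - m₀ K‖ < d := by
    have h1 := hin₁ d hd
    have h2 : Tendsto (fun θ : Θ => (θ, K)) (𝓝 0) (𝓝 (0, K)) := by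
      have hc : Continuous fun θ : Θ => (θ, K) := by fun_prop
      exact hc.tendsto 0
    have h3 := eventually_norm_sub_lt (tendsto_id (α := Θ) (x := 𝓝 0)) hρ0
    filter_upwards [h2.eventually h1, h3] with θ h4 h5
    rw [id, sub_zero] at h5
    have hKρ : ‖K - K‖ ≤ ρ := by simpa using hρ0.le
    obtain ⟨-, L, h6, h7, -⟩ := h4 (fun z => (fun m => ψ (θ, K, m))^[z] (m₀ K))
      (mem_of_mem_nhds hU₁) (fun z => Function.iterate_succ_apply' _ _ _)
    obtain ⟨-, L', h6', h7', h8', -⟩ := hinner θ K h5 hKρ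
      (fun z => (fun m => ψ (θ, K, m))^[z] (m₀ K))
      (Or.inr (mem_of_mem_nhds hU₁)) (fun z => Function.iterate_succ_apply' _ _ _)
    obtain rfl := tendsto_nhds_unique h6 h6'
    have h9 := (hout' θ K K h5 hKρ hKρ _ _ h7'.2 (hℓr θ K h5 hKρ) h8' (hℓfix θ K h5 hKρ)).1
    rw [sub_self, norm_zero, mul_zero] at h9
    rwa [← sub_eq_zero.1 (norm_le_zero_iff.1 h9)]
  refine ⟨ρ, hρ0, ?_⟩
  filter_upwards [hclose, eventually_norm_sub_lt (tendsto_id (α := Θ) (x := 𝓝 0)) hρ0,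
    eventually_norm_sub_lt (tendsto_id (α := Θ) (x := 𝓝 0)) hd] with θ hθ1 hθ2 hθ3
  rw [id, sub_zero] at hθ2 hθ3
  have hKρ : ‖K - K‖ ≤ ρ := by simpa using hρ0.le
  obtain ⟨k, hk, hfix, hseq⟩ := exists_fixedPoint_of_half_contraction
    (f := fun k => φ (θ, k, ℓ θ k)) (c := K) hρ0.le (by
      refine (@hφd (θ, K, ℓ θ K) ?_).le
      simp only [Prod.dist_eq, max_lt_iff]
      simp only [dist_eq_norm, sub_zero, sub_self, norm_zero]
      exact ⟨hθ3, hd, hθ1⟩) (fun k k' h1 h2 =>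
      (hout' θ k k' hθ2 h1 h2 _ _ (hℓr θ k hθ2 h1) (hℓr θ k' hθ2 h2) (hℓfix θ k hθ2 h1)
        (hℓfix θ k' hθ2 h2)).2)
  refine ⟨k, ℓ θ k, hk, hℓgood θ k hθ2 hk, hℓfix θ k hθ2 hk, hfix, fun Ks Ms hK0 hM0 hM hKM => ?_⟩
  have hlim : ∀ h, ‖Ks h - K‖ ≤ ρ → (Ms h 0 ∈ U₀ ∨ Ms h 0 ∈ U₁) →
      (∀ z, good (θ, Ks h, Ms h z)) ∧ Tendsto (Ms h) atTop (𝓝 (ℓ θ (Ks h))) ∧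
        ‖ℓ θ (Ks h) - m₀ K‖ < e₁ := fun h h1 h2 => by
    obtain ⟨h3, L, h4, h5, h6, h7⟩ := hinner θ (Ks h) hθ2 h1 (Ms h) h2 (hM h)
    have h8 := (hout' θ (Ks h) (Ks h) hθ2 h1 h1 _ _ h5.2 (hℓr θ (Ks h) hθ2 h1) h6
      (hℓfix θ (Ks h) hθ2 h1)).1
    have h9 : L = ℓ θ (Ks h) := by
      rw [sub_self, norm_zero, mul_zero] at h8
      exact sub_eq_zero.1 (norm_le_zero_iff.1 h8)
    rw [← h9]
    exact ⟨h3, h4, h5.1⟩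
  -- The invariant must include the start of the inner loop: a restart at zero lies in `U₀`, a
  -- continuation in `U₁`.
  have hstay : ∀ h, ‖Ks h - K‖ ≤ ρ ∧ (Ms h 0 ∈ U₀ ∨ Ms h 0 ∈ U₁) := by
    intro h
    induction h with
    | zero =>
      refine ⟨hK0, hM0.imp (fun h1 => hb₀ ?_) (fun h1 => hb₁ ?_)⟩
      · simpa using h1.trans hρe₀
      · simpa [dist_eq_norm] using h1.trans hρe₁
    | succ h ih =>
      obtain ⟨-, h2, h3⟩ := hlim h ih.1 ih.2
      obtain ⟨h4, h5⟩ := hKM h _ h2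
      refine ⟨?_, h5.imp (fun h6 => ?_) (fun h6 => ?_)⟩
      · rw [h4]
        exact ((hseq (fun n => (fun k => φ (θ, k, ℓ θ k))^[n] (Ks h)) ih.1
          (fun z => Function.iterate_succ_apply' _ _ _)).1 1)
      · rw [h6]; exact mem_of_mem_nhds hU₀
      · rw [h6]; exact hb₁ (by simpa [dist_eq_norm] using h3)
  have hl := fun h => hlim h (hstay h).1 (hstay h).2
  have hconv := (hseq Ks hK0 fun h => (hKM h _ (hl h).2.1).1).2
  refine ⟨fun h => ℓ θ (Ks h), fun h => (hl h).1, fun h => ⟨(hl h).2.1, hℓgood _ _ hθ2 (hstay h).1,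
    hℓfix _ _ hθ2 (hstay h).1⟩, hconv, ?_⟩
  rw [tendsto_iff_norm_sub_tendsto_zero] at hconv ⊢
  refine squeeze_zero (fun _ => norm_nonneg _) (fun h => (hout' θ (Ks h) k hθ2 (hstay h).1 hk _ _
    (hℓr _ _ hθ2 (hstay h).1) (hℓr _ _ hθ2 hk) (hℓfix _ _ hθ2 (hstay h).1)
    (hℓfix _ _ hθ2 hk)).1) ?_
  simpa using hconv.const_mul C

/-- Finite-time shadowing of the unperturbed orbit. A warm start at step `h` is close to `m₀ (κ (h -
1))`, the unperturbed limit of the previous inner loop. The truncated `0 - 1` is harmless since the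
first loop starts at zero. -/
lemma nested_near_orbit [CompleteSpace 𝓜] {Ω : Set 𝓚}
    (hψ : ∀ K ∈ Ω, ∀ M, ContDiffAt ℝ 1 ψ (0, K, M))
    (hφ : ∀ K ∈ Ω, ∀ M, ContDiffAt ℝ 1 φ (0, K, M))
    (hψ₀ : ∀ K M, ψ (0, K, M) = m₀ K) (hφ₀ : ∀ K M, φ (0, K, M) = k₀ K)
    (hgood : ∀ K ∈ Ω, ∀ M, ∀ᶠ y in 𝓝 (0, K, M), good y)
    {κ : ℕ → 𝓚} (hκ : ∀ h, κ (h + 1) = k₀ (κ h)) (hκΩ : ∀ h, κ h ∈ Ω) (h : ℕ) :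
    ∀ δ > 0, ∀ᶠ θ in 𝓝 (0 : Θ), ∀ (Ks : ℕ → 𝓚) (Ms : ℕ → ℕ → 𝓜),
      IsNestedIteration ψ φ θ (κ 0) Ks Ms →
      ‖Ks h - κ h‖ < δ ∧ (‖Ms h 0‖ < δ ∨ ‖Ms h 0 - m₀ (κ (h - 1))‖ < δ) ∧
      ∀ j < h, (∀ z, good (θ, Ks j, Ms j z)) ∧
        ∃ L, Tendsto (Ms j) atTop (𝓝 L) ∧ good (θ, Ks j, L) ∧ ψ (θ, Ks j, L) = L := by
  induction h with
  | zero =>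
    refine fun δ hδ => Eventually.of_forall fun θ Ks Ms hit => ⟨?_, Or.inl ?_, by simp⟩
    · simpa [hit.outer_zero] using hδ
    · simpa [hit.inner_zero] using hδ
  | succ h ih =>
    intro δ hδ
    obtain ⟨U₀, hU₀, hin₀⟩ := inner_converges (hψ _ (hκΩ h)) hψ₀ (hgood _ (hκΩ h)) 0
    obtain ⟨U₁, hU₁, hin₁⟩ := inner_converges (hψ _ (hκΩ h)) hψ₀ (hgood _ (hκΩ h))
      (m₀ (κ (h - 1)))
    obtain ⟨e₀, he₀, hb₀⟩ := Metric.mem_nhds_iff.1 hU₀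
    obtain ⟨e₁, he₁, hb₁⟩ := Metric.mem_nhds_iff.1 hU₁
    have hφcont : Tendsto φ (𝓝 (0, κ h, m₀ (κ h))) (𝓝 (κ (h + 1))) := by
      have := (hφ _ (hκΩ h) (m₀ (κ h))).continuousAt.tendsto
      rwa [hφ₀, ← hκ] at this
    obtain ⟨d, hd, hφd⟩ := Metric.eventually_nhds_iff.1 (eventually_norm_sub_lt hφcont hδ)
    obtain ⟨e₂, he₂, hin⟩ := Metric.eventually_nhds_iff.1
      ((hin₀ _ (lt_min hδ hd)).and (hin₁ _ (lt_min hδ hd)))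
    -- The accuracy demanded of the earlier steps is fixed only after the radii at step `h` are
    -- known.
    filter_upwards [ih (min (min e₀ e₁) (min e₂ d)) (by positivity),
      eventually_norm_sub_lt (tendsto_id (α := Θ) (x := 𝓝 0)) (lt_min he₂ hd)]
      with θ hθ hθ2 Ks Ms hit
    rw [id, sub_zero, lt_min_iff] at hθ2
    obtain ⟨h1, h2, h3⟩ := hθ Ks Ms hit
    simp only [lt_min_iff] at h1 h2
    have h4 := @hin (θ, Ks h) (by
      simp only [Prod.dist_eq, max_lt_iff]
      simp only [dist_eq_norm, sub_zero]
      exact ⟨hθ2.1, h1.2.1⟩)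
    have h5 : (∀ z, good (θ, Ks h, Ms h z)) ∧ ∃ L, Tendsto (Ms h) atTop (𝓝 L) ∧
        ‖L - m₀ (κ h)‖ < min δ d ∧ ψ (θ, Ks h, L) = L ∧ good (θ, Ks h, L) := by
      rcases h2 with h2 | h2
      · exact h4.1 _ (hb₀ (by simpa using h2.1.1)) (hit.inner_succ h)
      · exact h4.2 _ (hb₁ (by simpa [dist_eq_norm] using h2.1.2)) (hit.inner_succ h)
    obtain ⟨h6, L, h7, h8, h9, h10⟩ := h5
    rw [lt_min_iff] at h8
    obtain ⟨h11, h12⟩ := hit.outer_succ h L h7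
    refine ⟨?_, h12.imp (fun h13 => ?_) (fun h13 => ?_), fun j hj => ?_⟩
    · rw [h11]
      refine @hφd (θ, Ks h, L) ?_
      simp only [Prod.dist_eq, max_lt_iff]
      simp only [dist_eq_norm, sub_zero]
      exact ⟨hθ2.2, h1.2.2, h8.2⟩
    · simpa [h13] using hδ
    · simpa [h13] using h8.1
    · rcases Nat.lt_succ_iff_lt_or_eq.1 hj with hj | rfl
      · exact h3 j hj
      · exact ⟨h6, L, h7, h10, h9⟩

/-- The nested iteration converges for all small parameters, if for the parameter zero its maps do
not depend on the inner variable and its outer iterates converge to a superattracting point. -/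
theorem nested_converges [CompleteSpace 𝓚] [CompleteSpace 𝓜] {Ω : Set 𝓚}
    (hψ : ∀ K ∈ Ω, ∀ M, ContDiffAt ℝ 1 ψ (0, K, M))
    (hφ : ∀ K ∈ Ω, ∀ M, ContDiffAt ℝ 1 φ (0, K, M))
    (hψ₀ : ∀ K M, ψ (0, K, M) = m₀ K) (hφ₀ : ∀ K M, φ (0, K, M) = k₀ K)
    (hgood : ∀ K ∈ Ω, ∀ M, ∀ᶠ y in 𝓝 (0, K, M), good y)
    {κ : ℕ → 𝓚} (hκ : ∀ h, κ (h + 1) = k₀ (κ h)) (hκΩ : ∀ h, κ h ∈ Ω) {K : 𝓚}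
    (hlim : Tendsto κ atTop (𝓝 K)) (hKΩ : K ∈ Ω) (hK : k₀ K = K)
    (hk₀ : HasFDerivAt k₀ (0 : 𝓚 →L[ℝ] 𝓚) K) :
    ∀ᶠ θ in 𝓝 (0 : Θ), ∃ k m, good (θ, k, m) ∧ ψ (θ, k, m) = m ∧ φ (θ, k, m) = k ∧
      ∀ (Ks : ℕ → 𝓚) (Ms : ℕ → ℕ → 𝓜), IsNestedIteration ψ φ θ (κ 0) Ks Ms →
      ∃ Ls : ℕ → 𝓜, (∀ h z, good (θ, Ks h, Ms h z)) ∧ (∀ h, Tendsto (Ms h) atTop (𝓝 (Ls h)) ∧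
        good (θ, Ks h, Ls h) ∧ ψ (θ, Ks h, Ls h) = Ls h) ∧
        Tendsto Ks atTop (𝓝 k) ∧ Tendsto Ls atTop (𝓝 m) := by
  obtain ⟨ρ, hρ, hnear⟩ := nested_near_fixedPoint (hψ K hKΩ) (hφ K hKΩ _) hψ₀ hφ₀ (hgood K hKΩ)
    hk₀ hK
  have hm₀ : ContinuousAt m₀ K := by
    have h1 := (hψ K hKΩ 0).continuousAt.tendsto
    have h2 : Tendsto (fun k : 𝓚 => ((0 : Θ), k, (0 : 𝓜))) (𝓝 K) (𝓝 (0, K, 0)) := by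
      have hc : Continuous fun k : 𝓚 => ((0 : Θ), k, (0 : 𝓜)) := by fun_prop
      exact hc.tendsto K
    have h3 := h1.comp h2
    simpa only [ContinuousAt, Function.comp_def, hψ₀] using h3
  have hlim' : Tendsto (fun h => m₀ (κ (h - 1))) atTop (𝓝 (m₀ K)) :=
    hm₀.tendsto.comp (hlim.comp (tendsto_sub_atTop_nat 1))
  -- After `H` unperturbed steps, half of `ρ` is left for the shadowing error.
  obtain ⟨H, hH1, hH2⟩ := ((eventually_norm_sub_lt hlim (half_pos hρ)).and
    (eventually_norm_sub_lt hlim' (half_pos hρ))).exists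
  filter_upwards [hnear, nested_near_orbit hψ hφ hψ₀ hφ₀ hgood hκ hκΩ H _ (half_pos hρ)]
    with θ hθ hθ'
  obtain ⟨k, m, -, h1, h2, h3, h4⟩ := hθ
  refine ⟨k, m, h1, h2, h3, fun Ks Ms hit => ?_⟩
  obtain ⟨h5, h6, h7⟩ := hθ' Ks Ms hit
  obtain ⟨Ls, h8, h9, h10, h11⟩ := h4 (fun h => Ks (h + H)) (fun h => Ms (h + H)) (by
      have := norm_add_le (Ks H - κ H) (κ H - K)
      rw [sub_add_sub_cancel] at this
      simp only [zero_add]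
      linarith) (by
      simp only [zero_add]
      refine h6.imp (fun h => by linarith) (fun h => ?_)
      have := norm_add_le (Ms H 0 - m₀ (κ (H - 1))) (m₀ (κ (H - 1)) - m₀ K)
      rw [sub_add_sub_cancel] at this
      linarith) (fun h z => hit.inner_succ _ z) (fun h L hL => by
      have := hit.outer_succ (h + H) L hL
      rwa [show h + 1 + H = h + H + 1 by omega])
  have hall : ∀ h, (∀ z, good (θ, Ks h, Ms h z)) ∧
        ∃ L, Tendsto (Ms h) atTop (𝓝 L) ∧ good (θ, Ks h, L) ∧ ψ (θ, Ks h, L) = L := fun h => by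
    rcases lt_or_ge h H with hh | hh
    · exact h7 h hh
    · obtain ⟨j, rfl⟩ := Nat.exists_eq_add_of_le' hh
      exact ⟨h8 j, Ls j, h9 j⟩
  choose Ls' hLs' using fun h => (hall h).2
  have hshift : ∀ j, Ls' (j + H) = Ls j := fun j =>
    tendsto_nhds_unique (hLs' (j + H)).1 (h9 j).1
  refine ⟨Ls', fun h => (hall h).1, hLs', (tendsto_add_atTop_iff_nat H).1 h10,
    (tendsto_add_atTop_iff_nat H).1 ?_⟩
  simpa only [hshift] using h11

end NestedIteration

/-! ### Policy iteration for the linear-quadratic regulator. -/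

namespace ZeroSumGame

variable {ι κ σ : Type} [Fintype ι] [Fintype κ] [Fintype σ] [DecidableEq ι] [DecidableEq κ]
  [DecidableEq σ] (G : ZeroSumGame ι κ σ)

lemma ctrlGain_stationary {P : Matrix ι ι ℝ} (F : Matrix ι ι ℝ) (hP : IsUnit (G.ctrlHess P).det) :
    G.R * G.ctrlGain P F + G.Bᵀ * P * (F + G.B * G.ctrlGain P F) = 0 := by
  have h : G.ctrlHess P * G.ctrlGain P F = -(G.Bᵀ * P * F) := by
    rw [ctrlGain, Matrix.mul_neg, mul_nonsing_inv_cancel_left _ _ hP]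
  have h' : G.R * G.ctrlGain P F + G.Bᵀ * P * (F + G.B * G.ctrlGain P F)
      = G.ctrlHess P * G.ctrlGain P F + G.Bᵀ * P * F := by
    simp only [ctrlHess, Matrix.add_mul, Matrix.mul_add, Matrix.mul_assoc]
    abel
  rw [h', h, neg_add_cancel]

lemma ctrlGain_minimizes {P : Matrix ι ι ℝ} (hs : P.IsSymm) (hP : Pos (G.ctrlHess P))
    (F : Matrix ι ι ℝ) (x : ι → ℝ) (u : κ → ℝ) :
    qf G.R (G.ctrlGain P F *ᵥ x) + qf P (F *ᵥ x + G.B *ᵥ (G.ctrlGain P F *ᵥ x))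
      ≤ qf G.R u + qf P (F *ᵥ x + G.B *ᵥ u) := by
  have h1 := qf_expand hs G.R_symm G.B (F *ᵥ x) (G.ctrlGain P F *ᵥ x)
    (u - G.ctrlGain P F *ᵥ x)
  have h2 : G.R *ᵥ (G.ctrlGain P F *ᵥ x) + G.Bᵀ *ᵥ (P *ᵥ (F *ᵥ x + G.B *ᵥ (G.ctrlGain P F *ᵥ x)))
      = 0 := by
    have h3 := congrArg (fun T => T *ᵥ x) (G.ctrlGain_stationary F hP.isUnit_det)
    simpa only [add_mulVec, mulVec_add, ← mulVec_mulVec, zero_mulVec] using h3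
  rw [h2, dotProduct_zero, add_sub_cancel] at h1
  have h4 := hP.nonneg (u - G.ctrlGain P F *ᵥ x)
  simp only [ctrlHess] at h4
  linarith

/-- One step of policy iteration for the linear-quadratic regulator without adversary. -/
def lqrStep (K : Matrix κ ι ℝ) : Matrix κ ι ℝ := G.ctrlGain (G.lqrValue K) G.A

lemma lqrCost_isSymm (K : Matrix κ ι ℝ) : (G.Q + Kᵀ * G.R * K).IsSymm := by
  simp [IsSymm, transpose_mul, G.Q_symm.eq, G.R_symm.eq, Matrix.mul_assoc]

variable {G} {K : Matrix κ ι ℝ}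

lemma lqrValue_isSymm (hK : IsUnit (lyapMatrix (G.A + G.B * K)).det) : (G.lqrValue K).IsSymm :=
  lyap_isSymm (G.lqrCost_isSymm K) hK

lemma qf_lqrValue (hK : IsUnit (lyapMatrix (G.A + G.B * K)).det) (x : ι → ℝ) :
    qf (G.lqrValue K) x = qf G.Q x + (qf G.R (K *ᵥ x)
      + qf (G.lqrValue K) (G.A *ᵥ x + G.B *ᵥ (K *ᵥ x))) := by
  have h := congrArg (fun P => qf P x) (lyap_spec (G.Q + Kᵀ * G.R * K) hK)
  simp only [qf_add, ← qf_mulVec] at h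
  rw [lqrValue, h, add_mulVec, mulVec_mulVec, add_assoc]

/-- The value decreases along the stable closed loop, hence is nonnegative; one Bellman step then
gives the bound. Being uniform in `K`, it survives the limit of the iteration. -/
lemma le_qf_lqrValue (hK : Stable (G.A + G.B * K)) (x : ι → ℝ) :
    qf G.Q x ≤ qf (G.lqrValue K) x := by
  have h1 := qf_lqrValue hK.isUnit
  have h2 := hK.qf_nonneg (X := G.lqrValue K) fun x => by
    rw [h1 x, add_mulVec, mulVec_mulVec]
    linarith [G.Q_pos.nonneg x, G.R_pos.nonneg (K *ᵥ x)]
  rw [h1 x]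
  linarith [h2 (G.A *ᵥ x + G.B *ᵥ (K *ᵥ x)), G.R_pos.nonneg (K *ᵥ x)]

lemma lqrValue_pos (hK : Stable (G.A + G.B * K)) : Pos (G.lqrValue K) := fun x hx =>
  (G.Q_pos x hx).trans_le (le_qf_lqrValue hK x)

lemma qf_lqrValue_lqrStep (hK : Stable (G.A + G.B * K)) (x : ι → ℝ) :
    qf G.Q x + (qf G.R (G.lqrStep K *ᵥ x)
      + qf (G.lqrValue K) (G.A *ᵥ x + G.B *ᵥ (G.lqrStep K *ᵥ x))) ≤ qf (G.lqrValue K) x := by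
  have h := G.ctrlGain_minimizes (lqrValue_isSymm hK.isUnit)
    (G.ctrlHess_pos (lqrValue_pos hK).nonneg) G.A x (K *ᵥ x)
  rw [qf_lqrValue hK.isUnit x]
  exact add_le_add_right h _

/-- The old value is a Lyapunov function for the improved feedback, because minimization can only
lower the Bellman expression. -/
lemma stable_lqrStep (hK : Stable (G.A + G.B * K)) : Stable (G.A + G.B * G.lqrStep K) := by
  refine stable_of_pos (lqrValue_pos hK) fun x hx => ?_
  have h := qf_lqrValue_lqrStep hK x
  rw [qf_sub, ← qf_mulVec, add_mulVec, ← mulVec_mulVec]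
  linarith [G.Q_pos x hx, G.R_pos.nonneg (G.lqrStep K *ᵥ x)]

/-- A value that dominates its own update by the feedback `K` dominates the value of `K`. -/
lemma lqrValue_le {P : Matrix ι ι ℝ} (hK : Stable (G.A + G.B * K))
    (h : ∀ x, qf G.Q x + (qf G.R (K *ᵥ x) + qf P (G.A *ᵥ x + G.B *ᵥ (K *ᵥ x))) ≤ qf P x)
    (x : ι → ℝ) : qf (G.lqrValue K) x ≤ qf P x := by
  have h1 := hK.qf_nonneg (X := P - G.lqrValue K) fun x => by
    rw [qf_sub, qf_sub, qf_lqrValue hK.isUnit x, add_mulVec, ← mulVec_mulVec]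
    linarith [h x]
  have := h1 x
  rw [qf_sub] at this
  linarith

/-- The reverse comparison, which shows that the value at a fixed point of policy iteration is
minimal. -/
lemma le_lqrValue {P : Matrix ι ι ℝ} (hK : Stable (G.A + G.B * K))
    (h : ∀ x, qf P x ≤ qf G.Q x + (qf G.R (K *ᵥ x) + qf P (G.A *ᵥ x + G.B *ᵥ (K *ᵥ x))))
    (x : ι → ℝ) : qf P x ≤ qf (G.lqrValue K) x := by
  have h1 := hK.qf_nonneg (X := G.lqrValue K - P) fun x => by
    rw [qf_sub, qf_sub, qf_lqrValue hK.isUnit x, add_mulVec, ← mulVec_mulVec]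
    linarith [h x]
  have := h1 x
  rw [qf_sub] at this
  linarith

lemma stable_lqr_iterate (hK : Stable (G.A + G.B * K)) (h : ℕ) :
    Stable (G.A + G.B * G.lqrStep^[h] K) := by
  induction h with
  | zero => exact hK
  | succ h ih => rw [Function.iterate_succ_apply']; exact stable_lqrStep ih

/-- A sequence of symmetric forms that decreases and is bounded below converges. -/
lemma exists_tendsto_of_antitone {P : ℕ → Matrix ι ι ℝ} (hs : ∀ h, (P h).IsSymm)
    (hP : ∀ h x, 0 ≤ qf (P h) x) (ha : ∀ h x, qf (P (h + 1)) x ≤ qf (P h) x) :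
    ∃ L, Tendsto P atTop (𝓝 L) := by
  have h1 : ∀ x, ∃ l, Tendsto (fun h => qf (P h) x) atTop (𝓝 l) := fun x =>
    ⟨_, tendsto_atTop_ciInf (antitone_nat_of_succ_le fun h => ha h x)
      ⟨0, by rintro _ ⟨h, rfl⟩; exact hP h x⟩⟩
  choose l hl using h1
  refine ⟨Matrix.of fun i j => (l (Pi.single i 1 + Pi.single j 1) - l (Pi.single i 1)
      - l (Pi.single j 1)) / 2, tendsto_pi_nhds.2 fun i => tendsto_pi_nhds.2 fun j => ?_⟩
  refine Tendsto.congr (fun h => (apply_eq_qf (hs h) i j).symm) ?_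
  exact (((hl _).sub (hl _)).sub (hl _)).div_const 2

section

attribute [local instance] Matrix.normedAddCommGroup Matrix.normedSpace

lemma continuousAt_ctrlGain {P : Matrix ι ι ℝ} (hP : IsUnit (G.ctrlHess P).det) (F : Matrix ι ι ℝ) :
    ContinuousAt (fun P => G.ctrlGain P F) P := by
  exact (G.contDiffAt_ctrlGain contDiffAt_id contDiffAt_const hP).continuousAt

end

/-- Policy iteration for the linear-quadratic regulator converges to a stabilizing fixed point. -/
theorem exists_tendsto_lqr_iterate (hK : Stable (G.A + G.B * K)) :
    ∃ K', Tendsto (fun h => G.lqrStep^[h] K) atTop (𝓝 K') ∧ Stable (G.A + G.B * K') ∧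
      G.lqrStep K' = K' := by
  set Ks : ℕ → Matrix κ ι ℝ := fun h => G.lqrStep^[h] K
  have hst : ∀ h, Stable (G.A + G.B * Ks h) := stable_lqr_iterate hK
  have hsucc : ∀ h, Ks (h + 1) = G.lqrStep (Ks h) := fun h => Function.iterate_succ_apply' _ _ _
  obtain ⟨P, hP⟩ := exists_tendsto_of_antitone (P := fun h => G.lqrValue (Ks h))
    (fun h => lqrValue_isSymm (hst h).isUnit) (fun h => (lqrValue_pos (hst h)).nonneg)
    (fun h x => by
      refine lqrValue_le (hst (h + 1)) (fun x => ?_) x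
      rw [hsucc]
      exact qf_lqrValue_lqrStep (hst h) x)
  have hqf : ∀ x, Tendsto (fun h => qf (G.lqrValue (Ks h)) x) atTop (𝓝 (qf P x)) := fun x =>
    ((continuous_qf.comp (Continuous.prodMk_left x)).tendsto P).comp hP
  -- The lower bound by `Q` keeps the limit value positive, so it can serve as a Lyapunov function
  -- for the limit feedback.
  have hPQ : ∀ x, qf G.Q x ≤ qf P x := fun x =>
    ge_of_tendsto' (hqf x) fun h => le_qf_lqrValue (hst h) x
  have hPpos : Pos P := fun x hx => (G.Q_pos x hx).trans_le (hPQ x)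
  have hunit := (G.ctrlHess_pos hPpos.nonneg).isUnit_det
  have hlim : Tendsto Ks atTop (𝓝 (G.ctrlGain P G.A)) := by
    refine (tendsto_add_atTop_iff_nat 1).1 ?_
    simp only [hsucc]
    exact (continuousAt_ctrlGain hunit G.A).tendsto.comp hP
  set K' := G.ctrlGain P G.A with hK'
  -- The Lyapunov equations pass to the limit and become the Riccati equation for `P`.
  have hric : P = G.Q + K'ᵀ * G.R * K' + (G.A + G.B * K')ᵀ * P * (G.A + G.B * K') := by
    refine tendsto_nhds_unique hP ?_
    have h1 : ∀ h, G.lqrValue (Ks h) = G.Q + (Ks h)ᵀ * G.R * Ks h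
        + (G.A + G.B * Ks h)ᵀ * G.lqrValue (Ks h) * (G.A + G.B * Ks h) := fun h =>
      lyap_spec _ (hst h).isUnit
    have hc : Continuous fun y : Matrix κ ι ℝ × Matrix ι ι ℝ => G.Q + y.1ᵀ * G.R * y.1
        + (G.A + G.B * y.1)ᵀ * y.2 * (G.A + G.B * y.1) := by fun_prop
    have h2 := (hc.tendsto (K', P)).comp (hlim.prodMk_nhds hP)
    refine Tendsto.congr (fun h => ?_) h2
    exact (h1 h).symm
  have hstable : Stable (G.A + G.B * K') := by
    refine stable_of_pos hPpos fun x hx => ?_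
    have h1 := congrArg (fun P => qf P x) hric
    simp only [qf_add, ← qf_mulVec] at h1
    rw [qf_sub, ← qf_mulVec]
    linarith [G.Q_pos x hx, G.R_pos.nonneg (K' *ᵥ x)]
  refine ⟨K', hlim, hstable, ?_⟩
  have hval : G.lqrValue K' = P := (lyap_unique hstable.isUnit hric).symm
  rw [lqrStep, hval]

/-! ### The LQR fixed point is superattracting. -/

section Derivative

attribute [local instance] Matrix.normedAddCommGroup Matrix.normedSpace

lemma contDiffAt_lqrValue (hK : IsUnit (lyapMatrix (G.A + G.B * K)).det) :
    ContDiffAt ℝ 1 G.lqrValue K := by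
  refine contDiffAt_lyap ?_ ?_ hK
  · exact contDiffAt_const.add (contDiffAt_matrix_mul contDiffAt_const contDiffAt_id)
  · exact contDiffAt_const.add (contDiffAt_matrix_mul (contDiffAt_matrix_mul
      (contDiffAt_matrix_transpose contDiffAt_id) contDiffAt_const) contDiffAt_id)

/-- The value of `K` itself remains a strict Lyapunov function for all nearby feedbacks. -/
lemma eventually_stable (hK : Stable (G.A + G.B * K)) :
    ∀ᶠ K' in 𝓝 K, Stable (G.A + G.B * K') := by
  have h1 : Pos (G.lqrValue K - (G.A + G.B * K)ᵀ * G.lqrValue K * (G.A + G.B * K)) := fun x hx => by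
    rw [qf_sub, ← qf_mulVec, qf_lqrValue hK.isUnit x, add_mulVec, ← mulVec_mulVec]
    linarith [G.Q_pos x hx, G.R_pos.nonneg (K *ᵥ x)]
  have hc : Continuous fun K' : Matrix κ ι ℝ =>
      G.lqrValue K - (G.A + G.B * K')ᵀ * G.lqrValue K * (G.A + G.B * K') := by fun_prop
  filter_upwards [(hc.tendsto K).eventually h1.eventually] with K' hK'
  exact stable_of_pos (lqrValue_pos hK) hK'

/-- At a fixed point of policy iteration, the value is minimal, hence stationary. -/
lemma hasFDerivAt_lqrValue (hK : Stable (G.A + G.B * K)) (hfix : G.lqrStep K = K) :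
    HasFDerivAt G.lqrValue (0 : Matrix κ ι ℝ →L[ℝ] Matrix ι ι ℝ) K := by
  have hent : ∀ i j, DifferentiableAt ℝ (fun K => G.lqrValue K i j) K := fun i j =>
    (contDiffAt_matrix.1 (contDiffAt_lqrValue hK.isUnit) i j).differentiableAt one_ne_zero
  have hq : ∀ x, HasFDerivAt (fun K => qf (G.lqrValue K) x) (0 : Matrix κ ι ℝ →L[ℝ] ℝ) K := by
    intro x
    have h1 : DifferentiableAt ℝ (fun K => qf (G.lqrValue K) x) K := by
      simp only [qf, mulVec, dotProduct]
      exact DifferentiableAt.fun_sum fun i _ => DifferentiableAt.const_mul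
        (DifferentiableAt.fun_sum fun j _ => (hent i j).mul_const _) _
    -- Since `K` minimizes the Bellman expression of its own value, that value is a lower bound for
    -- the value of every stabilizing `K'`.
    have h2 : IsLocalMin (fun K => qf (G.lqrValue K) x) K := by
      filter_upwards [eventually_stable hK] with K' hK'
      refine le_lqrValue hK' (fun x => ?_) x
      have h3 := G.ctrlGain_minimizes (lqrValue_isSymm hK.isUnit)
        (G.ctrlHess_pos (lqrValue_pos hK).nonneg) G.A x (K' *ᵥ x)
      rw [← lqrStep, hfix] at h3
      rw [qf_lqrValue hK.isUnit x]
      exact add_le_add_right h3 _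
    exact h1.hasFDerivAt.congr_fderiv h2.fderiv_eq_zero
  have he : ∀ i j, HasFDerivAt (fun K => G.lqrValue K i j) (0 : Matrix κ ι ℝ →L[ℝ] ℝ) K := by
    intro i j
    -- Polarization passes from forms to entries. The symmetry it needs is available near `K`, where
    -- feedbacks are stabilizing.
    have h1 := (((hq (Pi.single i 1 + Pi.single j 1)).sub (hq (Pi.single i 1))).sub
      (hq (Pi.single j 1))).mul_const (1 / 2 : ℝ)
    refine (h1.congr_of_eventuallyEq ?_).congr_fderiv (by
      ext d
      change (1 / 2 : ℝ) * ((0 : ℝ) - 0 - 0) = 0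
      norm_num)
    filter_upwards [eventually_stable hK] with K' hK'
    rw [apply_eq_qf (lqrValue_isSymm hK'.isUnit)]
    simp only [Pi.sub_apply]
    ring
  exact hasFDerivAt_pi'.2 fun i => hasFDerivAt_pi'.2 fun j => he i j

/-- The step depends on `K` only through the value, whose derivative vanishes at the fixed point. -/
lemma hasFDerivAt_lqrStep (hK : Stable (G.A + G.B * K)) (hfix : G.lqrStep K = K) :
    HasFDerivAt G.lqrStep (0 : Matrix κ ι ℝ →L[ℝ] Matrix κ ι ℝ) K := by
  have h1 := ((G.contDiffAt_ctrlGain (x := G.lqrValue K) contDiffAt_id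
    (contDiffAt_const (c := G.A))
    (G.ctrlHess_pos (lqrValue_pos hK).nonneg).isUnit_det).differentiableAt
      one_ne_zero).hasFDerivAt
  have h2 := h1.comp K (hasFDerivAt_lqrValue hK hfix)
  exact h2.congr_fderiv (ContinuousLinearMap.comp_zero _)

end Derivative

end ZeroSumGame

/-! ### Convergence of the policy iteration for heavy adversarial weights. -/

namespace ZeroSumGame

variable {ι κ σ : Type} [Fintype ι] [Fintype κ] [Fintype σ] [DecidableEq ι] [DecidableEq κ]
  [DecidableEq σ] (G : ZeroSumGame ι κ σ)

/-- The policy iteration in terms of the matrices of the policies `u = K x`, `v = E M x`. -/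
structure IsPolicyIteration (E : Matrix σ σ ℝ) (K₀ : Matrix κ ι ℝ) (Ks : ℕ → Matrix κ ι ℝ)
    (Ms : ℕ → ℕ → Matrix σ ι ℝ) : Prop where
  outer_zero : Ks 0 = K₀
  inner_zero : Ms 0 0 = 0
  inner_succ : ∀ h z, Ms h (z + 1) = G.advStep E (Ks h) (Ms h z)
  outer_succ : ∀ h L, Tendsto (Ms h) atTop (𝓝 L) →
    Ks (h + 1) = G.ctrlStep E (Ks h) L ∧ (Ms (h + 1) 0 = 0 ∨ Ms (h + 1) 0 = L)

section Convergence

attribute [local instance] Matrix.normedAddCommGroup Matrix.normedSpace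

variable {G} {K : Matrix κ ι ℝ}

lemma pos_smul_one {c : ℝ} (hc : 0 < c) : Pos (c • (1 : Matrix σ σ ℝ)) := fun x hx => by
  rw [qf_smul, qf_one]
  have : 0 < x ⬝ᵥ x := by
    rw [← dotProduct_self_star_pos_iff] at hx
    simpa using hx
  positivity

lemma WellPosed.contDiffAt_value {t : ℝ} {E : Matrix σ σ ℝ} {M : Matrix σ ι ℝ}
    (h : G.WellPosed t E K M) :
    ContDiffAt ℝ 1 (fun y : Matrix κ ι ℝ × Matrix σ ι ℝ => G.value E y.1 y.2) (K, M) :=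
  G.contDiffAt_value contDiffAt_const (by fun_prop) (by fun_prop) h.lyap_unit

lemma wellPosed_zero (hK : Stable (G.A + G.B * K)) (M : Matrix σ ι ℝ) : G.WellPosed 0 0 K M where
  lyap_unit := by rw [closedLoop_zero]; exact hK.isUnit
  adv_unit := by
    rw [advSystem_zero]; exact (pos_smul_one (pow_pos G.β_pos 2)).isUnit_det
  concave := by rw [zero_smul, sub_zero]; exact pos_smul_one (pow_pos G.β_pos 2)
  convex := by rw [value_zero]; exact G.ctrlHess_pos (lqrValue_pos hK).nonneg
  value_pos := by rw [value_zero]; exact lqrValue_pos hK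
  cost_pos := by simpa using G.Q_pos

lemma eventually_isUnit_det {X ν : Type*} [TopologicalSpace X] [Fintype ν] [DecidableEq ν]
    {f : X → Matrix ν ν ℝ} {x : X} (hf : ContinuousAt f x) (hx : IsUnit (f x).det) :
    ∀ᶠ y in 𝓝 x, IsUnit (f y).det := by
  have hc : Continuous fun A : Matrix ν ν ℝ => A.det := by fun_prop
  have h1 : ContinuousAt (fun y => (f y).det) x := ContinuousAt.comp hc.continuousAt hf
  filter_upwards [h1.eventually_ne hx.ne_zero] with y hy
  exact hy.isUnit

/-- Every clause is an open condition on a continuous function of `(t, E, K, M)`. The separate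
parameter `t` keeps concavity continuous at zero, where the weight `W = E⁻¹` itself blows up. -/
lemma eventually_wellPosed (hK : Stable (G.A + G.B * K)) (M : Matrix σ ι ℝ) :
    ∀ᶠ y in 𝓝 ((0, K, M) : (ℝ × Matrix σ σ ℝ) × Matrix κ ι ℝ × Matrix σ ι ℝ),
      G.WellPosed y.1.1 y.1.2 y.2.1 y.2.2 := by
  have h := wellPosed_zero hK M
  set y₀ : (ℝ × Matrix σ σ ℝ) × Matrix κ ι ℝ × Matrix σ ι ℝ := (0, K, M)
  have ht : ContDiffAt ℝ 1 (fun y : (ℝ × Matrix σ σ ℝ) × Matrix κ ι ℝ × Matrix σ ι ℝ => y.1.1) y₀ := by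
    fun_prop
  have hE : ContDiffAt ℝ 1 (fun y : (ℝ × Matrix σ σ ℝ) × Matrix κ ι ℝ × Matrix σ ι ℝ => y.1.2) y₀ := by
    fun_prop
  have hk : ContDiffAt ℝ 1 (fun y : (ℝ × Matrix σ σ ℝ) × Matrix κ ι ℝ × Matrix σ ι ℝ => y.2.1) y₀ := by
    fun_prop
  have hm : ContDiffAt ℝ 1 (fun y : (ℝ × Matrix σ σ ℝ) × Matrix κ ι ℝ × Matrix σ ι ℝ => y.2.2) y₀ := by
    fun_prop
  have hP := G.contDiffAt_value hE hk hm h.lyap_unit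
  have e1 := eventually_isUnit_det
    (contDiffAt_lyapMatrix (G.contDiffAt_closedLoop hE hk hm)).continuousAt h.lyap_unit
  have e2 := eventually_isUnit_det (G.contDiffAt_advSystem hE hP).continuousAt h.adv_unit
  have e3 := (contDiffAt_const (c := G.β ^ 2 • (1 : Matrix σ σ ℝ))).sub
    (ht.smul (G.contDiffAt_curv hP))
  have e4 := G.contDiffAt_ctrlHess hP
  have e5 := (contDiffAt_const (c := G.Q)).sub (ContDiffAt.const_smul (G.β ^ 2)
    (contDiffAt_matrix_mul (contDiffAt_matrix_mul (contDiffAt_matrix_transpose hm) hE) hm))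
  filter_upwards [e1, e2, e3.continuousAt.eventually h.concave.eventually,
    e4.continuousAt.eventually h.convex.eventually,
    hP.continuousAt.eventually h.value_pos.eventually,
    e5.continuousAt.eventually h.cost_pos.eventually] with y h1 h2 h3 h4 h5 h6
  exact ⟨h1, h2, h3, h4, h5, h6⟩

/-- For heavy weights of the adversarial inputs, the policy iteration is well posed and converges,
from every stabilizing initial feedback. -/
theorem policyIteration_converges {K₀ : Matrix κ ι ℝ} (hK₀ : Stable (G.A + G.B * K₀)) :
    ∃ ε > 0, ∀ (t : ℝ) (E : Matrix σ σ ℝ), |t| < ε → (∀ i j, |E i j| < ε) →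
      ∃ K M, G.WellPosed t E K M ∧ G.advStep E K M = M ∧ G.ctrlStep E K M = K ∧
        ∀ Ks Ms, G.IsPolicyIteration E K₀ Ks Ms →
        ∃ Ls : ℕ → Matrix σ ι ℝ, (∀ h z, G.WellPosed t E (Ks h) (Ms h z)) ∧
          (∀ h, Tendsto (Ms h) atTop (𝓝 (Ls h)) ∧ G.WellPosed t E (Ks h) (Ls h) ∧
            G.advStep E (Ks h) (Ls h) = Ls h) ∧
          Tendsto Ks atTop (𝓝 K) ∧ Tendsto Ls atTop (𝓝 M) := by
  obtain ⟨K', hlim, hst, hfix⟩ := exists_tendsto_lqr_iterate hK₀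
  -- The perturbation parameter is the pair `(t, E)`. The argument 0 in `m₀` is arbitrary, as
  -- `advStep 0 K` is constant.
  have key := nested_converges (Θ := ℝ × Matrix σ σ ℝ) (𝓚 := Matrix κ ι ℝ) (𝓜 := Matrix σ ι ℝ)
    (ψ := fun y => G.advStep y.1.2 y.2.1 y.2.2) (φ := fun y => G.ctrlStep y.1.2 y.2.1 y.2.2)
    (m₀ := fun K => G.advStep 0 K 0) (k₀ := G.lqrStep)
    (good := fun y => G.WellPosed y.1.1 y.1.2 y.2.1 y.2.2)
    (Ω := {K | Stable (G.A + G.B * K)}) (κ := fun h => G.lqrStep^[h] K₀) (K := K')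
    (fun K hK M => G.contDiffAt_advStep (by fun_prop) (by fun_prop) (by fun_prop)
      (wellPosed_zero hK M).lyap_unit (wellPosed_zero hK M).adv_unit)
    (fun K hK M => G.contDiffAt_ctrlStep (by fun_prop) (by fun_prop) (by fun_prop)
      (wellPosed_zero hK M).lyap_unit (wellPosed_zero hK M).convex.isUnit_det)
    (fun K M => by
      change G.advStep 0 K M = G.advStep 0 K 0
      rw [advStep_zero, advStep_zero])
    (fun K M => G.ctrlStep_zero K M)
    (fun K hK M => eventually_wellPosed hK M)
    (fun h => Function.iterate_succ_apply' _ _ _) (stable_lqr_iterate hK₀) hlim hst hfix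
    (hasFDerivAt_lqrStep hst hfix)
  obtain ⟨ε, hε, hkey⟩ := Metric.eventually_nhds_iff.1 key
  refine ⟨ε, hε, fun t E ht hE => ?_⟩
  obtain ⟨K, M, h1, h2, h3, h4⟩ := @hkey (t, E) (by
    rw [Prod.dist_eq, max_lt_iff]
    refine ⟨by simpa [Real.dist_eq] using ht, ?_⟩
    change dist E 0 < ε
    rw [dist_zero_right]
    refine (Matrix.norm_lt_iff hε).2 fun i j => hE i j)
  exact ⟨K, M, h1, h2, h3, fun Ks Ms hit => h4 Ks Ms
    ⟨hit.outer_zero, hit.inner_zero, hit.inner_succ, hit.outer_succ⟩⟩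

end Convergence

end ZeroSumGame

/-! ### The Q-function: its optimizers and saddle points. -/

namespace ZeroSumGame

variable {ι κ σ : Type} [Fintype ι] [Fintype κ] [Fintype σ] [DecidableEq ι] [DecidableEq κ]
  [DecidableEq σ] (G : ZeroSumGame ι κ σ)

/-- The Q-function of the value `P` for the weight `W` of the adversarial inputs. -/
def qFun (W : Matrix σ σ ℝ) (P : Matrix ι ι ℝ) (x : ι → ℝ) (u : κ → ℝ) (v : σ → ℝ) : ℝ :=
  qf G.Q x + qf G.R u - G.β ^ 2 * qf W v + qf P (G.A *ᵥ x + G.B *ᵥ u + G.D *ᵥ v)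

/-- `W` is a symmetric weight, block diagonal with respect to the components of the adversarial
input, with `W ≥ t⁻¹`. -/
structure IsWeight (t : ℝ) (W : Matrix σ σ ℝ) : Prop where
  symm : W.IsSymm
  block : ∀ i j, G.lab i ≠ G.lab j → W i j = 0
  pos : 0 < t
  ge : ∀ v, v ⬝ᵥ v ≤ t * qf W v

variable {G} {t : ℝ} {W : Matrix σ σ ℝ} {K : Matrix κ ι ℝ} {M : Matrix σ ι ℝ}

lemma dotProduct_self_pos {ν : Type*} [Fintype ν] {x : ν → ℝ} (hx : x ≠ 0) : 0 < x ⬝ᵥ x := by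
  rw [← dotProduct_self_star_pos_iff] at hx
  simpa using hx

lemma IsWeight.weight_pos (hW : G.IsWeight t W) : Pos W := fun v hv =>
  pos_of_mul_pos_right ((dotProduct_self_pos hv).trans_le (hW.ge v)) hW.pos.le

lemma IsWeight.isUnit_det (hW : G.IsWeight t W) : IsUnit W.det := hW.weight_pos.isUnit_det

lemma IsWeight.inv_symm (hW : G.IsWeight t W) : (W⁻¹)ᵀ = W⁻¹ := by
  rw [transpose_nonsing_inv, hW.symm.eq]

lemma IsWeight.mulVec_inv (hW : G.IsWeight t W) (m : σ → ℝ) : W *ᵥ (W⁻¹ *ᵥ m) = m := by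
  rw [mulVec_mulVec, mul_nonsing_inv _ hW.isUnit_det, one_mulVec]

lemma IsWeight.inv_mulVec (hW : G.IsWeight t W) (m : σ → ℝ) : W⁻¹ *ᵥ (W *ᵥ m) = m := by
  rw [mulVec_mulVec, nonsing_inv_mul _ hW.isUnit_det, one_mulVec]

/-- For the column `v` of the inverse with index `j`, `v ⬝ᵥ v ≤ t * v j`. Hence `v j ≤ t`, and then
every `v i ^ 2` is at most `t ^ 2`. -/
lemma IsWeight.abs_inv_le (hW : G.IsWeight t W) (i j : σ) : |W⁻¹ i j| ≤ t := by
  set v : σ → ℝ := W⁻¹ *ᵥ Pi.single j 1 with hv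
  have hij : ∀ i, W⁻¹ i j = v i := fun i => by simp [hv]
  have h1 : qf W v = v j := by
    rw [qf, hv, hW.mulVec_inv]
    simp
  have h2 := hW.ge v
  rw [h1] at h2
  have hle : ∀ i, v i ^ 2 ≤ v ⬝ᵥ v := fun i => by
    rw [sq]
    exact Finset.single_le_sum (f := fun i => v i * v i) (fun j _ => mul_self_nonneg _)
      (Finset.mem_univ i)
  have h3 := hle j
  have h4 := hle i
  have ht := hW.pos
  have h5 : v j ≤ t := by nlinarith
  have h6 : v i ^ 2 ≤ t ^ 2 := by nlinarith
  rw [hij]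
  exact abs_le_of_sq_le_sq h6 ht.le

lemma IsWeight.qf_inv (hW : G.IsWeight t W) (x : ι → ℝ) :
    qf W (W⁻¹ *ᵥ (M *ᵥ x)) = qf (Mᵀ * W⁻¹ * M) x := by
  rw [← qf_mulVec, qf_mulVec W, hW.inv_symm, nonsing_inv_mul _ hW.isUnit_det, one_mul]

lemma policyCost_isSymm (hW : G.IsWeight t W) : (G.policyCost W⁻¹ K M).IsSymm := by
  simp [IsSymm, policyCost, transpose_mul, G.Q_symm.eq, G.R_symm.eq, hW.inv_symm, Matrix.mul_assoc]

lemma closedLoop_mulVec (x : ι → ℝ) : G.closedLoop W⁻¹ K M *ᵥ x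
    = G.A *ᵥ x + G.B *ᵥ (K *ᵥ x) + G.D *ᵥ (W⁻¹ *ᵥ (M *ᵥ x)) := by
  simp only [closedLoop, add_mulVec, ← mulVec_mulVec]

lemma qFun_policies (hW : G.IsWeight t W) (P : Matrix ι ι ℝ) (x : ι → ℝ) :
    G.qFun W P x (K *ᵥ x) (W⁻¹ *ᵥ (M *ᵥ x))
      = qf (G.policyCost W⁻¹ K M + (G.closedLoop W⁻¹ K M)ᵀ * P * G.closedLoop W⁻¹ K M) x := by
  rw [qf_add, ← qf_mulVec, closedLoop_mulVec, policyCost, qf_sub, qf_add, qf_smul, ← qf_mulVec G.R,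
    ← hW.qf_inv, qFun]

lemma WellPosed.value_isSymm (h : G.WellPosed t W⁻¹ K M) (hW : G.IsWeight t W) :
    (G.value W⁻¹ K M).IsSymm := lyap_isSymm (policyCost_isSymm hW) h.lyap_unit

lemma WellPosed.qFun_eq (h : G.WellPosed t W⁻¹ K M) (hW : G.IsWeight t W) (x : ι → ℝ) :
    G.qFun W (G.value W⁻¹ K M) x (K *ᵥ x) (W⁻¹ *ᵥ (M *ᵥ x)) = qf (G.value W⁻¹ K M) x := by
  rw [qFun_policies hW]
  exact congrArg (fun P => qf P x) (lyap_spec _ h.lyap_unit).symm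

lemma WellPosed.eq_value (h : G.WellPosed t W⁻¹ K M) (hW : G.IsWeight t W) {P : Matrix ι ι ℝ}
    (hs : P.IsSymm) (hP : ∀ x, G.qFun W P x (K *ᵥ x) (W⁻¹ *ᵥ (M *ᵥ x)) = qf P x) :
    P = G.value W⁻¹ K M := by
  refine lyap_unique h.lyap_unit (eq_of_qf_eq hs ?_ fun x => ?_)
  · refine (policyCost_isSymm hW).add ?_
    simp [IsSymm, transpose_mul, hs.eq, Matrix.mul_assoc]
  · rw [← qFun_policies hW, hP]

/-- Multiplied by `t`, the form dominates the one in `concave`, since `t * qf W d ≥ d ⬝ᵥ d`. -/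
lemma WellPosed.advHess_pos (h : G.WellPosed t W⁻¹ K M) (hW : G.IsWeight t W) :
    Pos (G.β ^ 2 • W - G.curv (G.value W⁻¹ K M)) := fun d hd => by
  have h1 := h.concave d hd
  rw [qf_sub, qf_smul, qf_smul, qf_one] at h1
  rw [qf_sub, qf_smul]
  have h2 := hW.ge d
  have h3 : 0 < t * (G.β ^ 2 * qf W d - qf (G.curv (G.value W⁻¹ K M)) d) := by
    have := mul_le_mul_of_nonneg_left h2 (sq_nonneg G.β)
    nlinarith
  exact pos_of_mul_pos_right h3 hW.pos.le

/-- Instance of `qf_expand` with `-β² W` in the role of the control weight. The expansion is exact,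
so gradients and Hessians decide all extremal questions. -/
lemma qFun_add_adv {P : Matrix ι ι ℝ} (hs : P.IsSymm) (hW : W.IsSymm) (x : ι → ℝ) (u : κ → ℝ)
    (v d : σ → ℝ) : G.qFun W P x u (v + d) = G.qFun W P x u v
      + 2 * (d ⬝ᵥ (-(G.β ^ 2 • (W *ᵥ v)) + G.Dᵀ *ᵥ (P *ᵥ (G.A *ᵥ x + G.B *ᵥ u + G.D *ᵥ v))))
      - qf (G.β ^ 2 • W - G.curv P) d := by
  have hs' : (-(G.β ^ 2 • W)).IsSymm := by simp [IsSymm, hW.eq]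
  have h := qf_expand hs hs' G.D (G.A *ᵥ x + G.B *ᵥ u) v d
  simp only [qf_neg, qf_smul, qf_add, neg_mulVec, smul_mulVec] at h
  simp only [qFun, qf_sub, qf_smul, curv]
  linarith

lemma qFun_add_ctrl {P : Matrix ι ι ℝ} (hs : P.IsSymm) (x : ι → ℝ) (u d : κ → ℝ)
    (v : σ → ℝ) : G.qFun W P x (u + d) v = G.qFun W P x u v
      + 2 * (d ⬝ᵥ (G.R *ᵥ u + G.Bᵀ *ᵥ (P *ᵥ (G.A *ᵥ x + G.B *ᵥ u + G.D *ᵥ v))))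
      + qf (G.ctrlHess P) d := by
  have h := qf_expand hs G.R_symm G.B (G.A *ᵥ x + G.D *ᵥ v) u d
  simp only [qFun, ctrlHess]
  rw [show G.A *ᵥ x + G.B *ᵥ (u + d) + G.D *ᵥ v = G.A *ᵥ x + G.D *ᵥ v + G.B *ᵥ (u + d) by abel,
    show G.A *ᵥ x + G.B *ᵥ u + G.D *ᵥ v = G.A *ᵥ x + G.D *ᵥ v + G.B *ᵥ u by abel]
  linarith

variable (G) in
/-- The component `c` of `b` combined with the other components of `b₀`. -/
def mix (c : Fin 3) (b₀ b : σ → ℝ) : σ → ℝ := fun s => if G.lab s = c then b s else b₀ s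

lemma IsWeight.mulVec_mix (hW : G.IsWeight t W) (b₀ b : σ → ℝ) (s : σ) :
    (W *ᵥ G.mix (G.lab s) b₀ b) s = (W *ᵥ b) s := by
  refine Finset.sum_congr rfl fun r _ => ?_
  by_cases hr : G.lab r = G.lab s
  · simp [mix, hr]
  · simp [hW.block s r fun h => hr h.symm]

lemma mulVec_mix (Γ : Matrix σ σ ℝ) (b₀ b : σ → ℝ) (s : σ) :
    (Γ *ᵥ G.mix (G.lab s) b₀ b) s
      = (G.blockPart Γ *ᵥ b) s + ((Γ - G.blockPart Γ) *ᵥ b₀) s := by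
  simp only [mulVec, dotProduct, ← Finset.sum_add_distrib]
  refine Finset.sum_congr rfl fun r _ => ?_
  by_cases hr : G.lab r = G.lab s
  · simp [mix, blockPart, hr]
  · have hr' : ¬G.lab s = G.lab r := fun h => hr h.symm
    simp [mix, blockPart, hr, hr']

/-- Entry `s` of the first-order condition is taken at the point where only the component containing
`s` is updated. Stacking these entries gives one linear system for `W b`, a block Jacobi step:
diagonal blocks act on the new input, off-diagonal ones on the old. -/
lemma WellPosed.advStep_iff (h : G.WellPosed t W⁻¹ K M) (hW : G.IsWeight t W) (x : ι → ℝ)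
    (b : σ → ℝ) :
    b = W⁻¹ *ᵥ (G.advStep W⁻¹ K M *ᵥ x) ↔
      ∀ s, (-(G.β ^ 2 • (W *ᵥ G.mix (G.lab s) (W⁻¹ *ᵥ (M *ᵥ x)) b)) + G.Dᵀ *ᵥ
        (G.value W⁻¹ K M *ᵥ (G.A *ᵥ x + G.B *ᵥ (K *ᵥ x)
          + G.D *ᵥ G.mix (G.lab s) (W⁻¹ *ᵥ (M *ᵥ x)) b))) s = 0 := by
  set P := G.value W⁻¹ K M with hP
  set rhs : Matrix σ ι ℝ := G.Dᵀ * P * (G.A + G.B * K)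
    + (G.curv P - G.blockPart (G.curv P)) * W⁻¹ * M with hrhs
  have h1 : G.advStep W⁻¹ K M = (G.advSystem W⁻¹ P)⁻¹ * rhs := rfl
  have h2 : b = W⁻¹ *ᵥ (G.advStep W⁻¹ K M *ᵥ x) ↔
      G.advSystem W⁻¹ P *ᵥ (W *ᵥ b) = rhs *ᵥ x := by
    rw [h1, ← mulVec_mulVec]
    constructor
    · intro hb
      rw [hb, hW.mulVec_inv, mulVec_mulVec, mul_nonsing_inv _ h.adv_unit, one_mulVec]
    · intro hb
      rw [← hb, mulVec_mulVec _ (G.advSystem W⁻¹ P)⁻¹, nonsing_inv_mul _ h.adv_unit, one_mulVec,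
        hW.inv_mulVec]
  rw [h2, funext_iff]
  refine forall_congr' fun s => ?_
  have h3 : (G.Dᵀ *ᵥ (P *ᵥ (G.A *ᵥ x + G.B *ᵥ (K *ᵥ x)
      + G.D *ᵥ G.mix (G.lab s) (W⁻¹ *ᵥ (M *ᵥ x)) b))) s
      = ((G.Dᵀ * P * (G.A + G.B * K)) *ᵥ x) s
        + (G.curv P *ᵥ G.mix (G.lab s) (W⁻¹ *ᵥ (M *ᵥ x)) b) s := by
    rw [← Pi.add_apply]
    simp only [curv, mulVec_add, ← mulVec_mulVec, add_mulVec]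
  rw [Pi.add_apply, h3, mulVec_mix, Pi.neg_apply, Pi.smul_apply, hW.mulVec_mix, hrhs, advSystem,
    sub_mulVec, ← mulVec_mulVec, hW.inv_mulVec, smul_mulVec, one_mulVec, add_mulVec, Pi.sub_apply,
    Pi.add_apply, Pi.smul_apply, ← mulVec_mulVec x (_ * W⁻¹), ← mulVec_mulVec _ _ W⁻¹]
  constructor <;> intro h4 <;> linarith

/-- The componentwise maximizers of the Q-function are given by `advStep`. -/
lemma WellPosed.isBlockMax_iff (h : G.WellPosed t W⁻¹ K M) (hW : G.IsWeight t W) (x : ι → ℝ)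
    (b : σ → ℝ) :
    (∀ c d, (∀ s, G.lab s ≠ c → d s = 0) →
      G.qFun W (G.value W⁻¹ K M) x (K *ᵥ x) (G.mix c (W⁻¹ *ᵥ (M *ᵥ x)) b + d)
        ≤ G.qFun W (G.value W⁻¹ K M) x (K *ᵥ x) (G.mix c (W⁻¹ *ᵥ (M *ᵥ x)) b)) ↔
      b = W⁻¹ *ᵥ (G.advStep W⁻¹ K M *ᵥ x) := by
  rw [h.advStep_iff hW]
  simp only [qFun_add_adv (h.value_isSymm hW) hW.symm]
  constructor
  · intro hmax s
    -- Perturbing along multiples of a unit vector shows that the corresponding entry of the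
    -- gradient vanishes.
    have h1 := eq_zero_of_quadratic_nonneg (a := -2 * (Pi.single s 1 ⬝ᵥ
      (-(G.β ^ 2 • (W *ᵥ G.mix (G.lab s) (W⁻¹ *ᵥ (M *ᵥ x)) b)) + G.Dᵀ *ᵥ
        (G.value W⁻¹ K M *ᵥ (G.A *ᵥ x + G.B *ᵥ (K *ᵥ x)
          + G.D *ᵥ G.mix (G.lab s) (W⁻¹ *ᵥ (M *ᵥ x)) b)))))
      (b := qf (G.β ^ 2 • W - G.curv (G.value W⁻¹ K M)) (Pi.single s 1)) fun r => by
        have h2 := hmax (G.lab s) (r • Pi.single s 1) fun s' hs' => by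
          have : s' ≠ s := fun h => hs' (by rw [h])
          simp [this]
        rw [qf_smul_vec, smul_dotProduct, smul_eq_mul] at h2
        linarith
    rw [single_one_dotProduct] at h1
    linarith
  · intro hg c d hd
    have h1 : d ⬝ᵥ (-(G.β ^ 2 • (W *ᵥ G.mix c (W⁻¹ *ᵥ (M *ᵥ x)) b)) + G.Dᵀ *ᵥ
        (G.value W⁻¹ K M *ᵥ (G.A *ᵥ x + G.B *ᵥ (K *ᵥ x)
          + G.D *ᵥ G.mix c (W⁻¹ *ᵥ (M *ᵥ x)) b))) = 0 := by
      refine Finset.sum_eq_zero fun s _ => ?_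
      by_cases hs : G.lab s = c
      · rw [← hs, hg s, mul_zero]
      · rw [hd s hs, zero_mul]
    rw [h1]
    linarith [(h.advHess_pos hW).nonneg d]

/-- The minimizer of the Q-function in the control is given by `ctrlStep`. -/
lemma WellPosed.isMin_iff (h : G.WellPosed t W⁻¹ K M) (hW : G.IsWeight t W) (x : ι → ℝ)
    (u : κ → ℝ) :
    (∀ a, G.qFun W (G.value W⁻¹ K M) x u (W⁻¹ *ᵥ (M *ᵥ x))
      ≤ G.qFun W (G.value W⁻¹ K M) x a (W⁻¹ *ᵥ (M *ᵥ x))) ↔ u = G.ctrlStep W⁻¹ K M *ᵥ x := by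
  set P := G.value W⁻¹ K M with hP
  have h1 := congrArg (fun T => T *ᵥ x)
    (G.ctrlGain_stationary (G.A + G.D * W⁻¹ * M) h.convex.isUnit_det)
  rw [← hP, ← ctrlStep.eq_1] at h1
  simp only [add_mulVec, mulVec_add, ← mulVec_mulVec, zero_mulVec] at h1
  have h2 : ∀ d, G.qFun W P x (G.ctrlStep W⁻¹ K M *ᵥ x + d) (W⁻¹ *ᵥ (M *ᵥ x))
      = G.qFun W P x (G.ctrlStep W⁻¹ K M *ᵥ x) (W⁻¹ *ᵥ (M *ᵥ x)) + qf (G.ctrlHess P) d := by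
    intro d
    rw [qFun_add_ctrl (h.value_isSymm hW)]
    have h3 : G.R *ᵥ (G.ctrlStep W⁻¹ K M *ᵥ x) + G.Bᵀ *ᵥ (P *ᵥ (G.A *ᵥ x
        + G.B *ᵥ (G.ctrlStep W⁻¹ K M *ᵥ x) + G.D *ᵥ (W⁻¹ *ᵥ (M *ᵥ x)))) = 0 := by
      rw [← h1]
      simp only [mulVec_add]
      abel
    rw [h3, dotProduct_zero, mul_zero, add_zero]
  constructor
  · intro hu
    by_contra hne
    have h3 := h2 (u - G.ctrlStep W⁻¹ K M *ᵥ x)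
    rw [add_sub_cancel] at h3
    have h4 := hu (G.ctrlStep W⁻¹ K M *ᵥ x)
    have h5 := h.convex _ (sub_ne_zero.2 hne)
    linarith
  · rintro rfl a
    have h3 := h2 (a - G.ctrlStep W⁻¹ K M *ᵥ x)
    rw [add_sub_cancel] at h3
    rw [h3]
    linarith [h.convex.nonneg (a - G.ctrlStep W⁻¹ K M *ᵥ x)]

/-- At a fixed point of the inner iteration, the Q-function is stationary in the whole adversarial
input. -/
lemma WellPosed.adv_stationary (h : G.WellPosed t W⁻¹ K M) (hM : G.advStep W⁻¹ K M = M) :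
    G.β ^ 2 • M = G.Dᵀ * G.value W⁻¹ K M * G.closedLoop W⁻¹ K M := by
  have h1 : G.advSystem W⁻¹ (G.value W⁻¹ K M) * M
      = G.Dᵀ * G.value W⁻¹ K M * (G.A + G.B * K)
        + (G.curv (G.value W⁻¹ K M) - G.blockPart (G.curv (G.value W⁻¹ K M))) * W⁻¹ * M := by
    calc _ = G.advSystem W⁻¹ (G.value W⁻¹ K M) * G.advStep W⁻¹ K M := by rw [hM]
      _ = _ := mul_nonsing_inv_cancel_left _ _ h.adv_unit
  rw [advSystem, Matrix.sub_mul, Matrix.smul_mul, Matrix.one_mul, sub_eq_iff_eq_add] at h1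
  rw [h1]
  simp only [closedLoop, curv, Matrix.mul_add, Matrix.sub_mul, Matrix.mul_assoc]
  abel

lemma WellPosed.ctrl_stationary (h : G.WellPosed t W⁻¹ K M) (hK : G.ctrlStep W⁻¹ K M = K) :
    G.R * K + G.Bᵀ * G.value W⁻¹ K M * G.closedLoop W⁻¹ K M = 0 := by
  have h1 := G.ctrlGain_stationary (G.A + G.D * W⁻¹ * M) h.convex.isUnit_det
  rw [← ctrlStep, hK] at h1
  rw [closedLoop, add_right_comm]
  exact h1

/-- One half of the saddle inequality: at the inner fixed point the whole gradient in `v` vanishes,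
and the Q-function is concave in `v`. -/
lemma WellPosed.qFun_le (h : G.WellPosed t W⁻¹ K M) (hW : G.IsWeight t W)
    (hM : G.advStep W⁻¹ K M = M) (x : ι → ℝ) (v : σ → ℝ) :
    G.qFun W (G.value W⁻¹ K M) x (K *ᵥ x) v ≤ qf (G.value W⁻¹ K M) x := by
  have h1 := qFun_add_adv (G := G) (h.value_isSymm hW) hW.symm x (K *ᵥ x) (W⁻¹ *ᵥ (M *ᵥ x))
    (v - W⁻¹ *ᵥ (M *ᵥ x))
  have h2 := congrArg (fun T => T *ᵥ x) (h.adv_stationary hM)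
  simp only [smul_mulVec, ← mulVec_mulVec, closedLoop_mulVec] at h2
  rw [add_sub_cancel, hW.mulVec_inv, h2, neg_add_cancel, dotProduct_zero, h.qFun_eq hW] at h1
  rw [h1]
  linarith [(h.advHess_pos hW).nonneg (v - W⁻¹ *ᵥ (M *ᵥ x))]

lemma WellPosed.le_qFun (h : G.WellPosed t W⁻¹ K M) (hW : G.IsWeight t W)
    (hK : G.ctrlStep W⁻¹ K M = K) (x : ι → ℝ) (u : κ → ℝ) :
    qf (G.value W⁻¹ K M) x ≤ G.qFun W (G.value W⁻¹ K M) x u (W⁻¹ *ᵥ (M *ᵥ x)) := by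
  rw [← h.qFun_eq hW]
  exact (h.isMin_iff hW x (K *ᵥ x)).2 (by rw [hK]) u

/-- The critical point of a strictly concave quadratic; the control need not be the optimal one. -/
lemma WellPosed.exists_max (h : G.WellPosed t W⁻¹ K M) (hW : G.IsWeight t W) (x : ι → ℝ)
    (u : κ → ℝ) : ∃ v, ∀ b, G.qFun W (G.value W⁻¹ K M) x u b ≤ G.qFun W (G.value W⁻¹ K M) x u v := by
  set P := G.value W⁻¹ K M
  have hH := h.advHess_pos hW
  set v := (G.β ^ 2 • W - G.curv P)⁻¹ *ᵥ (G.Dᵀ *ᵥ (P *ᵥ (G.A *ᵥ x + G.B *ᵥ u))) with hv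
  have h1 : (G.β ^ 2 • W - G.curv P) *ᵥ v = G.Dᵀ *ᵥ (P *ᵥ (G.A *ᵥ x + G.B *ᵥ u)) := by
    rw [hv, mulVec_mulVec, mul_nonsing_inv _ hH.isUnit_det, one_mulVec]
  have h2 : -(G.β ^ 2 • (W *ᵥ v)) + G.Dᵀ *ᵥ (P *ᵥ (G.A *ᵥ x + G.B *ᵥ u + G.D *ᵥ v)) = 0 := by
    rw [mulVec_add, mulVec_add, ← h1, sub_mulVec, smul_mulVec, curv, ← mulVec_mulVec,
      ← mulVec_mulVec]
    abel
  refine ⟨v, fun b => ?_⟩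
  have h3 := qFun_add_adv (G := G) (h.value_isSymm hW) hW.symm x u v (b - v)
  rw [h2, add_sub_cancel, dotProduct_zero] at h3
  rw [h3]
  linarith [hH.nonneg (b - v)]

/-! ### Optimality gaps for the stopping criteria. -/

section Gaps

attribute [local instance] Matrix.normedAddCommGroup Matrix.normedSpace

lemma tendsto_of_contDiffAt {α : Type*} {l : Filter α}
    {f : Matrix κ ι ℝ × Matrix σ ι ℝ → Matrix ι ι ℝ} (hf : ContDiffAt ℝ 1 f (K, M))
    {Kf : α → Matrix κ ι ℝ} {Mf : α → Matrix σ ι ℝ}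
    (hK : Tendsto Kf l (𝓝 K)) (hM : Tendsto Mf l (𝓝 M)) :
    Tendsto (fun y => f (Kf y, Mf y)) l (𝓝 (f (K, M))) :=
  hf.continuousAt.tendsto.comp (hK.prodMk_nhds hM)

lemma WellPosed.tendsto_value {α : Type*} {l : Filter α} {E : Matrix σ σ ℝ}
    (h : G.WellPosed t E K M) {Kf : α → Matrix κ ι ℝ} {Mf : α → Matrix σ ι ℝ}
    (hK : Tendsto Kf l (𝓝 K)) (hM : Tendsto Mf l (𝓝 M)) :
    Tendsto (fun y => G.value E (Kf y) (Mf y)) l (𝓝 (G.value E K M)) :=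
  tendsto_of_contDiffAt (f := fun y => G.value E y.1 y.2) h.contDiffAt_value hK hM

end Gaps

/-- The gap is a linear term minus a quadratic one. The gradient matrix tends to zero by
stationarity at the limit, while the Hessian tends to a positive form. -/
lemma WellPosed.eventually_adv_gap {α : Type*} {l : Filter α} {Mf : α → Matrix σ ι ℝ}
    (h : G.WellPosed t W⁻¹ K M) (hW : G.IsWeight t W) (hM : G.advStep W⁻¹ K M = M)
    (hMf : Tendsto Mf l (𝓝 M)) (hf : ∀ y, G.WellPosed t W⁻¹ K (Mf y)) {ε : ℝ} (hε : 0 < ε) :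
    ∀ᶠ y in l, ∀ x b, G.qFun W (G.value W⁻¹ K (Mf y)) x (K *ᵥ x) b
      ≤ G.qFun W (G.value W⁻¹ K (Mf y)) x (K *ᵥ x) (W⁻¹ *ᵥ (Mf y *ᵥ x)) + ε * (x ⬝ᵥ x) := by
  have hP := h.tendsto_value (tendsto_const_nhds (x := K)) hMf
  have hc : Continuous fun y : Matrix ι ι ℝ × Matrix σ ι ℝ =>
      (G.β ^ 2 • W - G.curv y.1, -(G.β ^ 2 • y.2) + G.Dᵀ * y.1 * G.closedLoop W⁻¹ K y.2) := by
    unfold curv closedLoop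
    fun_prop
  have h1 := (hc.tendsto (G.value W⁻¹ K M, M)).comp (hP.prodMk_nhds hMf)
  simp only [← h.adv_stationary hM, neg_add_cancel] at h1
  filter_upwards [h1.eventually ((h.advHess_pos hW).eventually_gap_le hε)] with y hy x b
  have h2 := hy x (b - W⁻¹ *ᵥ (Mf y *ᵥ x))
  have h3 := qFun_add_adv (G := G) ((hf y).value_isSymm hW) hW.symm x (K *ᵥ x)
    (W⁻¹ *ᵥ (Mf y *ᵥ x)) (b - W⁻¹ *ᵥ (Mf y *ᵥ x))
  simp only [Function.comp_apply, add_mulVec, neg_mulVec, smul_mulVec, ← mulVec_mulVec,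
    closedLoop_mulVec] at h2
  rw [add_sub_cancel, hW.mulVec_inv] at h3
  rw [h3]
  linarith

/-- The control gradient vanishes only at the limit of the outer iteration, so even the inner limits
have a small gap only for large `k`. -/
lemma WellPosed.eventually_ctrl_gap {Ks : ℕ → Matrix κ ι ℝ} {Ms : ℕ → ℕ → Matrix σ ι ℝ}
    {Ls : ℕ → Matrix σ ι ℝ} (h : G.WellPosed t W⁻¹ K M) (hW : G.IsWeight t W)
    (hK : G.ctrlStep W⁻¹ K M = K) (hKs : Tendsto Ks atTop (𝓝 K)) (hLs : Tendsto Ls atTop (𝓝 M))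
    (hMs : ∀ k, Tendsto (Ms k) atTop (𝓝 (Ls k))) (hl : ∀ k, G.WellPosed t W⁻¹ (Ks k) (Ls k))
    (hm : ∀ k z, G.WellPosed t W⁻¹ (Ks k) (Ms k z)) {ε : ℝ} (hε : 0 < ε) :
    ∀ᶠ k in atTop, ∀ᶠ z in atTop, ∀ x a,
      G.qFun W (G.value W⁻¹ (Ks k) (Ms k z)) x (Ks k *ᵥ x) (W⁻¹ *ᵥ (Ms k z *ᵥ x))
        ≤ G.qFun W (G.value W⁻¹ (Ks k) (Ms k z)) x a (W⁻¹ *ᵥ (Ms k z *ᵥ x)) + ε * (x ⬝ᵥ x) := by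
  have hc : Continuous fun y : Matrix ι ι ℝ × Matrix κ ι ℝ × Matrix σ ι ℝ =>
      (G.ctrlHess y.1, -(G.R * y.2.1 + G.Bᵀ * y.1 * G.closedLoop W⁻¹ y.2.1 y.2.2)) := by
    unfold ctrlHess closedLoop
    fun_prop
  have h1 := (hc.tendsto (G.value W⁻¹ K M, K, M)).comp
    ((h.tendsto_value hKs hLs).prodMk_nhds (hKs.prodMk_nhds hLs))
  simp only [h.ctrl_stationary hK, neg_zero] at h1
  -- The gap bound holds on a neighbourhood of the data at `(Ks k, Ls k)`, hence also at the inner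
  -- iterates `Ms k z` for large `z`.
  filter_upwards [h1.eventually (eventually_eventually_nhds.2 (h.convex.eventually_gap_le hε))]
    with k hk
  have h2 := (hc.tendsto (G.value W⁻¹ (Ks k) (Ls k), Ks k, Ls k)).comp
    (((hl k).tendsto_value (tendsto_const_nhds (x := Ks k)) (hMs k)).prodMk_nhds
      ((tendsto_const_nhds (x := Ks k)).prodMk_nhds (hMs k)))
  filter_upwards [h2.eventually hk] with z hz x a
  have h3 := hz x (a - Ks k *ᵥ x)
  have h4 := qFun_add_ctrl (G := G) (W := W) ((hm k z).value_isSymm hW) x (Ks k *ᵥ x)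
    (a - Ks k *ᵥ x) (W⁻¹ *ᵥ (Ms k z *ᵥ x))
  simp only [Function.comp_apply, add_mulVec, neg_mulVec, ← mulVec_mulVec,
    closedLoop_mulVec, dotProduct_neg] at h3
  rw [add_sub_cancel] at h4
  rw [h4]
  linarith

end ZeroSumGame

/-! ### From a saddle point of the Bellman equation to a minmax strategy. -/

section Minmax

variable {N n p q : ℕ} {S : MultiAgentSystem N n p q} {C : CostWeights N n p q} {i : Fin N}

lemma coe_sum_range_sub_le {f : ℕ → ℝ} (hf : ∀ k, 0 ≤ f k) (a : ℝ) (T : ℕ) :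
    ((∑ k ∈ Finset.range T, f k - a : ℝ) : EReal)
      ≤ ((∑' k, ENNReal.ofReal (f k) : ℝ≥0∞) : EReal) - (a : EReal) := by
  rw [EReal.coe_sub]
  refine EReal.sub_le_sub ?_ le_rfl
  have h1 : ENNReal.ofReal (∑ k ∈ Finset.range T, f k) ≤ ∑' k, ENNReal.ofReal (f k) := by
    rw [ENNReal.ofReal_sum_of_nonneg fun k _ => hf k]
    exact ENNReal.sum_le_tsum _
  have h2 : ((∑ k ∈ Finset.range T, f k : ℝ) : EReal)
      = ((ENNReal.ofReal (∑ k ∈ Finset.range T, f k) : ℝ≥0∞) : EReal) := by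
    rw [EReal.coe_ennreal_ofReal, max_eq_left (Finset.sum_nonneg fun k _ => hf k)]
  rw [h2]
  exact_mod_cast h1

lemma coe_tsum_ofReal_sub {f : ℕ → ℝ} (hf : ∀ k, 0 ≤ f k) (hs : Summable f) (a : ℝ) :
    ((∑' k, ENNReal.ofReal (f k) : ℝ≥0∞) : EReal) - (a : EReal) = ((∑' k, f k - a : ℝ) : EReal) := by
  rw [← ENNReal.ofReal_tsum_of_nonneg hf hs, EReal.coe_ennreal_ofReal,
    max_eq_left (tsum_nonneg hf), EReal.coe_sub]

/-- The energy of an adversarial input. -/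
def advEnergy (S : MultiAgentSystem N n p q) (i : Fin N) (v : S.Adv i) : ℝ :=
  ∑ j : S.Nbr i, v.1 j ⬝ᵥ v.1 j + v.2.1 ⬝ᵥ v.2.1 + ∑ j : S.Nbr i, v.2.2 j ⬝ᵥ v.2.2 j

lemma advEnergy_nonneg (v : S.Adv i) : 0 ≤ advEnergy S i v :=
  add_nonneg (add_nonneg (Finset.sum_nonneg fun _ _ => dotProduct_self_nonneg _)
    (dotProduct_self_nonneg _)) (Finset.sum_nonneg fun _ _ => dotProduct_self_nonneg _)

lemma advEnergy_zero : advEnergy S i 0 = 0 := by simp [advEnergy]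

/-- The trajectory when the adversary follows the state feedback `vS`. -/
def feedbackTraj (S : MultiAgentSystem N n p q) (i : Fin N) (μ : ℕ → (Fin n → ℝ) → Fin p → ℝ)
    (vS : (Fin n → ℝ) → S.Adv i) (x₀ : Fin n → ℝ) : ℕ → Fin n → ℝ
  | 0 => x₀
  | k + 1 => S.next i (feedbackTraj S i μ vS x₀ k) (μ k (feedbackTraj S i μ vS x₀ k))
      (vS (feedbackTraj S i μ vS x₀ k))

lemma traj_eq_feedbackTraj {μ : ℕ → (Fin n → ℝ) → Fin p → ℝ} {vS : (Fin n → ℝ) → S.Adv i}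
    {x₀ : Fin n → ℝ} {v : ℕ → S.Adv i} {T : ℕ}
    (hv : ∀ k < T, v k = vS (feedbackTraj S i μ vS x₀ k)) :
    ∀ k ≤ T, S.traj i μ v x₀ k = feedbackTraj S i μ vS x₀ k := by
  intro k
  induction k with
  | zero => exact fun _ => rfl
  | succ k ih =>
    intro hk
    have h1 := ih (by omega)
    simp only [MultiAgentSystem.traj, feedbackTraj, h1, hv k (by omega)]

variable {V : (Fin n → ℝ) → ℝ} {k₀ : (Fin n → ℝ) → Fin p → ℝ} {vS : (Fin n → ℝ) → S.Adv i}
  {c a e : ℝ}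

lemma sum_stageCost_le
    (hup : ∀ x v, stageCost S C i x (k₀ x) v + V (S.next i x (k₀ x) v) ≤ V x)
    (v : ℕ → S.Adv i) (x₀ : Fin n → ℝ) (T : ℕ) :
    ∑ k ∈ Finset.range T, stageCost S C i (S.traj i (fun _ => k₀) v x₀ k)
      (k₀ (S.traj i (fun _ => k₀) v x₀ k)) (v k) + V (S.traj i (fun _ => k₀) v x₀ T) ≤ V x₀ := by
  induction T with
  | zero => simp [MultiAgentSystem.traj]
  | succ T ih =>
    rw [Finset.sum_range_succ]
    have := hup (S.traj i (fun _ => k₀) v x₀ T) (v T)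
    simp only [MultiAgentSystem.traj]
    linarith

lemma le_sum_stageCost
    (hlo : ∀ x u, V x ≤ stageCost S C i x u (vS x) + V (S.next i x u (vS x)))
    (μ : ℕ → (Fin n → ℝ) → Fin p → ℝ) (x₀ : Fin n → ℝ) (T : ℕ) :
    V x₀ ≤ ∑ k ∈ Finset.range T, stageCost S C i (feedbackTraj S i μ vS x₀ k)
      (μ k (feedbackTraj S i μ vS x₀ k)) (vS (feedbackTraj S i μ vS x₀ k))
      + V (feedbackTraj S i μ vS x₀ T) := by
  induction T with
  | zero => simp [feedbackTraj]
  | succ T ih =>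
    rw [Finset.sum_range_succ]
    have := hlo (feedbackTraj S i μ vS x₀ T) (μ T (feedbackTraj S i μ vS x₀ T))
    simp only [feedbackTraj]
    linarith

lemma summable_advCost (ha : ∀ v, 0 ≤ C.β ^ 2 * advCost S C i v ∧
      C.β ^ 2 * advCost S C i v ≤ a * advEnergy S i v) {v : ℕ → S.Adv i}
    (hv : S.FiniteEnergy i v) : Summable fun k => C.β ^ 2 * advCost S C i (v k) :=
  Summable.of_nonneg_of_le (fun _ => (ha _).1) (fun _ => (ha _).2) (Summable.mul_left a hv)

/-- The telescoped Bellman inequality bounds the partial sums of the own cost, so the first series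
is finite and the bound passes to the limit. -/
lemma totalCost_le (hV : ∀ x, 0 ≤ V x) (hown : ∀ x u, 0 ≤ ownCost C i x u)
    (ha : ∀ v, 0 ≤ C.β ^ 2 * advCost S C i v ∧
      C.β ^ 2 * advCost S C i v ≤ a * advEnergy S i v)
    (hup : ∀ x v, stageCost S C i x (k₀ x) v + V (S.next i x (k₀ x) v) ≤ V x)
    (x₀ : Fin n → ℝ) {v : ℕ → S.Adv i} (hv : S.FiniteEnergy i v) :
    totalCost S C i x₀ (fun _ => k₀) v ≤ (V x₀ : EReal) := by
  have hs := summable_advCost ha hv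
  have h1 : ∀ T, ∑ k ∈ Finset.range T, ownCost C i (S.traj i (fun _ => k₀) v x₀ k)
      (k₀ (S.traj i (fun _ => k₀) v x₀ k)) ≤ V x₀ + ∑' k, C.β ^ 2 * advCost S C i (v k) := by
    intro T
    have h2 := sum_stageCost_le hup v x₀ T
    simp only [stageCost, Finset.sum_sub_distrib] at h2
    have h3 := hs.sum_le_tsum (Finset.range T) fun k _ => (ha (v k)).1
    linarith [hV (S.traj i (fun _ => k₀) v x₀ T)]
  have hsum := summable_of_sum_range_le (fun k => hown _ _) h1
  rw [totalCost, coe_tsum_ofReal_sub (fun k => hown _ _) hsum]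
  have h4 := hsum.tsum_le_of_sum_range_le h1
  exact_mod_cast (by linarith : _ ≤ V x₀)

lemma finiteEnergy_feedbackTraj (hc : 0 < c) (hcoer : ∀ x u, c * (x ⬝ᵥ x) ≤ ownCost C i x u)
    (he : ∀ x, advEnergy S i (vS x) ≤ e * (x ⬝ᵥ x)) {μ : ℕ → (Fin n → ℝ) → Fin p → ℝ}
    {x₀ : Fin n → ℝ} (hs : Summable fun k => ownCost C i (feedbackTraj S i μ vS x₀ k)
      (μ k (feedbackTraj S i μ vS x₀ k))) :
    S.FiniteEnergy i (fun k => vS (feedbackTraj S i μ vS x₀ k)) ∧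
      Tendsto (feedbackTraj S i μ vS x₀) atTop (𝓝 0) := by
  have h1 : Summable fun k => feedbackTraj S i μ vS x₀ k ⬝ᵥ feedbackTraj S i μ vS x₀ k := by
    refine Summable.of_nonneg_of_le (fun k => dotProduct_self_nonneg _) (fun k => ?_)
      (hs.mul_left c⁻¹)
    rw [inv_mul_eq_div, le_div_iff₀ hc, mul_comm]
    exact hcoer _ _
  exact ⟨Summable.of_nonneg_of_le (fun k => advEnergy_nonneg _) (fun k => he _) (h1.mul_left e),
    tendsto_zero_of_dotProduct h1.tendsto_atTop_zero⟩

/-- Finite own cost forces the state to zero by coercivity, so the terminal value in the telescoped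
inequality disappears. -/
lemma le_totalCost_feedback (hVc : Tendsto V (𝓝 0) (𝓝 0)) (hc : 0 < c)
    (hcoer : ∀ x u, c * (x ⬝ᵥ x) ≤ ownCost C i x u)
    (he : ∀ x, advEnergy S i (vS x) ≤ e * (x ⬝ᵥ x))
    (ha : ∀ v, 0 ≤ C.β ^ 2 * advCost S C i v ∧
      C.β ^ 2 * advCost S C i v ≤ a * advEnergy S i v)
    (hlo : ∀ x u, V x ≤ stageCost S C i x u (vS x) + V (S.next i x u (vS x)))
    {μ : ℕ → (Fin n → ℝ) → Fin p → ℝ} {x₀ : Fin n → ℝ}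
    (hs : Summable fun k => ownCost C i (feedbackTraj S i μ vS x₀ k)
      (μ k (feedbackTraj S i μ vS x₀ k))) :
    (V x₀ : EReal) ≤ totalCost S C i x₀ μ (fun k => vS (feedbackTraj S i μ vS x₀ k)) := by
  obtain ⟨hfin, hlim⟩ := finiteEnergy_feedbackTraj hc hcoer he hs
  have hown : ∀ x u, 0 ≤ ownCost C i x u := fun x u =>
    (mul_nonneg hc.le (dotProduct_self_nonneg x)).trans (hcoer x u)
  have hadv := summable_advCost ha hfin
  have htr : ∀ k, S.traj i μ (fun k => vS (feedbackTraj S i μ vS x₀ k)) x₀ k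
      = feedbackTraj S i μ vS x₀ k := fun k =>
    traj_eq_feedbackTraj (T := k) (fun _ _ => rfl) _ le_rfl
  simp only [totalCost, htr]
  rw [coe_tsum_ofReal_sub (fun k => hown _ _) hs, EReal.coe_le_coe_iff]
  have h1 := (hs.hasSum.tendsto_sum_nat.sub hadv.hasSum.tendsto_sum_nat).add (hVc.comp hlim)
  rw [add_zero] at h1
  refine ge_of_tendsto' h1 fun T => ?_
  have h2 := le_sum_stageCost hlo μ x₀ T
  simpa only [stageCost, Finset.sum_sub_distrib, Function.comp_apply] using h2

/-- The competing feedback is arbitrary, so its own cost against `vS` may diverge. In that case the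
partial sums of the stage cost, which dominate `c` times those of the own cost, exceed `V x₀` after
finitely many steps. -/
lemma le_worstCost (hVc : Tendsto V (𝓝 0) (𝓝 0)) (hc : 0 < c)
    (hcoer : ∀ x u, c * (x ⬝ᵥ x) ≤ ownCost C i x u)
    (hstage : ∀ x u, c * ownCost C i x u ≤ stageCost S C i x u (vS x))
    (he : ∀ x, advEnergy S i (vS x) ≤ e * (x ⬝ᵥ x))
    (ha : ∀ v, 0 ≤ C.β ^ 2 * advCost S C i v ∧
      C.β ^ 2 * advCost S C i v ≤ a * advEnergy S i v)
    (hlo : ∀ x u, V x ≤ stageCost S C i x u (vS x) + V (S.next i x u (vS x)))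
    (μ : ℕ → (Fin n → ℝ) → Fin p → ℝ) (x₀ : Fin n → ℝ) :
    (V x₀ : EReal) ≤ worstCost S C i x₀ μ := by
  have hown : ∀ x u, 0 ≤ ownCost C i x u := fun x u =>
    (mul_nonneg hc.le (dotProduct_self_nonneg x)).trans (hcoer x u)
  set y := feedbackTraj S i μ vS x₀ with hy
  by_cases hs : Summable fun k => ownCost C i (y k) (μ k (y k))
  · exact (le_totalCost_feedback hVc hc hcoer he ha hlo hs).trans
      (le_iSup_of_le ⟨_, (finiteEnergy_feedbackTraj hc hcoer he hs).1⟩ le_rfl)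
  · -- the adversary follows `vS` for a long time and then stops
    obtain ⟨T, hT⟩ : ∃ T, V x₀ ≤ c * ∑ k ∈ Finset.range T, ownCost C i (y k) (μ k (y k)) := by
      by_contra! hcon
      exact hs (summable_of_sum_range_le (fun k => hown _ _) (c := c⁻¹ * V x₀) fun T => by
        rw [inv_mul_eq_div, le_div_iff₀ hc, mul_comm]
        exact (hcon T).le)
    set v : ℕ → S.Adv i := fun k => if k < T then vS (y k) else 0 with hv
    have hzero : ∀ k, k ∉ Finset.range T → v k = 0 := fun k hk => by
      simp only [Finset.mem_range] at hk
      simp [hv, hk]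
    have hfin : S.FiniteEnergy i v := by
      refine summable_of_ne_finset_zero (s := Finset.range T) fun k hk => ?_
      have := advEnergy_zero (S := S) (i := i)
      rw [← hzero k hk] at this
      exact this
    have htr : ∀ k ≤ T, S.traj i μ v x₀ k = y k :=
      traj_eq_feedbackTraj fun k hk => by simp [hv, hk, hy]
    refine le_trans ?_ (le_iSup_of_le ⟨v, hfin⟩ le_rfl)
    -- Once the adversary has stopped, the remaining own costs are nonnegative and may be dropped.
    refine le_trans ?_ (coe_sum_range_sub_le (fun k => hown _ _) _ T)
    rw [EReal.coe_le_coe_iff, tsum_eq_sum (s := Finset.range T) fun k hk => by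
      have h0 := ha (v k)
      rw [hzero k hk, advEnergy_zero, mul_zero] at h0
      change C.β ^ 2 * advCost S C i (v k) = 0
      rw [hzero k hk]
      exact le_antisymm h0.2 h0.1, ← Finset.sum_sub_distrib]
    refine hT.trans ?_
    rw [Finset.mul_sum]
    refine Finset.sum_le_sum fun k hk => ?_
    rw [Finset.mem_range] at hk
    have hvk : v k = vS (y k) := by simp [hv, hk]
    have := hstage (y k) (μ k (y k))
    rw [← hvk] at this
    change _ ≤ ownCost C i (S.traj i μ v x₀ k) (μ k (S.traj i μ v x₀ k))
      - C.β ^ 2 * advCost S C i (v k)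
    rwa [htr k hk.le]

/-- A stationary saddle point of the Bellman equation whose worst adversarial policy keeps the stage
cost coercive yields a minmax strategy. -/
theorem isMinmaxStrategy_of_saddle (hV : ∀ x, 0 ≤ V x) (hVc : Tendsto V (𝓝 0) (𝓝 0)) (hc : 0 < c)
    (hcoer : ∀ x u, c * (x ⬝ᵥ x) ≤ ownCost C i x u)
    (hstage : ∀ x u, c * ownCost C i x u ≤ stageCost S C i x u (vS x))
    (he : ∀ x, advEnergy S i (vS x) ≤ e * (x ⬝ᵥ x))
    (ha : ∀ v, 0 ≤ C.β ^ 2 * advCost S C i v ∧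
      C.β ^ 2 * advCost S C i v ≤ a * advEnergy S i v)
    (hup : ∀ x v, stageCost S C i x (k₀ x) v + V (S.next i x (k₀ x) v) ≤ V x)
    (hlo : ∀ x u, V x ≤ stageCost S C i x u (vS x) + V (S.next i x u (vS x))) :
    IsMinmaxStrategy S C i (fun _ => k₀) ∧
      ∀ x₀, worstCost S C i x₀ (fun _ => k₀) = (V x₀ : EReal) := by
  have hown : ∀ x u, 0 ≤ ownCost C i x u := fun x u =>
    (mul_nonneg hc.le (dotProduct_self_nonneg x)).trans (hcoer x u)
  have hle : ∀ x₀ μ, (V x₀ : EReal) ≤ worstCost S C i x₀ μ := fun x₀ μ =>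
    le_worstCost hVc hc hcoer hstage he ha hlo μ x₀
  have hworst : ∀ x₀, worstCost S C i x₀ (fun _ => k₀) = (V x₀ : EReal) := fun x₀ =>
    le_antisymm (iSup_le fun v => totalCost_le hV hown ha hup x₀ v.2) (hle x₀ _)
  refine ⟨fun x₀ => ⟨?_, fun μ' => (hworst x₀).trans_le (hle x₀ μ')⟩, hworst⟩
  -- Against `vS`, `c` times the own cost is at most the stage cost, whose partial sums are bounded
  -- by `V x₀`. Hence the saddle policy generates a finite-energy input that attains the maximum.
  have hs : Summable fun k => ownCost C i (feedbackTraj S i (fun _ => k₀) vS x₀ k)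
      (k₀ (feedbackTraj S i (fun _ => k₀) vS x₀ k)) := by
    refine summable_of_sum_range_le (fun k => hown _ _) (c := c⁻¹ * V x₀) fun T => ?_
    rw [inv_mul_eq_div, le_div_iff₀ hc, mul_comm]
    have h1 := sum_stageCost_le hup
      (fun k => vS (feedbackTraj S i (fun _ => k₀) vS x₀ k)) x₀ T
    have htr : ∀ k, S.traj i (fun _ => k₀)
        (fun k => vS (feedbackTraj S i (fun _ => k₀) vS x₀ k)) x₀ k
        = feedbackTraj S i (fun _ => k₀) vS x₀ k := fun k =>
      traj_eq_feedbackTraj (T := k) (fun _ _ => rfl) _ le_rfl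
    simp only [htr] at h1
    refine le_trans ?_ (le_trans (le_add_of_nonneg_right (hV _)) h1)
    rw [Finset.mul_sum]
    exact Finset.sum_le_sum fun k _ => hstage _ _
  obtain ⟨hfin, -⟩ := finiteEnergy_feedbackTraj hc hcoer he hs
  refine ⟨_, hfin, ?_⟩
  rw [hworst]
  exact le_antisymm (totalCost_le hV hown ha hup x₀ hfin)
    (le_totalCost_feedback hVc hc hcoer he ha hlo hs)

end Minmax

/-! ### Stacking the adversarial inputs of an agent into one vector. -/

section Adversary

variable {N n p q : ℕ} (S : MultiAgentSystem N n p q) (C : CostWeights N n p q) (i : Fin N)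

/-- The index set of the entries of an adversarial input of agent `i`. -/
abbrev AdvIndex : Type := (S.Nbr i × Fin p) ⊕ (Fin q ⊕ (S.Nbr i × Fin q))

variable {S i} in
/-- An adversarial input as a vector. -/
def toVec (v : S.Adv i) : AdvIndex S i → ℝ :=
  Sum.elim (fun a => v.1 a.1 a.2) (Sum.elim v.2.1 fun a => v.2.2 a.1 a.2)

variable {S i} in
/-- A vector as an adversarial input. -/
def ofVec (b : AdvIndex S i → ℝ) : S.Adv i :=
  (fun j a => b (Sum.inl (j, a)), fun a => b (Sum.inr (Sum.inl a)),
    fun j a => b (Sum.inr (Sum.inr (j, a))))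

variable {S i}

@[simp] lemma ofVec_toVec (v : S.Adv i) : ofVec (toVec v) = v := rfl

@[simp] lemma toVec_ofVec (b : AdvIndex S i → ℝ) : toVec (ofVec b) = b := by
  ext (a | a | a) <;> rfl

lemma continuous_ofVec : Continuous (ofVec : (AdvIndex S i → ℝ) → S.Adv i) := by
  unfold ofVec
  fun_prop

lemma toVec_dotProduct (v w : S.Adv i) : toVec v ⬝ᵥ toVec w
    = ∑ j, v.1 j ⬝ᵥ w.1 j + v.2.1 ⬝ᵥ w.2.1 + ∑ j, v.2.2 j ⬝ᵥ w.2.2 j := by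
  simp [dotProduct, toVec, Fintype.sum_sum_type, Fintype.sum_prod_type, add_assoc]

lemma advEnergy_eq (v : S.Adv i) : advEnergy S i v = toVec v ⬝ᵥ toVec v :=
  (toVec_dotProduct v v).symm

variable (S i)

/-- The input matrix of the adversary. -/
def advMatrix : Matrix (Fin n) (AdvIndex S i) ℝ :=
  Matrix.of fun k => Sum.elim (fun a => S.adj i a.1 * S.B a.1 k a.2)
    (Sum.elim (fun a => -(S.gain i * S.E i k a)) fun a => S.adj i a.1 * S.E a.1 k a.2)

/-- The weight of the adversarial input. -/
def advWeight : Matrix (AdvIndex S i) (AdvIndex S i) ℝ :=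
  Matrix.of fun s r => match s, r with
    | Sum.inl a, Sum.inl b => if a.1 = b.1 then C.R i a.1 a.2 b.2 else 0
    | Sum.inr (Sum.inl a), Sum.inr (Sum.inl b) => C.T i i a b
    | Sum.inr (Sum.inr a), Sum.inr (Sum.inr b) => if a.1 = b.1 then C.T i a.1 a.2 b.2 else 0
    | _, _ => 0

/-- The component of the adversarial input an entry belongs to. -/
def advLab : AdvIndex S i → Fin 3 := Sum.elim (fun _ => 0) (Sum.elim (fun _ => 1) fun _ => 2)

/-- The zero-sum game that agent `i` plays against its adversarial inputs. -/
def agentGame {β : ℝ} {Q : Matrix (Fin n) (Fin n) ℝ} {R : Matrix (Fin p) (Fin p) ℝ}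
    (hβ : 0 < β) (hQ : Q.PosDef) (hR : R.PosDef) :
    ZeroSumGame (Fin n) (Fin p) (AdvIndex S i) where
  A := S.A
  B := -(S.gain i • S.B i)
  D := advMatrix S i
  Q := Q
  R := R
  β := β
  lab := advLab S i
  Q_symm := isSymm_of_isHermitian hQ.isHermitian
  Q_pos := pos_of_posDef hQ
  R_symm := isSymm_of_isHermitian hR.isHermitian
  R_pos := pos_of_posDef hR
  β_pos := hβ

variable {S C i}

lemma advMatrix_mulVec (v : S.Adv i) : advMatrix S i *ᵥ toVec v
    = ∑ j : S.Nbr i, S.adj i j • (S.B j *ᵥ v.1 j) - S.gain i • (S.E i *ᵥ v.2.1)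
      + ∑ j : S.Nbr i, S.adj i j • (S.E j *ᵥ v.2.2 j) := by
  ext k
  simp only [mulVec, dotProduct, advMatrix, toVec, of_apply, Fintype.sum_sum_type,
    Fintype.sum_prod_type, Sum.elim_inl, Sum.elim_inr, Pi.add_apply, Pi.sub_apply,
    Finset.sum_apply, Pi.smul_apply, smul_eq_mul, Finset.mul_sum, mul_assoc, neg_mul,
    Finset.sum_neg_distrib]
  ring

lemma advMatrix_transpose_mulVec (y : Fin n → ℝ) : (advMatrix S i)ᵀ *ᵥ y
    = toVec (S := S) (i := i) (fun j => S.adj i j • ((S.B j)ᵀ *ᵥ y), (-S.gain i) • ((S.E i)ᵀ *ᵥ y),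
      fun j => S.adj i j • ((S.E j)ᵀ *ᵥ y)) := by
  ext (a | a | a) <;>
  simp [mulVec, dotProduct, advMatrix, toVec, Finset.mul_sum, mul_assoc]

lemma advWeight_mulVec (v : S.Adv i) : advWeight S C i *ᵥ toVec v
    = toVec (S := S) (i := i) (fun j => C.R i j *ᵥ v.1 j, C.T i i *ᵥ v.2.1,
      fun j => C.T i j *ᵥ v.2.2 j) := by
  ext (a | a | a) <;>
  simp [mulVec, dotProduct, advWeight, toVec, Fintype.sum_prod_type, Finset.sum_ite_irrel,
    Finset.sum_ite_eq]

lemma qf_advWeight (v : S.Adv i) : qf (advWeight S C i) (toVec v) = advCost S C i v := by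
  rw [qf, advWeight_mulVec, toVec_dotProduct]
  rfl

lemma next_eq (x : Fin n → ℝ) (u : Fin p → ℝ) (v : S.Adv i) :
    S.next i x u v = S.A *ᵥ x + (-(S.gain i • S.B i)) *ᵥ u + advMatrix S i *ᵥ toVec v := by
  rw [advMatrix_mulVec, MultiAgentSystem.next, neg_mulVec, smul_mulVec]
  abel

section

variable {Q : Matrix (Fin n) (Fin n) ℝ} {R : Matrix (Fin p) (Fin p) ℝ} {β : ℝ}
  {hβ : 0 < β} {hQ : Q.PosDef} {hR : R.PosDef}

/-- The game is built from `β`, `Q`, `R` rather than from `C`, because `τ` must be found before the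
adversarial weights are given. The hypotheses match the two descriptions. -/
lemma qOfValue_eq (h1 : C.β = β) (h2 : C.Q i = Q) (h3 : C.R i i = R)
    (P : Matrix (Fin n) (Fin n) ℝ) (x : Fin n → ℝ) (u : Fin p → ℝ) (v : S.Adv i) :
    qOfValue S C i (quad P) x u v
      = (agentGame S i hβ hQ hR).qFun (advWeight S C i) P x u (toVec v) := by
  rw [qOfValue, stageCost, ownCost, next_eq, ZeroSumGame.qFun, qf_advWeight, h1, h2, h3]
  rfl

lemma isWeight_advWeight {τ : ℝ} (hτ : 0 < τ) (h : AdvWeightsAtLeast S C τ i) :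
    (agentGame S i hβ hQ hR).IsWeight τ⁻¹ (advWeight S C i) where
  symm := by
    have hs : ∀ {m : ℕ} {X : Matrix (Fin m) (Fin m) ℝ}, (X - τ • 1).PosSemidef →
        ∀ a b, X b a = X a b := fun {m X} hX a b => by
      have h1 := (isSymm_of_isHermitian hX.isHermitian).apply a b
      simp only [Matrix.sub_apply, Matrix.smul_apply, one_apply, eq_comm (a := b)] at h1
      linarith
    ext s r
    obtain (a | a | a) := s <;> obtain (b | b | b) := r <;>
      simp only [transpose_apply, advWeight, of_apply]
    · by_cases hab : a.1 = b.1
      · simp [hab, hs (h.2 b.1).1 a.2 b.2]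
      · simp [hab, Ne.symm hab]
    · exact hs h.1 a b
    · by_cases hab : a.1 = b.1
      · simp [hab, hs (h.2 b.1).2 a.2 b.2]
      · simp [hab, Ne.symm hab]
  block := by
    rintro (a | a | a) (b | b | b) hab <;> simp_all [advWeight, agentGame, advLab]
  pos := inv_pos.2 hτ
  ge := fun v => by
    have hs : ∀ {m : ℕ} {X : Matrix (Fin m) (Fin m) ℝ}, (X - τ • 1).PosSemidef →
        ∀ y, τ * (y ⬝ᵥ y) ≤ y ⬝ᵥ (X *ᵥ y) := fun {m X} hX y => by
      have h1 := qf_nonneg_of_posSemidef hX y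
      rw [qf_sub, qf_smul, qf_one] at h1
      simpa [qf] using h1
    rw [inv_mul_eq_div, le_div_iff₀ hτ, mul_comm, ← toVec_ofVec v, qf, advWeight_mulVec,
      toVec_dotProduct, toVec_dotProduct, mul_add, mul_add, Finset.mul_sum, Finset.mul_sum]
    exact add_le_add (add_le_add (Finset.sum_le_sum fun j _ => hs (h.2 j).1 _) (hs h.1 _))
      (Finset.sum_le_sum fun j _ => hs (h.2 j).2 _)

lemma stable_of_admissible {K : Matrix (Fin p) (Fin n) ℝ} (hK : S.Admissible i K) :
    Stable ((agentGame S i hβ hQ hR).A + (agentGame S i hβ hQ hR).B * K) := by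
  intro x
  refine (hK x).congr fun k => ?_
  induction k with
  | zero => simp
  | succ k ih =>
    rw [Function.iterate_succ_apply', ih, next_eq, pow_succ', ← mulVec_mulVec]
    have h0 : toVec (0 : S.Adv i) = 0 := by ext (a | a | a) <;> rfl
    rw [h0, mulVec_zero, add_zero, add_mulVec, ← mulVec_mulVec]
    rfl

end

/-- Componentwise maximization, in terms of vectors. -/
lemma isAdvUpdate_iff {G : ZeroSumGame (Fin n) (Fin p) (AdvIndex S i)} (hlab : G.lab = advLab S i)
    {f : S.Adv i → ℝ} {ψ : (AdvIndex S i → ℝ) → ℝ} (hf : ∀ v, f v = ψ (toVec v)) (b₀ b : S.Adv i) :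
    IsAdvUpdate S f b₀ b ↔ ∀ c d, (∀ s, G.lab s ≠ c → d s = 0) →
      ψ (G.mix c (toVec b₀) (toVec b) + d) ≤ ψ (G.mix c (toVec b₀) (toVec b)) := by
  have m0 : toVec (b.1, b₀.2.1, b₀.2.2) = G.mix 0 (toVec b₀) (toVec b) := by
    ext (a | a | a) <;> simp [ZeroSumGame.mix, hlab, advLab, toVec]
  have m1 : toVec (b₀.1, b.2.1, b₀.2.2) = G.mix 1 (toVec b₀) (toVec b) := by
    ext (a | a | a) <;> simp [ZeroSumGame.mix, hlab, advLab, toVec]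
  have m2 : toVec (b₀.1, b₀.2.1, b.2.2) = G.mix 2 (toVec b₀) (toVec b) := by
    ext (a | a | a) <;> simp [ZeroSumGame.mix, hlab, advLab, toVec]
  simp only [IsAdvUpdate, hf, m0, m1, m2]
  constructor
  · rintro ⟨h0, h1, h2⟩ c d hd
    have hc : c = 0 ∨ c = 1 ∨ c = 2 := by fin_cases c <;> simp
    have hz : ∀ s, advLab S i s ≠ c → d s = 0 := fun s hs => hd s (by rwa [hlab])
    rcases hc with rfl | rfl | rfl
    · have e : G.mix 0 (toVec b₀) (toVec b) + d
          = toVec ((ofVec (G.mix 0 (toVec b₀) (toVec b) + d)).1, b₀.2.1, b₀.2.2) := by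
        ext (a | a | a)
        · rfl
        · have := hz (Sum.inr (Sum.inl a)) (by simp [advLab])
          simp [ZeroSumGame.mix, hlab, advLab, toVec, this]
        · have := hz (Sum.inr (Sum.inr a)) (by simp [advLab])
          simp [ZeroSumGame.mix, hlab, advLab, toVec, this]
      rw [e]
      exact h0 _
    · have e : G.mix 1 (toVec b₀) (toVec b) + d
          = toVec (b₀.1, (ofVec (G.mix 1 (toVec b₀) (toVec b) + d)).2.1, b₀.2.2) := by
        ext (a | a | a)
        · have := hz (Sum.inl a) (by simp [advLab])
          simp [ZeroSumGame.mix, hlab, advLab, toVec, this]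
        · rfl
        · have := hz (Sum.inr (Sum.inr a)) (by simp [advLab])
          simp [ZeroSumGame.mix, hlab, advLab, toVec, this]
      rw [e]
      exact h1 _
    · have e : G.mix 2 (toVec b₀) (toVec b) + d
          = toVec (b₀.1, b₀.2.1, (ofVec (G.mix 2 (toVec b₀) (toVec b) + d)).2.2) := by
        ext (a | a | a)
        · have := hz (Sum.inl a) (by simp [advLab])
          simp [ZeroSumGame.mix, hlab, advLab, toVec, this]
        · have := hz (Sum.inr (Sum.inl a)) (by simp [advLab])
          simp [ZeroSumGame.mix, hlab, advLab, toVec, this]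
        · rfl
      rw [e]
      exact h2 _
  · intro h
    refine ⟨fun c => ?_, fun c => ?_, fun c => ?_⟩
    · have := h 0 (toVec (c, b₀.2.1, b₀.2.2) - G.mix 0 (toVec b₀) (toVec b)) (by
        intro s hs
        rw [hlab] at hs
        obtain (a | a | a) := s <;> simp [ZeroSumGame.mix, hlab, advLab, toVec] at hs ⊢)
      rwa [add_sub_cancel] at this
    · have := h 1 (toVec (b₀.1, c, b₀.2.2) - G.mix 1 (toVec b₀) (toVec b)) (by
        intro s hs
        rw [hlab] at hs
        obtain (a | a | a) := s <;> simp [ZeroSumGame.mix, hlab, advLab, toVec] at hs ⊢)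
      rwa [add_sub_cancel] at this
    · have := h 2 (toVec (b₀.1, b₀.2.1, c) - G.mix 2 (toVec b₀) (toVec b)) (by
        intro s hs
        rw [hlab] at hs
        obtain (a | a | a) := s <;> simp [ZeroSumGame.mix, hlab, advLab, toVec] at hs ⊢)
      rwa [add_sub_cancel] at this

end Adversary

/-! ### Policy evaluation and improvement in matrix form. -/

section Agent

variable {N n p q : ℕ} {S : MultiAgentSystem N n p q} {C : CostWeights N n p q} {i : Fin N}
  {G : ZeroSumGame (Fin n) (Fin p) (AdvIndex S i)} {W : Matrix (AdvIndex S i) (AdvIndex S i) ℝ}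
  {t : ℝ} {K : Matrix (Fin p) (Fin n) ℝ} {M : Matrix (AdvIndex S i) (Fin n) ℝ}

/-- The adversarial policies `v = W⁻¹ M x`. -/
def advPolicy (W : Matrix (AdvIndex S i) (AdvIndex S i) ℝ) (M : Matrix (AdvIndex S i) (Fin n) ℝ)
    (x : Fin n → ℝ) : S.Adv i := ofVec (W⁻¹ *ᵥ (M *ᵥ x))

@[simp] lemma toVec_advPolicy (x : Fin n → ℝ) :
    toVec (advPolicy W M x) = W⁻¹ *ᵥ (M *ᵥ x) := toVec_ofVec _

lemma advPolicy_zero (x : Fin n → ℝ) : advPolicy W (0 : Matrix (AdvIndex S i) (Fin n) ℝ) x = 0 := by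
  rw [advPolicy, zero_mulVec, mulVec_zero]
  rfl

lemma tendsto_advPolicy {α : Type*} {l : Filter α} {Mf : α → Matrix (AdvIndex S i) (Fin n) ℝ}
    (h : Tendsto Mf l (𝓝 M)) (x : Fin n → ℝ) :
    Tendsto (fun y => advPolicy W (Mf y) x) l (𝓝 (advPolicy W M x)) := by
  have hc : Continuous fun M : Matrix (AdvIndex S i) (Fin n) ℝ => W⁻¹ *ᵥ (M *ᵥ x) := by fun_prop
  exact ((continuous_ofVec.comp hc).tendsto M).comp h

lemma tendsto_qOfValue {α : Type*} {l : Filter α} {Pf : α → Matrix (Fin n) (Fin n) ℝ}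
    {P : Matrix (Fin n) (Fin n) ℝ} (h : Tendsto Pf l (𝓝 P)) (x : Fin n → ℝ) (u : Fin p → ℝ)
    (v : S.Adv i) : Tendsto (fun y => qOfValue S C i (quad (Pf y)) x u v) l
      (𝓝 (qOfValue S C i (quad P) x u v)) := by
  refine tendsto_const_nhds.add ?_
  exact ((continuous_qf.comp (Continuous.prodMk_left (S.next i x u v))).tendsto P).comp h

lemma solvesQEquation_of_wellPosed (hW : G.IsWeight t W) (hq : ∀ P x u v,
      qOfValue S C i (quad P) x u v = G.qFun W P x u (toVec v)) (h : G.WellPosed t W⁻¹ K M) :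
    SolvesQEquation S C i (fun x => K *ᵥ x) (advPolicy W M)
      (qOfValue S C i (quad (G.value W⁻¹ K M))) := by
  have h1 : ∀ x, qOfValue S C i (quad (G.value W⁻¹ K M)) x (K *ᵥ x) (advPolicy W M x)
      = quad (G.value W⁻¹ K M) x := fun x => by
    rw [hq, toVec_advPolicy, h.qFun_eq hW, quad_eq_qf]
  refine ⟨⟨_, h.value_isSymm hW, fun _ _ _ => rfl, h1⟩, fun x => ?_⟩
  rw [h1 (S.next i x (K *ᵥ x) (advPolicy W M x))]
  rfl

/-- The evaluation step leaves no choice: a symmetric solution satisfies the Lyapunov equation,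
whose solution is unique under `WellPosed`. -/
lemma eq_of_solvesQEquation (hW : G.IsWeight t W) (hq : ∀ P x u v,
      qOfValue S C i (quad P) x u v = G.qFun W P x u (toVec v)) (h : G.WellPosed t W⁻¹ K M)
    {u : (Fin n → ℝ) → Fin p → ℝ} {v : (Fin n → ℝ) → S.Adv i}
    {F : (Fin n → ℝ) → (Fin p → ℝ) → S.Adv i → ℝ} (hu : ∀ x, u x = K *ᵥ x)
    (hv : ∀ x, v x = advPolicy W M x) (hF : SolvesQEquation S C i u v F) (x : Fin n → ℝ)
    (a : Fin p → ℝ) (b : S.Adv i) :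
    F x a b = qOfValue S C i (quad (G.value W⁻¹ K M)) x a b := by
  obtain ⟨⟨P, hs, h1, h2⟩, -⟩ := hF
  rw [h1, h.eq_value hW hs fun x => ?_]
  rw [← quad_eq_qf, ← h2, h1, hq, hu, hv, toVec_advPolicy]

lemma isAdvUpdate_advPolicy_iff (hW : G.IsWeight t W) (hlab : G.lab = advLab S i)
    (hq : ∀ P x u v, qOfValue S C i (quad P) x u v = G.qFun W P x u (toVec v))
    (h : G.WellPosed t W⁻¹ K M) (x : Fin n → ℝ) (b : S.Adv i) :
    IsAdvUpdate S (qOfValue S C i (quad (G.value W⁻¹ K M)) x (K *ᵥ x)) (advPolicy W M x) b ↔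
      b = advPolicy W (G.advStep W⁻¹ K M) x := by
  rw [isAdvUpdate_iff hlab (ψ := G.qFun W (G.value W⁻¹ K M) x (K *ᵥ x)) (fun v => hq _ _ _ _),
    toVec_advPolicy, h.isBlockMax_iff hW]
  constructor
  · intro hb
    rw [advPolicy, ← hb, ofVec_toVec]
  · rintro rfl
    rw [toVec_advPolicy]

lemma isMin_qOfValue_iff (hW : G.IsWeight t W)
    (hq : ∀ P x u v, qOfValue S C i (quad P) x u v = G.qFun W P x u (toVec v))
    (h : G.WellPosed t W⁻¹ K M) (x : Fin n → ℝ) (u : Fin p → ℝ) :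
    (∀ a, qOfValue S C i (quad (G.value W⁻¹ K M)) x u (advPolicy W M x)
      ≤ qOfValue S C i (quad (G.value W⁻¹ K M)) x a (advPolicy W M x)) ↔
      u = G.ctrlStep W⁻¹ K M *ᵥ x := by
  simp only [hq, toVec_advPolicy, h.isMin_iff hW]

/-- Brings a stationarity condition into the form used in the DTHJ equation; the 2 in the
denominator cancels the factor in `gradQuad`. -/
lemma eq_smul_inv_mulVec {m : ℕ} {X : Matrix (Fin m) (Fin m) ℝ} (hX : Pos X) {b c : ℝ} (hb : b ≠ 0)
    {F : Matrix (Fin m) (Fin n) ℝ} {P : Matrix (Fin n) (Fin n) ℝ} {y : Fin m → ℝ} {x : Fin n → ℝ}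
    (h : b • (X *ᵥ y) = c • (F *ᵥ (P *ᵥ x))) :
    y = (c / (2 * b)) • (X⁻¹ *ᵥ (F *ᵥ gradQuad P x)) := by
  have h1 : X *ᵥ y = (c / b) • (F *ᵥ (P *ᵥ x)) := by
    rw [div_eq_inv_mul, mul_smul, ← h, smul_smul, inv_mul_cancel₀ hb, one_smul]
  have h2 : y = X⁻¹ *ᵥ (X *ᵥ y) := by
    rw [mulVec_mulVec, nonsing_inv_mul _ hX.isUnit_det, one_mulVec]
  rw [h2, h1, gradQuad, mulVec_smul, mulVec_smul, mulVec_smul, smul_smul]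
  congr 1
  field_simp

lemma pos_of_sub_posSemidef {m : ℕ} {X : Matrix (Fin m) (Fin m) ℝ} {τ : ℝ} (hτ : 0 < τ)
    (hX : (X - τ • (1 : Matrix (Fin m) (Fin m) ℝ)).PosSemidef) : Pos X := fun y hy => by
  have h1 := qf_nonneg_of_posSemidef hX y
  rw [qf_sub, qf_smul, qf_one] at h1
  have h2 := mul_pos hτ (ZeroSumGame.dotProduct_self_pos hy)
  linarith

end Agent

/-! ### Fixed points solve the DTHJ equation and are minmax. -/

section Saddle

variable {N n p q : ℕ} {S : MultiAgentSystem N n p q} {C : CostWeights N n p q} {i : Fin N}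
  {t τ β : ℝ} {Q : Matrix (Fin n) (Fin n) ℝ} {R : Matrix (Fin p) (Fin p) ℝ}
  {hβ : 0 < β} {hQ : Q.PosDef} {hR : R.PosDef}
  {K : Matrix (Fin p) (Fin n) ℝ} {M : Matrix (AdvIndex S i) (Fin n) ℝ}

local notation "𝒢" => agentGame S i hβ hQ hR
local notation "𝒲" => advWeight S C i

lemma next_advPolicy (x : Fin n → ℝ) :
    S.next i x (K *ᵥ x) (advPolicy 𝒲 M x) = ZeroSumGame.closedLoop 𝒢 (𝒲)⁻¹ K M *ᵥ x := by
  rw [next_eq, toVec_advPolicy, ZeroSumGame.closedLoop_mulVec]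
  rfl

lemma solvesDTHJ_of_fixedPoint (h1 : C.β = β) (h2 : C.Q i = Q) (h3 : C.R i i = R) (hτ : 0 < τ)
    (hC : AdvWeightsAtLeast S C τ i) (hW : ZeroSumGame.IsWeight 𝒢 t 𝒲)
    (h : ZeroSumGame.WellPosed 𝒢 t (𝒲)⁻¹ K M) (hM : ZeroSumGame.advStep 𝒢 (𝒲)⁻¹ K M = M)
    (hK : ZeroSumGame.ctrlStep 𝒢 (𝒲)⁻¹ K M = K) :
    SolvesDTHJ S C i (ZeroSumGame.value 𝒢 (𝒲)⁻¹ K M) (fun x => K *ᵥ x) (advPolicy 𝒲 M) := by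
  have hq := qOfValue_eq (S := S) (hβ := hβ) (hQ := hQ) (hR := hR) h1 h2 h3
  set P := ZeroSumGame.value 𝒢 (𝒲)⁻¹ K M
  have hβ2 : C.β ^ 2 ≠ 0 := by rw [h1]; positivity
  -- The stationarity condition for the stacked input, unfolded into its three components so that
  -- each can be read off separately.
  have hadv : ∀ x, C.β ^ 2 • toVec (S := S) (i := i) (fun j => C.R i j *ᵥ (advPolicy 𝒲 M x).1 j,
      C.T i i *ᵥ (advPolicy 𝒲 M x).2.1, fun j => C.T i j *ᵥ (advPolicy 𝒲 M x).2.2 j)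
      = toVec (S := S) (i := i) (fun j => S.adj i j • ((S.B j)ᵀ *ᵥ (P *ᵥ
        S.next i x (K *ᵥ x) (advPolicy 𝒲 M x))), (-S.gain i) • ((S.E i)ᵀ *ᵥ (P *ᵥ
        S.next i x (K *ᵥ x) (advPolicy 𝒲 M x))), fun j => S.adj i j • ((S.E j)ᵀ *ᵥ (P *ᵥ
        S.next i x (K *ᵥ x) (advPolicy 𝒲 M x)))) := fun x => by
    have h4 := congrArg (fun T => T *ᵥ x) (h.adv_stationary hM)
    simp only [smul_mulVec, ← mulVec_mulVec] at h4
    rw [← next_advPolicy] at h4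
    rw [← advWeight_mulVec, ← advMatrix_transpose_mulVec, toVec_advPolicy, hW.mulVec_inv, h1]
    exact h4
  have hval : ∀ x, qOfValue S C i (quad P) x (K *ᵥ x) (advPolicy 𝒲 M x) = quad P x := fun x => by
    rw [hq, toVec_advPolicy, h.qFun_eq hW, quad_eq_qf]
  refine ⟨fun x => ?_, fun x => ?_, fun x j => ?_, fun x j => ?_, fun x => (hval x).symm,
    fun x u => ?_, fun x => ⟨⟨_, hval x⟩, ?_⟩⟩
  · have h4 := congrArg (fun T => T *ᵥ x) (h.ctrl_stationary hK)
    simp only [add_mulVec, ← mulVec_mulVec, zero_mulVec] at h4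
    rw [← next_advPolicy] at h4
    have h5 : (1 : ℝ) • (C.R i i *ᵥ (K *ᵥ x)) = S.gain i • ((S.B i)ᵀ *ᵥ (P *ᵥ
        S.next i x (K *ᵥ x) (advPolicy 𝒲 M x))) := by
      have h5 : R *ᵥ (K *ᵥ x) = -((-(S.gain i • S.B i))ᵀ *ᵥ (P *ᵥ
          S.next i x (K *ᵥ x) (advPolicy 𝒲 M x))) := eq_neg_of_add_eq_zero_left h4
      rw [one_smul, h3, h5, transpose_neg, transpose_smul, neg_mulVec, smul_mulVec, neg_neg]
    have h6 := eq_smul_inv_mulVec (h3 ▸ pos_of_posDef hR) one_ne_zero h5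
    rwa [mul_one] at h6
  · have h4 : C.β ^ 2 • (C.T i i *ᵥ (advPolicy 𝒲 M x).2.1) = (-S.gain i) • ((S.E i)ᵀ *ᵥ (P *ᵥ
        S.next i x (K *ᵥ x) (advPolicy 𝒲 M x))) :=
      funext fun a => congrFun (hadv x) (Sum.inr (Sum.inl a))
    rw [← neg_div]
    exact eq_smul_inv_mulVec (pos_of_sub_posSemidef hτ hC.1) hβ2 h4
  · have h4 : C.β ^ 2 • (C.R i j *ᵥ (advPolicy 𝒲 M x).1 j) = S.adj i j • ((S.B j)ᵀ *ᵥ (P *ᵥ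
        S.next i x (K *ᵥ x) (advPolicy 𝒲 M x))) :=
      funext fun a => congrFun (hadv x) (Sum.inl (j, a))
    exact eq_smul_inv_mulVec (pos_of_sub_posSemidef hτ (hC.2 j).1) hβ2 h4
  · have h4 : C.β ^ 2 • (C.T i j *ᵥ (advPolicy 𝒲 M x).2.2 j) = S.adj i j • ((S.E j)ᵀ *ᵥ (P *ᵥ
        S.next i x (K *ᵥ x) (advPolicy 𝒲 M x))) :=
      funext fun a => congrFun (hadv x) (Sum.inr (Sum.inr (j, a)))
    exact eq_smul_inv_mulVec (pos_of_sub_posSemidef hτ (hC.2 j).2) hβ2 h4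
  · obtain ⟨v, hv⟩ := h.exists_max hW x u
    refine ⟨_, ⟨⟨ofVec v, rfl⟩, ?_⟩, ?_⟩
    · rintro _ ⟨b, rfl⟩
      rw [hq, hq, toVec_ofVec]
      exact hv _
    · rw [hq, toVec_ofVec, quad_eq_qf]
      exact (h.le_qFun hW hK x u).trans (hv _)
  · rintro _ ⟨b, rfl⟩
    rw [hq, quad_eq_qf]
    exact h.qFun_le hW hM x _

lemma isMinmaxStrategy_of_fixedPoint (h1 : C.β = β) (h2 : C.Q i = Q) (h3 : C.R i i = R)
    (hW : ZeroSumGame.IsWeight 𝒢 t 𝒲)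
    (h : ZeroSumGame.WellPosed 𝒢 t (𝒲)⁻¹ K M) (hM : ZeroSumGame.advStep 𝒢 (𝒲)⁻¹ K M = M)
    (hK : ZeroSumGame.ctrlStep 𝒢 (𝒲)⁻¹ K M = K) :
    IsMinmaxStrategy S C i (fun _ x => K *ᵥ x) ∧ ∀ x₀, worstCost S C i x₀ (fun _ x => K *ᵥ x)
      = ((quad (ZeroSumGame.value 𝒢 (𝒲)⁻¹ K M) x₀ : ℝ) : EReal) := by
  have hq := qOfValue_eq (S := S) (hβ := hβ) (hQ := hQ) (hR := hR) h1 h2 h3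
  obtain ⟨c₁, hc₁, hcoer⟩ := (pos_of_posDef hQ).exists_coercive
  obtain ⟨c₂, hc₂, hcost⟩ := h.cost_pos.exists_dominates Q
  obtain ⟨c₃, hc₃, hdom⟩ :=
    (ZeroSumGame.pos_smul_one (σ := AdvIndex S i) one_pos).exists_dominates (𝒲)
  have hQ0 := (pos_of_posDef hQ).nonneg
  have hR0 := (pos_of_posDef hR).nonneg
  have hown : ∀ x u, ownCost C i x u = qf Q x + qf R u := fun x u => by
    rw [ownCost, h2, h3]; rfl
  -- One constant for three bounds: `c₁` for coercivity in the state, `c₂` for the state cost left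
  -- after paying for the worst adversary, and 1 for the control cost.
  set c := min c₁ (min c₂ 1)
  have hc0 : 0 < c := by positivity
  have hcc₁ : c ≤ c₁ := min_le_left _ _
  have hcc₂ : c ≤ c₂ := (min_le_right _ _).trans (min_le_left _ _)
  have hcc₃ : c ≤ 1 := (min_le_right _ _).trans (min_le_right _ _)
  refine isMinmaxStrategy_of_saddle (V := quad (ZeroSumGame.value 𝒢 (𝒲)⁻¹ K M))
    (k₀ := fun x => K *ᵥ x) (vS := advPolicy 𝒲 M) (c := c)
    -- `e` is the squared Frobenius norm of the adversarial gain, and `a` comes from the upper bound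
    -- `c₃⁻¹` on the weight.
    (e := ∑ k, ∑ l, ((𝒲)⁻¹ * M) k l ^ 2) (a := β ^ 2 * c₃⁻¹)
    h.value_pos.nonneg ?_ hc0 (fun x u => ?_) (fun x u => ?_) (fun x => ?_) (fun v => ?_)
    (fun x v => ?_) (fun x u => ?_)
  · have hcont : Continuous (qf (ZeroSumGame.value 𝒢 (𝒲)⁻¹ K M)) :=
      continuous_qf.comp (Continuous.prodMk_right _)
    have := hcont.tendsto 0
    rwa [qf_zero] at this
  · rw [hown]
    have h4 := mul_le_mul_of_nonneg_right hcc₁ (dotProduct_self_nonneg x)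
    linarith [hcoer x, hR0 u]
  · rw [stageCost, hown, ← qf_advWeight, toVec_advPolicy, hW.qf_inv, h1]
    have h4 := hcost x
    rw [qf_sub, qf_smul] at h4
    change c₂ * qf Q x ≤ qf Q x - β ^ 2 * _ at h4
    have h5 := mul_le_mul_of_nonneg_right hcc₂ (hQ0 x)
    have h6 := mul_le_mul_of_nonneg_right hcc₃ (hR0 u)
    linarith
  · rw [advEnergy_eq, toVec_advPolicy, mulVec_mulVec]
    exact dotProduct_self_mulVec_le _ x
  · rw [← qf_advWeight, advEnergy_eq, h1]
    have h4 := hdom (toVec v)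
    rw [one_smul, qf_one] at h4
    have h5 : qf 𝒲 (toVec v) ≤ c₃⁻¹ * (toVec v ⬝ᵥ toVec v) := by
      rw [inv_mul_eq_div, le_div_iff₀ hc₃, mul_comm]
      exact h4
    refine ⟨mul_nonneg (sq_nonneg _) (hW.weight_pos.nonneg _), ?_⟩
    rw [mul_assoc]
    exact mul_le_mul_of_nonneg_left h5 (sq_nonneg _)
  · have := h.qFun_le hW hM x (toVec v)
    rwa [← hq] at this
  · have := h.le_qFun hW hK x u
    rwa [← toVec_advPolicy, ← hq] at this

end Saddle

/-! ### Existence of the matrix iteration. -/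

namespace ZeroSumGame

variable {ι κ σ : Type} [Fintype ι] [DecidableEq ι] [Fintype κ] [DecidableEq κ]
  [Fintype σ] [DecidableEq σ] (G : ZeroSumGame ι κ σ)

/-- The gains at the start of the outer steps of the policy iteration; `w h` tells whether the
adversarial gains are kept after outer step `h`. -/
def outerState (E : Matrix σ σ ℝ) (K₀ : Matrix κ ι ℝ) (w : ℕ → Bool) :
    ℕ → Matrix κ ι ℝ × Matrix σ ι ℝ
  | 0 => (K₀, 0)
  | h + 1 =>
    let y := outerState E K₀ w h
    let L := limUnder atTop fun z => (G.advStep E y.1)^[z] y.2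
    (G.ctrlStep E y.1 L, if w h then L else 0)

/-- Existence needs no convergence: `limUnder` has some value even without a limit, and the
conditions on limits are then void. -/
lemma exists_isPolicyIteration (E : Matrix σ σ ℝ) (K₀ : Matrix κ ι ℝ) (w : ℕ → Bool) :
    ∃ Ks Ms, G.IsPolicyIteration E K₀ Ks Ms ∧ (∀ h, w h = false → Ms (h + 1) 0 = 0) ∧
      ∀ h L, w h = true → Tendsto (Ms h) atTop (𝓝 L) → Ms (h + 1) 0 = L := by
  refine ⟨fun h => (G.outerState E K₀ w h).1,
    fun h z => (G.advStep E (G.outerState E K₀ w h).1)^[z] (G.outerState E K₀ w h).2,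
    ⟨rfl, rfl, fun h z => Function.iterate_succ_apply' _ _ _, fun h L hL => ?_⟩,
    fun h hw => ?_, fun h L hw hL => ?_⟩
  · have h1 := hL.limUnder_eq
    refine ⟨?_, ?_⟩
    · simp only [outerState, h1]
    · simp only [outerState, h1, Function.iterate_zero, id]
      cases w h <;> simp
  · simp [outerState, hw]
  · simp only [outerState, hL.limUnder_eq, hw, Function.iterate_zero, id, if_true]

end ZeroSumGame

/-! ### Runs of the algorithm and the matrix iteration. -/

section Runs

variable {N n p q : ℕ} {S : MultiAgentSystem N n p q} {C : CostWeights N n p q}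
  {K₀ : Fin N → Matrix (Fin p) (Fin n) ℝ} {warm : ℕ → Fin N → Bool}

/-- The gains `Ks`, `Ms` of agent `i` in the policy iteration, with limits `Ls` of the inner
loops. -/
structure AgentIteration (S : MultiAgentSystem N n p q) (C : CostWeights N n p q) (i : Fin N)
    (G : ZeroSumGame (Fin n) (Fin p) (AdvIndex S i)) (t : ℝ) (K₀ : Matrix (Fin p) (Fin n) ℝ)
    (w : ℕ → Bool) (Ks : ℕ → Matrix (Fin p) (Fin n) ℝ)
    (Ms : ℕ → ℕ → Matrix (AdvIndex S i) (Fin n) ℝ)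
    (Ls : ℕ → Matrix (AdvIndex S i) (Fin n) ℝ) : Prop where
  weight : G.IsWeight t (advWeight S C i)
  lab_eq : G.lab = advLab S i
  qOfValue_eq : ∀ P x u v,
    qOfValue S C i (quad P) x u v = G.qFun (advWeight S C i) P x u (toVec v)
  policyIteration : G.IsPolicyIteration (advWeight S C i)⁻¹ K₀ Ks Ms
  cold : ∀ h, w h = false → Ms (h + 1) 0 = 0
  warm : ∀ h, w h = true → Ms (h + 1) 0 = Ls h
  inner_wellPosed : ∀ h z, G.WellPosed t (advWeight S C i)⁻¹ (Ks h) (Ms h z)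
  limit_wellPosed : ∀ h, G.WellPosed t (advWeight S C i)⁻¹ (Ks h) (Ls h)
  inner_tendsto : ∀ h, Tendsto (Ms h) atTop (𝓝 (Ls h))

namespace AgentIteration

variable {i : Fin N} {G : ZeroSumGame (Fin n) (Fin p) (AdvIndex S i)} {t : ℝ}
  {Ks : ℕ → Matrix (Fin p) (Fin n) ℝ} {Ms : ℕ → ℕ → Matrix (AdvIndex S i) (Fin n) ℝ}
  {Ls : ℕ → Matrix (AdvIndex S i) (Fin n) ℝ}

lemma tendsto_q {k₀ : Matrix (Fin p) (Fin n) ℝ} {w : ℕ → Bool}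
    (d : AgentIteration S C i G t k₀ w Ks Ms Ls) (h : ℕ) (x : Fin n → ℝ)
    (a : Fin p → ℝ) (b : S.Adv i) :
    Tendsto (fun z => qOfValue S C i (quad (G.value (advWeight S C i)⁻¹ (Ks h) (Ms h z))) x a b)
      atTop (𝓝 (qOfValue S C i (quad (G.value (advWeight S C i)⁻¹ (Ks h) (Ls h))) x a b)) :=
  tendsto_qOfValue ((d.limit_wellPosed h).tendsto_value tendsto_const_nhds (d.inner_tendsto h)) x a b

lemma run_q (d : AgentIteration S C i G t (K₀ i) (fun h => warm h i) Ks Ms Ls)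
    (r : Run S C K₀ warm) {h z : ℕ} (hu : ∀ x, r.u h i x = Ks h *ᵥ x)
    (hv : ∀ x, r.v h z i x = advPolicy (advWeight S C i) (Ms h z) x) (x : Fin n → ℝ)
    (a : Fin p → ℝ) (b : S.Adv i) :
    r.F h z i x a b = qOfValue S C i (quad (G.value (advWeight S C i)⁻¹ (Ks h) (Ms h z))) x a b :=
  eq_of_solvesQEquation d.weight d.qOfValue_eq (d.inner_wellPosed h z) hu hv (r.evaluate h z i)
    x a b

lemma run_adv_of_zero (d : AgentIteration S C i G t (K₀ i) (fun h => warm h i) Ks Ms Ls)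
    (r : Run S C K₀ warm) {h : ℕ} (hu : ∀ x, r.u h i x = Ks h *ᵥ x)
    (hv : ∀ x, r.v h 0 i x = advPolicy (advWeight S C i) (Ms h 0) x) (z : ℕ) (x : Fin n → ℝ) :
    r.v h z i x = advPolicy (advWeight S C i) (Ms h z) x := by
  induction z generalizing x with
  | zero => exact hv x
  | succ z ih =>
    have h1 := r.improve_v h z i x
    rw [funext fun b => d.run_q r hu ih x (r.u h i x) b, hu, ih,
      isAdvUpdate_advPolicy_iff d.weight d.lab_eq d.qOfValue_eq (d.inner_wellPosed h z)] at h1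
    rw [h1, d.policyIteration.inner_succ]

/-- Control gain and start of the inner loop are carried together through the induction. They
determine the whole inner loop, and its limits determine the next pair because the minimizing
control is unique. -/
lemma run_start (d : AgentIteration S C i G t (K₀ i) (fun h => warm h i) Ks Ms Ls)
    (r : Run S C K₀ warm) (h : ℕ) : (∀ x, r.u h i x = Ks h *ᵥ x) ∧
      ∀ x, r.v h 0 i x = advPolicy (advWeight S C i) (Ms h 0) x := by
  induction h with
  | zero =>
    refine ⟨fun x => ?_, fun x => ?_⟩
    · rw [r.init_u, d.policyIteration.outer_zero]
    · rw [r.init_v, d.policyIteration.inner_zero, advPolicy_zero]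
  | succ h ih =>
    have hv := d.run_adv_of_zero r ih.1 ih.2
    have hlim : ∀ x, Tendsto (fun z => r.v h z i x) atTop
        (𝓝 (advPolicy (advWeight S C i) (Ls h) x)) := fun x => by
      simp only [hv]
      exact tendsto_advPolicy (d.inner_tendsto h) x
    refine ⟨fun x => ?_, fun x => ?_⟩
    · have h1 := r.improve_u h i _ _ hlim (fun x a b => by
        simp only [d.run_q r ih.1 (hv _)]
        exact d.tendsto_q h x a b) x
      rw [isMin_qOfValue_iff d.weight d.qOfValue_eq (d.limit_wellPosed h)] at h1
      rw [h1, (d.policyIteration.outer_succ h _ (d.inner_tendsto h)).1]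
    · cases hw : warm h i
      · rw [r.restart h i hw, d.cold h hw, advPolicy_zero]
      · rw [r.continue_v h i hw _ hlim, d.warm h hw]

lemma run_ctrl (d : AgentIteration S C i G t (K₀ i) (fun h => warm h i) Ks Ms Ls)
    (r : Run S C K₀ warm) (h : ℕ) (x : Fin n → ℝ) : r.u h i x = Ks h *ᵥ x :=
  (d.run_start r h).1 x

lemma run_adv (d : AgentIteration S C i G t (K₀ i) (fun h => warm h i) Ks Ms Ls)
    (r : Run S C K₀ warm) (h z : ℕ) (x : Fin n → ℝ) :
    r.v h z i x = advPolicy (advWeight S C i) (Ms h z) x :=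
  d.run_adv_of_zero r (d.run_start r h).1 (d.run_start r h).2 z x

lemma run_qFun (d : AgentIteration S C i G t (K₀ i) (fun h => warm h i) Ks Ms Ls)
    (r : Run S C K₀ warm) (h z : ℕ) (x : Fin n → ℝ) (a : Fin p → ℝ) (b : S.Adv i) :
    r.F h z i x a b = qOfValue S C i (quad (G.value (advWeight S C i)⁻¹ (Ks h) (Ms h z))) x a b :=
  d.run_q r (d.run_ctrl r h) (d.run_adv r h z) x a b

end AgentIteration

/-- The characterizations of the updates are equivalences, so the policies of the matrix iteration
also satisfy the clauses of a run. -/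
lemma nonempty_run {t : ℝ} {G : ∀ i, ZeroSumGame (Fin n) (Fin p) (AdvIndex S i)}
    {Ks : Fin N → ℕ → Matrix (Fin p) (Fin n) ℝ}
    {Ms : ∀ i, ℕ → ℕ → Matrix (AdvIndex S i) (Fin n) ℝ}
    {Ls : ∀ i, ℕ → Matrix (AdvIndex S i) (Fin n) ℝ}
    (d : ∀ i, AgentIteration S C i (G i) t (K₀ i) (fun h => warm h i) (Ks i) (Ms i) (Ls i)) :
    Nonempty (Run S C K₀ warm) := by
  refine ⟨⟨fun h i x => Ks i h *ᵥ x, fun h z i => advPolicy (advWeight S C i) (Ms i h z),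
    fun h z i => qOfValue S C i (quad ((G i).value (advWeight S C i)⁻¹ (Ks i h) (Ms i h z))),
    fun i x => ?_, fun i x => ?_, fun h z i => ?_, fun h z i x => ?_, fun h i vL FL hv hF x => ?_,
    fun h i hw x => ?_, fun h i hw vL hv x => ?_⟩⟩
  · rw [(d i).policyIteration.outer_zero]
  · rw [(d i).policyIteration.inner_zero, advPolicy_zero]
  · exact solvesQEquation_of_wellPosed (d i).weight (d i).qOfValue_eq ((d i).inner_wellPosed h z)
  · rw [isAdvUpdate_advPolicy_iff (d i).weight (d i).lab_eq (d i).qOfValue_eq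
      ((d i).inner_wellPosed h z), (d i).policyIteration.inner_succ]
  · have h1 := tendsto_nhds_unique (hv x) (tendsto_advPolicy ((d i).inner_tendsto h) x)
    have h2 := fun a b => tendsto_nhds_unique (hF x a b) ((d i).tendsto_q h x a b)
    simp only [h1, h2]
    rw [isMin_qOfValue_iff (d i).weight (d i).qOfValue_eq ((d i).limit_wellPosed h),
      ((d i).policyIteration.outer_succ h _ ((d i).inner_tendsto h)).1]
  · rw [(d i).cold h hw, advPolicy_zero]
  · rw [(d i).warm h hw]
    exact tendsto_nhds_unique (tendsto_advPolicy ((d i).inner_tendsto h) x) (hv x)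

end Runs

end GraphicalGame

end

/-! ### The theorem, assembled agent by agent. -/

theorem theorem2 {N n p q : ℕ} (S : GraphicalGame.MultiAgentSystem N n p q)
    (β : ℝ) (hβ : 0 < β)
    (Q : Fin N → Matrix (Fin n) (Fin n) ℝ) (hQ : ∀ i, (Q i).PosDef)
    (R₀ : Fin N → Matrix (Fin p) (Fin p) ℝ) (hR₀ : ∀ i, (R₀ i).PosDef)
    (K₀ : Fin N → Matrix (Fin p) (Fin n) ℝ) (hK₀ : ∀ i, S.Admissible i (K₀ i)) :
    ∃ τ : ℝ, 0 < τ ∧ ∀ C : GraphicalGame.CostWeights N n p q,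
      C.β = β → C.Q = Q → (∀ i, C.R i i = R₀ i) →
      (∀ i, GraphicalGame.AdvWeightsAtLeast S C τ i) →
      ∃ (P : Fin N → Matrix (Fin n) (Fin n) ℝ) (K : Fin N → Matrix (Fin p) (Fin n) ℝ)
        (vS : (i : Fin N) → (Fin n → ℝ) → S.Adv i),
        -- the optimal solution of the DTHJ equation and the minmax solution
        (∀ i, (P i).PosDef ∧
          GraphicalGame.SolvesDTHJ S C i (P i) (fun x => K i *ᵥ x) (vS i) ∧
          GraphicalGame.IsMinmaxStrategy S C i (fun _ x => K i *ᵥ x) ∧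
          ∀ x₀, GraphicalGame.worstCost S C i x₀ (fun _ x => K i *ᵥ x)
            = ((GraphicalGame.quad (P i) x₀ : ℝ) : EReal)) ∧
        ∀ warm : ℕ → Fin N → Bool,
          -- the algorithm can be carried out
          Nonempty (GraphicalGame.Run S C K₀ warm) ∧
          ∀ (r : GraphicalGame.Run S C K₀ warm) (i : Fin N),
            -- the control policies converge to the minmax solution
            (∀ x, Tendsto (fun h => r.u h i x) atTop (𝓝 (K i *ᵥ x))) ∧
            -- all inner loops converge, and the Q-functions converge to the optimal one
            (∃ (vL : ℕ → (Fin n → ℝ) → S.Adv i)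
              (FL : ℕ → (Fin n → ℝ) → (Fin p → ℝ) → S.Adv i → ℝ),
              (∀ h x, Tendsto (fun z => r.v h z i x) atTop (𝓝 (vL h x))) ∧
              (∀ h x a b, Tendsto (fun z => r.F h z i x a b) atTop (𝓝 (FL h x a b))) ∧
              ∀ x a b, Tendsto (fun h => FL h x a b) atTop
                (𝓝 (GraphicalGame.qOfValue S C i (GraphicalGame.quad (P i)) x a b))) ∧
            -- the stopping criteria of the inner and of the outer loop are met for all tolerances
            (∀ h, ∀ ε > 0, ∀ᶠ z in atTop, ∀ x b,
              r.F h z i x (r.u h i x) b ≤ r.F h z i x (r.u h i x) (r.v h z i x) + ε * (x ⬝ᵥ x)) ∧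
            (∀ ε > 0, ∀ᶠ h in atTop, ∀ᶠ z in atTop, ∀ x a,
              r.F h z i x (r.u h i x) (r.v h z i x)
                ≤ r.F h z i x a (r.v h z i x) + ε * (x ⬝ᵥ x)) := by
  have hε := fun i => GraphicalGame.ZeroSumGame.policyIteration_converges
    (G := GraphicalGame.agentGame S i hβ (hQ i) (hR₀ i))
    (GraphicalGame.stable_of_admissible (hK₀ i))
  choose ε hε0 hε using hε
  have hsum : ∀ i, (ε i)⁻¹ ≤ ∑ j, (ε j)⁻¹ := fun i =>
    Finset.single_le_sum (f := fun j => (ε j)⁻¹) (fun j _ => (inv_pos.2 (hε0 j)).le)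
      (Finset.mem_univ i)
  have hτ : 0 < 1 + ∑ j, (ε j)⁻¹ :=
    add_pos_of_pos_of_nonneg one_pos (Finset.sum_nonneg fun j _ => (inv_pos.2 (hε0 j)).le)
  -- This `τ` exceeds every `(ε i)⁻¹`, so `t = τ⁻¹` is below all thresholds at once; the 1 makes the
  -- comparison strict and keeps `τ` positive without agents.
  refine ⟨1 + ∑ j, (ε j)⁻¹, hτ, fun C h1 h2 h3 hC => ?_⟩
  set t := (1 + ∑ j, (ε j)⁻¹)⁻¹
  have hW := fun i => GraphicalGame.isWeight_advWeight (hβ := hβ) (hQ := hQ i) (hR := hR₀ i) hτ (hC i)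
  have hlt : ∀ i, t < ε i := fun i =>
    inv_lt_of_inv_lt₀ (hε0 i) ((hsum i).trans_lt (lt_one_add _))
  have key := fun i => hε i t (GraphicalGame.advWeight S C i)⁻¹
    (by rw [abs_of_pos (inv_pos.2 hτ)]; exact hlt i)
    (fun a b => ((hW i).abs_inv_le a b).trans_lt (hlt i))
  choose K M hwp hM hK hrun using key
  have h2' : ∀ i, C.Q i = Q i := fun i => by rw [h2]
  refine ⟨_, K, fun i => GraphicalGame.advPolicy (GraphicalGame.advWeight S C i) (M i), fun i =>
    ⟨(hwp i).value_pos.posDef ((hwp i).value_isSymm (hW i)),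
      GraphicalGame.solvesDTHJ_of_fixedPoint h1 (h2' i) (h3 i) hτ (hC i) (hW i) (hwp i) (hM i) (hK i),
      GraphicalGame.isMinmaxStrategy_of_fixedPoint h1 (h2' i) (h3 i) (hW i) (hwp i) (hM i) (hK i)⟩,
    fun warm => ?_⟩
  choose Ks Ms hit hcold hwarm using fun i =>
    GraphicalGame.ZeroSumGame.exists_isPolicyIteration
      (GraphicalGame.agentGame S i hβ (hQ i) (hR₀ i)) (GraphicalGame.advWeight S C i)⁻¹ (K₀ i)
      fun h => warm h i
  choose Ls hms hls hKs hLs using fun i => hrun i (Ks i) (Ms i) (hit i)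
  have d : ∀ i, GraphicalGame.AgentIteration S C i
      (GraphicalGame.agentGame S i hβ (hQ i) (hR₀ i)) t (K₀ i) (fun h => warm h i)
      (Ks i) (Ms i) (Ls i) := fun i =>
    { weight := hW i
      lab_eq := rfl
      qOfValue_eq := GraphicalGame.qOfValue_eq h1 (h2' i) (h3 i)
      policyIteration := hit i
      cold := hcold i
      warm := fun h hw => hwarm i h _ hw (hls i h).1
      inner_wellPosed := hms i
      limit_wellPosed := fun h => (hls i h).2.1
      inner_tendsto := fun h => (hls i h).1 }
  refine ⟨GraphicalGame.nonempty_run d, fun r i => ⟨fun x => ?_, ⟨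
    fun h => GraphicalGame.advPolicy (GraphicalGame.advWeight S C i) (Ls i h),
    fun h => GraphicalGame.qOfValue S C i (GraphicalGame.quad
      ((GraphicalGame.agentGame S i hβ (hQ i) (hR₀ i)).value (GraphicalGame.advWeight S C i)⁻¹
        (Ks i h) (Ls i h))), fun h x => ?_,
    fun h x a b => ?_, fun x a b => ?_⟩, fun h δ hδ => ?_, fun δ hδ => ?_⟩⟩
  · simp only [(d i).run_ctrl r]
    have hc : Continuous fun K : Matrix (Fin p) (Fin n) ℝ => K *ᵥ x := by fun_prop
    exact (hc.tendsto (K i)).comp (hKs i)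
  · simp only [(d i).run_adv r]
    exact GraphicalGame.tendsto_advPolicy ((d i).inner_tendsto h) x
  · simp only [(d i).run_qFun r]
    exact (d i).tendsto_q h x a b
  · exact GraphicalGame.tendsto_qOfValue ((hwp i).tendsto_value (hKs i) (hLs i)) x a b
  · filter_upwards [((d i).limit_wellPosed h).eventually_adv_gap (hW i) (hls i h).2.2
      ((d i).inner_tendsto h) ((d i).inner_wellPosed h) hδ] with z hz x b
    simp only [(d i).run_qFun r, (d i).run_ctrl r, (d i).run_adv r, (d i).qOfValue_eq,
      GraphicalGame.toVec_advPolicy]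
    exact hz x _
  · filter_upwards [(hwp i).eventually_ctrl_gap (hW i) (hK i) (hKs i) (hLs i)
      (d i).inner_tendsto (d i).limit_wellPosed (d i).inner_wellPosed hδ] with h hh
    filter_upwards [hh] with z hz x a
    simp only [(d i).run_qFun r, (d i).run_ctrl r, (d i).run_adv r, (d i).qOfValue_eq,
      GraphicalGame.toVec_advPolicy]
    exact hz x a
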